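/- **Setting.** Identify $\mathbb R^4=\mathbb H$, $\mathbb C=\mathrm{span}_{\mathbb R}\{1,i\}\subset\mathbb H$, and let $\omega(v,w)=\langle jv,w\rangle$. For a one-form $\eta$ on $\mathbb C$ put $(*\eta)(v)=\eta(iv)$. Let $\Gamma\subset\mathbb C$ be a lattice and let $f:T^2=\mathbb C/\Gamma\to\mathbb R^4$ be a Hamiltonian stationary torus, that is, a smooth conformal Lagrangian immersion that is a critical point of the area under all variations $Z$ (smooth vector fields along $f$) for which $\omega(Z,df)$ is exact on $T^2$. Let $N$ be its left normal, $*df=N\,df$, $N^2=-1$. Functions on $T^2$ are regarded as $\Gamma$-periodic functions on $\mathbb C$, and $\mathbb C$ acts on $\mathbb H$-valued functions by right multiplication. * For $h\in\mathrm{Hom}(\Gamma,\mathbb C_*)$ let $H^0_h$ be the space of smooth $\alpha:\mathbb C\to\mathbb H$ with $*d\alpha=N\,d\alpha$ and $\gamma^*\alpha=\alpha h_\gamma$ for all $\gamma\in\Gamma$, and let $\mathrm{Spec}=\{h\mid H^0_h\neq0\}$. The multiplier spectral curve $\Sigma$ is the normalization of $\mathrm{Spec}$. * For $\mu\in\mathbb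 C_*$ let $d^\mu\alpha=d\alpha-\frac12(dN)'\big(N\alpha(a-1)+\alpha b\big)$, where $(dN)'=\frac12(dN-N*dN)$, $a=\frac{\mu+\mu^{-1}}2$, $b=\frac{\mu^{-1}-\mu}2\,i$. Let $\mathrm{Eig}\subset\mathbb C_*\times\mathrm{Hom}(\Gamma,\mathbb C_*)$ be the set of pairs $(\mu,h)$ for which there is a smooth $\alpha\neq0$ with $d^\mu\alpha=0$ and $\gamma^*\alpha=\alpha h_\gamma$ for all $\gamma\in\Gamma$. The eigenline spectral curve $\Sigma_e$ is the normalization of $\mathrm{Eig}$. * The normalization of a one-dimensional analytic set $X$ is a Riemann surface with a proper holomorphic map onto $X$ that is an injective immersion away from the (discrete) preimage of a subset of $X$. * The kernel bundle $\mathcal L$ is the holomorphic line subbundle of the trivial $C^\infty(\mathbb C,\mathbb H)$-bundle over $\Sigma$ whose fibre over $x$ is $H^0_{h(x)}$ whenever $\dim_{\mathbb C}H^0_{h(x)}=1$. The eigenline bundle $\mathcal E$ is the holomorphic line subbundle of the trivial $C^\infty(\mathbb C,\mathbb H)$-bundle over $\Sigma_e$ whose fibre over $x$, lying over $(\mu,h)$,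 is the space of $d^\mu$-parallel sections with multiplier $h$, whenever the monodromy of $d^\mu$ has two different eigenvalues. * A section $\alpha\not\equiv0$ in $H^0_h$ has a prolongation $\hat\varphi=(f\nu+\alpha,\nu):\mathbb C\to\mathbb H^2$, determined by $d\alpha=-df\,\nu$. If $\hat\varphi$ has no zeros, $\hat f=\hat\varphi\,\mathbb H:T^2\to\mathbb{HP}^1=S^4=\mathbb H\cup\{\infty\}$ is called the Darboux transform of $f$ given by $\alpha$. **Theorem.** The normalizations $\Sigma$ and $\Sigma_e$ and the bundles $\mathcal L$ and $\mathcal E$ exist, and $\mathcal L$ and $\mathcal E$ are unique. For any choice of the normalizations the following holds. 1. There is a biholomorphic map $\Phi:\Sigma_e\to\Sigma$ that covers the map $\mathrm{Eig}\to\mathrm{Spec}$, $(\mu,h)\mapsto h$, and it is the only continuous map $\Sigma_e\to\Sigma$ that does so. 2. $\mathcal E_x=\mathcal L_{\Phi(x)}$ for all $x\in\Sigma_e$. 3. There is a holomorphic open embedding $\iota:\Sigma\to\mathbb{CP}^1=\mathbb C\cup\{\infty\}$ with image $\mathbb{CP}^1\setminus\{0,\infty\}$ such that $\mu(x)=\iota(\Phi(x))^2$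 for all $x\in\Sigma_e$. In particular $\Sigma$ compactifies to $\bar\Sigma=\mathbb{CP}^1$ (genus zero) by adding two points, which lie over $\mu=0$ and $\mu=\infty$. 4. $\Sigma$ parametrizes a $\mathbb{CP}^1$-family of Hamiltonian stationary tori isospectral to $f$: with $\iota$ as in 3, there is a continuous map $F:\mathbb{CP}^1\times T^2\to S^4$ such that $F(0,\cdot)=F(\infty,\cdot)=f$ and such that, for every $x\in\Sigma$ and every $0\neq\alpha\in\mathcal L_x$, the map $f^x:=F(\iota(x),\cdot)$ is the Darboux transform of $f$ given by $\alpha$. For all but finitely many $x\in\Sigma$ the map $f^x$ is not constant. Whenever $f^x$ is not constant, it takes values in $\mathbb R^4$ and is a Hamiltonian stationary torus with the same lattice $\Gamma$, possibly with isolated branch points across which its left normal extends smoothly, and it is isospectral to $f$: its sets $\mathrm{Spec}$ and $\mathrm{Eig}$, formed with its left normal, are those of $f$. -/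

import Mathlib

open Set Filter Topology MeasureTheory
open scoped Manifold ContDiff Quaternion

noncomputable section

namespace HSTorus

/-! ### The Riemann sphere as a complex manifold -/

/-- The involution `w ↦ 1 / w` of `ℂP¹ = ℂ ∪ {∞}`. -/
def sphereInv : OnePoint ℂ → OnePoint ℂ
  | none => ((0 : ℂ) : OnePoint ℂ)
  | some w => if w = 0 then OnePoint.infty else ((w⁻¹ : ℂ) : OnePoint ℂ)

theorem sphereInv_infty : sphereInv OnePoint.infty = ((0 : ℂ) : OnePoint ℂ) := rfl

theorem sphereInv_zero : sphereInv ((0 : ℂ) : OnePoint ℂ) = OnePoint.infty := if_pos rfl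

theorem sphereInv_coe {w : ℂ} (hw : w ≠ 0) :
    sphereInv (w : OnePoint ℂ) = ((w⁻¹ : ℂ) : OnePoint ℂ) := if_neg hw

theorem sphereInv_involutive : Function.Involutive sphereInv := by
  intro p
  induction p using OnePoint.rec with
  | infty => rw [sphereInv_infty, sphereInv_zero]
  | coe w =>
    by_cases hw : w = 0
    · rw [hw, sphereInv_zero, sphereInv_infty]
    · rw [sphereInv_coe hw, sphereInv_coe (inv_ne_zero hw), inv_inv]

theorem continuous_sphereInv : Continuous sphereInv := by
  have hcoe : Tendsto (fun w : ℂ => (w : OnePoint ℂ)) (Bornology.cobounded ℂ)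
      (𝓝 OnePoint.infty) := by
    have := OnePoint.tendsto_coe_infty (X := ℂ)
    rwa [coclosedCompact_eq_cocompact, ← Metric.cobounded_eq_cocompact] at this
  rw [continuous_iff_continuousAt]
  intro p
  induction p using OnePoint.rec with
  | infty =>
    rw [OnePoint.continuousAt_infty', coclosedCompact_eq_cocompact,
      ← Metric.cobounded_eq_cocompact, sphereInv_infty]
    have h1 : Tendsto (fun w : ℂ => ((w⁻¹ : ℂ) : OnePoint ℂ)) (Bornology.cobounded ℂ)
        (𝓝 ((0 : ℂ) : OnePoint ℂ)) :=
      (OnePoint.continuous_coe.tendsto 0).comp tendsto_inv₀_cobounded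
    refine h1.congr' ?_
    filter_upwards [Bornology.eventually_ne_cobounded (0 : ℂ)] with w hw
    exact (sphereInv_coe hw).symm
  | coe w =>
    rw [OnePoint.continuousAt_coe]
    by_cases hw : w = 0
    · subst hw
      rw [continuousAt_iff_punctured_nhds]
      have h1 : Tendsto (fun w : ℂ => ((w⁻¹ : ℂ) : OnePoint ℂ)) (𝓝[≠] 0)
          (𝓝 OnePoint.infty) := hcoe.comp tendsto_inv₀_nhdsNE_zero
      have h2 : (sphereInv ∘ (fun w : ℂ => (w : OnePoint ℂ))) 0 = OnePoint.infty :=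
        sphereInv_zero
      rw [h2]
      refine h1.congr' ?_
      filter_upwards [self_mem_nhdsWithin] with w hw
      exact (sphereInv_coe hw).symm
    · have h1 : ContinuousAt (fun w : ℂ => ((w⁻¹ : ℂ) : OnePoint ℂ)) w :=
        OnePoint.continuous_coe.continuousAt.comp (continuousAt_inv₀ hw)
      refine h1.congr ?_
      filter_upwards [isOpen_ne.mem_nhds hw] with v hv
      exact (sphereInv_coe hv).symm

/-- `w ↦ 1 / w` as a homeomorphism of `ℂP¹`. -/
def sphereInvHomeo : OnePoint ℂ ≃ₜ OnePoint ℂ where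
  toEquiv := sphereInv_involutive.toPerm
  continuous_toFun := continuous_sphereInv
  continuous_invFun := continuous_sphereInv

/-- The affine chart `w ↦ w` on `ℂP¹ ∖ {∞}`. -/
def chartZero : OpenPartialHomeomorph (OnePoint ℂ) ℂ :=
  (OnePoint.isOpenEmbedding_coe.toOpenPartialHomeomorph (fun w : ℂ => (w : OnePoint ℂ))).symm

/-- The affine chart `w ↦ 1 / w` on `ℂP¹ ∖ {0}`. -/
def chartInfty : OpenPartialHomeomorph (OnePoint ℂ) ℂ :=
  sphereInvHomeo.toOpenPartialHomeomorph.trans chartZero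

theorem chartZero_source : chartZero.source = range (fun w : ℂ => (w : OnePoint ℂ)) := by
  simp [chartZero]

theorem chartZero_coe (w : ℂ) : chartZero (w : OnePoint ℂ) = w :=
  (OnePoint.isOpenEmbedding_coe.toOpenPartialHomeomorph
    (fun w : ℂ => (w : OnePoint ℂ))).left_inv (by simp)

theorem chartZero_symm (w : ℂ) : chartZero.symm w = (w : OnePoint ℂ) := rfl

theorem chartInfty_source : chartInfty.source = sphereInv ⁻¹' chartZero.source := by
  simp only [chartInfty, OpenPartialHomeomorph.trans_source]
  exact univ_inter _

theorem chartInfty_apply (p : OnePoint ℂ) : chartInfty p = chartZero (sphereInv p) := rfl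

theorem chartInfty_symm (w : ℂ) : chartInfty.symm w = sphereInv (w : OnePoint ℂ) := rfl

instance : ChartedSpace ℂ (OnePoint ℂ) where
  atlas := {chartZero, chartInfty}
  chartAt p := by
    classical
    exact if p = OnePoint.infty then chartInfty else chartZero
  mem_chart_source p := by
    induction p using OnePoint.rec with
    | infty =>
      rw [if_pos rfl, chartInfty_source, chartZero_source]
      exact ⟨0, rfl⟩
    | coe w =>
      rw [if_neg (OnePoint.coe_ne_infty w), chartZero_source]
      exact ⟨w, rfl⟩
  chart_mem_atlas p := by
    split_ifs <;> simp

instance : IsManifold 𝓘(ℂ) ω (OnePoint ℂ) := by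
  have key : ∀ s : Set ℂ, (∀ w ∈ s, w ≠ 0) → ∀ g : ℂ → ℂ, (∀ w ∈ s, g w = w⁻¹) →
      ContDiffOn ℂ ω g s := by
    intro s hs g hg
    refine ContDiffOn.congr (f := fun w : ℂ => w⁻¹) ?_ hg
    exact fun w hw => (contDiffAt_inv ℂ (hs w hw)).contDiffWithinAt
  have hid : ∀ s : Set ℂ, ∀ g : ℂ → ℂ, (∀ w ∈ s, g w = w) → ContDiffOn ℂ ω g s :=
    fun s g hg => contDiffOn_id.congr hg
  have hinv : ∀ w : ℂ, sphereInv (w : OnePoint ℂ) ∈ range (fun w : ℂ => (w : OnePoint ℂ)) →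
      w ≠ 0 := by
    rintro w ⟨v, hv⟩ rfl
    rw [sphereInv_zero] at hv
    exact OnePoint.coe_ne_infty v hv
  refine isManifold_of_contDiffOn _ _ _ ?_
  rintro e e' (rfl | rfl) (rfl | rfl)
  · refine hid _ _ fun w _ => ?_
    simp [chartZero_symm, chartZero_coe]
  · have hs : ∀ w ∈ 𝓘(ℂ).symm ⁻¹' (chartZero.symm.trans chartInfty).source ∩ range 𝓘(ℂ),
        w ≠ 0 := by
      intro w hw
      have hw' := hw.1
      simp only [OpenPartialHomeomorph.trans_source, chartInfty_source, chartZero_source,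
        mem_preimage, mem_inter_iff, modelWithCornersSelf_coe_symm, id, chartZero_symm] at hw'
      exact hinv w hw'.2
    refine key _ hs _ fun w hw => ?_
    simp [chartZero_symm, chartInfty_apply, sphereInv_coe (hs w hw), chartZero_coe]
  · have hs : ∀ w ∈ 𝓘(ℂ).symm ⁻¹' (chartInfty.symm.trans chartZero).source ∩ range 𝓘(ℂ),
        w ≠ 0 := by
      intro w hw
      have hw' := hw.1
      simp only [OpenPartialHomeomorph.trans_source, chartZero_source,
        mem_preimage, mem_inter_iff, modelWithCornersSelf_coe_symm, id, chartInfty_symm] at hw'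
      exact hinv w hw'.2
    refine key _ hs _ fun w hw => ?_
    simp [chartInfty_symm, sphereInv_coe (hs w hw), chartZero_coe]
  · refine hid _ _ fun w _ => ?_
    simp [chartInfty_symm, chartInfty_apply, sphereInv_involutive (w : OnePoint ℂ), chartZero_coe]

/-- A holomorphic embedding of one Riemann surface as an open subset of another one. -/
structure IsHolomorphicOpenEmbedding {S T : Type*} [TopologicalSpace S] [ChartedSpace ℂ S]
    [TopologicalSpace T] [ChartedSpace ℂ T] (i : S → T) : Prop where
  isOpenEmbedding : IsOpenEmbedding i
  holomorphic : MDifferentiable 𝓘(ℂ) 𝓘(ℂ) i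
  mfderiv_ne_zero : ∀ x, mfderiv 𝓘(ℂ) 𝓘(ℂ) i x ≠ 0

/-! ### Normalization of a one-dimensional analytic set -/

/-- `ν : S → Y` is the normalization of the one-dimensional analytic set `X ⊆ Y`.
Here `Y` is the ambient complex manifold, whose topology and complex structure are given by
the family `c` of holomorphic functions on `Y`: a map into `Y` is holomorphic if its
composition with every `c i` is. The normalization is a Riemann surface `S` with a proper
holomorphic map onto `X` that is, away from a discrete set, an injective immersion, i.e. a
biholomorphism onto the complement of a discrete subset `A` of `X`. -/
structure IsNormalization {S Y ι : Type*} [TopologicalSpace S] [ChartedSpace ℂ S]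
    [TopologicalSpace Y] (c : ι → Y → ℂ) (X : Set Y) (ν : S → Y) : Prop where
  holomorphic : ∀ i, MDifferentiable 𝓘(ℂ) 𝓘(ℂ) (fun x => c i (ν x))
  range_eq : range ν = X
  proper : ∀ K ⊆ X, IsCompact K → IsCompact (ν ⁻¹' K)
  generic : ∃ A ⊆ X, IsClosed (ν ⁻¹' A) ∧ IsDiscrete (ν ⁻¹' A) ∧ InjOn ν (ν ⁻¹' A)ᶜ ∧
    ∀ x ∉ ν ⁻¹' A, ∃ i, mfderiv 𝓘(ℂ) 𝓘(ℂ) (fun y => c i (ν y)) x ≠ 0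

/-! ### Surfaces in `ℝ⁴ = ℍ`

Maps from the torus `ℂ / Γ` are `Γ`-periodic maps on `ℂ`. For a one-form `η` on `ℂ` the
Hodge star is `(* η)(v) = η (i v)`. The complex numbers are the span of `1, i` in `ℍ`. -/

/-- The quaternion `j`, whose left multiplication is the complex structure of `ℝ⁴`. -/
def qj : ℍ := ⟨0, 0, 1, 0⟩

/-- The symplectic form `ω(v, w) = ⟨j v, w⟩` on `ℝ⁴ = ℍ`. -/
def omega (v w : ℍ) : ℝ := inner ℝ (qj * v) w

/-- The left normal `N` of a conformal immersion `f`, determined by `* df = N df`. -/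
def leftNormal (f : ℂ → ℍ) (z : ℂ) : ℍ := fderiv ℝ f z Complex.I * (fderiv ℝ f z 1)⁻¹

/-- The map `f` is `Γ`-periodic. -/
def IsPeriodic {E : Type*} (Γ : Submodule ℤ ℂ) (f : ℂ → E) : Prop :=
  ∀ γ ∈ Γ, ∀ z, f (z + γ) = f z

/-- The density of the area induced by `f`. -/
def areaDensity (f : ℂ → ℍ) (z : ℂ) : ℝ :=
  √(‖fderiv ℝ f z 1‖ ^ 2 * ‖fderiv ℝ f z Complex.I‖ ^ 2
    - (inner ℝ (fderiv ℝ f z 1) (fderiv ℝ f z Complex.I)) ^ 2)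

/-- `f` pulls back the symplectic form to zero. -/
def IsLagrangian (f : ℂ → ℍ) : Prop :=
  ∀ z v w, omega (fderiv ℝ f z v) (fderiv ℝ f z w) = 0

/-- The vector field `Z` along the torus `f` is Hamiltonian: the one-form `ω(Z, df)` on
`ℂ / Γ` is exact. -/
def IsHamiltonianVariation (Γ : Submodule ℤ ℂ) (f Z : ℂ → ℍ) : Prop :=
  ContDiff ℝ ∞ Z ∧ IsPeriodic Γ Z ∧ ∃ φ : ℂ → ℝ, ContDiff ℝ ∞ φ ∧ IsPeriodic Γ φ ∧
    ∀ z v, omega (Z z) (fderiv ℝ f z v) = fderiv ℝ φ z v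

/-- `f` is a critical point of the area of the torus under all Hamiltonian variations. The
area is the integral over a fundamental domain of `Γ`. -/
def IsHamiltonianCritical (Γ : Submodule ℤ ℂ) (f : ℂ → ℍ) : Prop :=
  ∀ Z, IsHamiltonianVariation Γ f Z → ∀ D : Set ℂ, IsAddFundamentalDomain Γ D volume →
    HasDerivAt (fun t : ℝ => ∫ z in D, areaDensity (fun w => f w + t • Z w) z) 0 0

/-- A Hamiltonian stationary torus: a conformal Lagrangian immersion of `ℂ / Γ` into `ℝ⁴`
that is critical for the area under Hamiltonian variations. -/
structure IsHamiltonianStationaryTorus (Γ : Submodule ℤ ℂ) (f : ℂ → ℍ) : Prop where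
  smooth : ContDiff ℝ ∞ f
  periodic : IsPeriodic Γ f
  immersion : ∀ z, fderiv ℝ f z 1 ≠ 0
  conformal_norm : ∀ z, ‖fderiv ℝ f z Complex.I‖ = ‖fderiv ℝ f z 1‖
  conformal_inner : ∀ z, inner ℝ (fderiv ℝ f z 1) (fderiv ℝ f z Complex.I) = 0
  lagrangian : IsLagrangian f
  critical : IsHamiltonianCritical Γ f

/-- A branched Hamiltonian stationary torus `f` with left normal `N`: the same for a branched
conformal immersion, i.e. `df` may have isolated zeros, but `N` is smooth across them. -/
structure IsBranchedHamiltonianStationaryTorus (Γ : Submodule ℤ ℂ) (f N : ℂ → ℍ) : Prop where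
  smooth : ContDiff ℝ ∞ f
  periodic : IsPeriodic Γ f
  smooth_normal : ContDiff ℝ ∞ N
  normal_sq : ∀ z, N z * N z = -1
  star_df : ∀ z v, fderiv ℝ f z (Complex.I * v) = N z * fderiv ℝ f z v
  branch_closed : IsClosed {z | fderiv ℝ f z = 0}
  branch_discrete : IsDiscrete {z | fderiv ℝ f z = 0}
  lagrangian : IsLagrangian f
  critical : IsHamiltonianCritical Γ f

/-! ### Multipliers, holomorphic sections and the multiplier spectrum

Multipliers are the elements of `Hom(Γ, ℂ_*)`, i.e. of `AddChar Γ ℂ` (the values of an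
additive character are automatically nonzero). -/

/-- The topology of `Hom(Γ, ℂ_*)` is that of pointwise convergence. -/
instance multiplierTopology (Γ : Submodule ℤ ℂ) : TopologicalSpace (AddChar Γ ℂ) :=
  TopologicalSpace.induced (fun h : AddChar Γ ℂ => (h : Γ → ℂ)) inferInstance

/-- The holomorphic functions `h ↦ h_γ` on `Hom(Γ, ℂ_*)`. -/
def multiplierCoord (Γ : Submodule ℤ ℂ) (γ : Γ) (h : AddChar Γ ℂ) : ℂ := h γ

/-- The holomorphic functions `(μ, h) ↦ μ` and `(μ, h) ↦ h_γ` on `ℂ × Hom(Γ, ℂ_*)`. -/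
def eigCoord (Γ : Submodule ℤ ℂ) : Option Γ → ℂ × AddChar Γ ℂ → ℂ
  | none => fun p => p.1
  | some γ => fun p => p.2 γ

/-- `γ^* α = α h_γ` for all `γ ∈ Γ`. -/
def HasMultiplier (Γ : Submodule ℤ ℂ) (h : AddChar Γ ℂ) (α : ℂ → ℍ) : Prop :=
  ∀ (γ : Γ) (z : ℂ), α (z + γ) = α z * ((h γ : ℂ) : ℍ)

/-- `H⁰_h`: the holomorphic sections `α` of the trivial bundle with complex structure `N`,
`* dα = N dα`, that have multiplier `h`. -/
def holSections (Γ : Submodule ℤ ℂ) (N : ℂ → ℍ) (h : AddChar Γ ℂ) : Set (ℂ → ℍ) :=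
  {α | ContDiff ℝ ∞ α ∧ (∀ z v, fderiv ℝ α z (Complex.I * v) = N z * fderiv ℝ α z v) ∧
    HasMultiplier Γ h α}

/-- The set `Spec` of all multipliers of nontrivial holomorphic sections. -/
def Spec (Γ : Submodule ℤ ℂ) (N : ℂ → ℍ) : Set (AddChar Γ ℂ) :=
  {h | ∃ α ∈ holSections Γ N h, α ≠ 0}

/-! ### The family of flat connections and the eigenvalues of its monodromy -/

/-- The `(1,0)`-part `(dN)' = (dN - N * dN) / 2`. With the mean curvature quantity `H` of a
conformal immersion with left normal `N`, given by `(dN)' = - df H`, one has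
`df H = - (dN)'`. -/
def dNprime (N : ℂ → ℍ) (z v : ℂ) : ℍ :=
  (1 / 2 : ℝ) • (fderiv ℝ N z v - N z * fderiv ℝ N z (Complex.I * v))

/-- `a = (μ + μ⁻¹) / 2`. -/
def paramA (μ : ℂ) : ℂ := (μ + μ⁻¹) / 2

/-- `b = i (μ⁻¹ - μ) / 2`. -/
def paramB (μ : ℂ) : ℂ := (μ⁻¹ - μ) / 2 * Complex.I

/-- `d^μ α = dα + ½ df H (N α (a - 1) + α b)`, evaluated on the tangent vector `v` at `z`,
where `df H = - (dN)'` and complex numbers act by right multiplication. -/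
def dmu (N : ℂ → ℍ) (μ : ℂ) (α : ℂ → ℍ) (z v : ℂ) : ℍ :=
  fderiv ℝ α z v + (1 / 2 : ℝ) • ((-dNprime N z v) *
    (N z * α z * ((paramA μ - 1 : ℂ) : ℍ) + α z * ((paramB μ : ℂ) : ℍ)))

/-- The `d^μ`-parallel sections with multiplier `h`, i.e. the eigenspace of the monodromy of
`d^μ` for the eigenvalue `h`. -/
def eigenSections (Γ : Submodule ℤ ℂ) (N : ℂ → ℍ) (μ : ℂ) (h : AddChar Γ ℂ) : Set (ℂ → ℍ) :=
  {α | ContDiff ℝ ∞ α ∧ (∀ z v, dmu N μ α z v = 0) ∧ HasMultiplier Γ h α}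

/-- The set `Eig` of all `(μ, h)`, `μ ∈ ℂ_*`, such that `h` is an eigenvalue of the monodromy
of `d^μ`. -/
def Eig (Γ : Submodule ℤ ℂ) (N : ℂ → ℍ) : Set (ℂ × AddChar Γ ℂ) :=
  {p | p.1 ≠ 0 ∧ ∃ α ∈ eigenSections Γ N p.1 p.2, α ≠ 0}

/-! ### Line bundles over the spectral curves -/

/-- The set `{α c | c ∈ ℂ}`; complex numbers act on `ℍ`-valued maps from the right. -/
def complexSpan (α : ℂ → ℍ) : Set (ℂ → ℍ) := {σ | ∃ c : ℂ, σ = fun z => α z * (c : ℍ)}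

/-- `V` is complex one-dimensional. -/
def IsComplexLine (V : Set (ℂ → ℍ)) : Prop := ∃ α, α ≠ 0 ∧ V = complexSpan α

/-- The component `u` of `q = u + j v`, `u, v ∈ ℂ`. -/
def compU (q : ℍ) : ℂ := ⟨q.re, q.imI⟩

/-- The component `v` of `q = u + j v`, `u, v ∈ ℂ`. -/
def compV (q : ℍ) : ℂ := ⟨q.imJ, -q.imK⟩

/-- `L` is a holomorphic line subbundle of the trivial bundle over the Riemann surface `S`
whose fibre is the space of smooth maps `ℂ → ℍ`: it is locally spanned by a nowhere
vanishing section that depends holomorphically on the point of `S`. -/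
def IsHolomorphicLineSubbundle {S : Type*} [TopologicalSpace S] [ChartedSpace ℂ S]
    (L : S → Set (ℂ → ℍ)) : Prop :=
  ∀ x₀ : S, ∃ U : Set S, IsOpen U ∧ x₀ ∈ U ∧ ∃ s : S → ℂ → ℍ,
    ContMDiffOn (𝓘(ℝ, ℂ).prod 𝓘(ℝ, ℂ)) 𝓘(ℝ, ℍ) ∞ (fun p : S × ℂ => s p.1 p.2) (U ×ˢ univ) ∧
    (∀ z, MDifferentiableOn 𝓘(ℂ) 𝓘(ℂ) (fun x => compU (s x z)) U) ∧
    (∀ z, MDifferentiableOn 𝓘(ℂ) 𝓘(ℂ) (fun x => compV (s x z)) U) ∧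
    ∀ x ∈ U, s x ≠ 0 ∧ L x = complexSpan (s x)

/-- `L` is the kernel bundle over the normalization `ν : S → Spec`: the holomorphic line
subbundle with `L_x = H⁰_h`, `h = ν x`, wherever `H⁰_h` is complex one-dimensional. -/
def IsKernelBundle {S : Type*} [TopologicalSpace S] [ChartedSpace ℂ S] (Γ : Submodule ℤ ℂ)
    (N : ℂ → ℍ) (ν : S → AddChar Γ ℂ) (L : S → Set (ℂ → ℍ)) : Prop :=
  IsHolomorphicLineSubbundle L ∧
    ∀ x, IsComplexLine (holSections Γ N (ν x)) → L x = holSections Γ N (ν x)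

/-- `E` is the eigenline bundle over the normalization `ν : S → Eig`: the holomorphic line
subbundle given by the eigenline of the monodromy wherever this has two different
eigenvalues. -/
def IsEigenlineBundle {S : Type*} [TopologicalSpace S] [ChartedSpace ℂ S] (Γ : Submodule ℤ ℂ)
    (N : ℂ → ℍ) (ν : S → ℂ × AddChar Γ ℂ) (E : S → Set (ℂ → ℍ)) : Prop :=
  IsHolomorphicLineSubbundle E ∧
    ∀ x, (∃ h, h ≠ (ν x).2 ∧ ((ν x).1, h) ∈ Eig Γ N) →
      E x = eigenSections Γ N (ν x).1 (ν x).2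

/-! ### Darboux transforms -/

/-- The point of `S⁴ = ℍP¹ = ℍ ∪ {∞}` given by a nonzero vector of `ℍ²`; here `q ∈ ℍ` is the
line spanned by `(q, 1)` and `∞` is the line spanned by `(1, 0)`. -/
def toS4 (p : ℍ × ℍ) : OnePoint ℍ :=
  open Classical in
  if p.2 = 0 then OnePoint.infty else ((p.1 * p.2⁻¹ : ℍ) : OnePoint ℍ)

/-- `P` is the prolongation of the section `α` of `V / L ≅ ℍ`, where `V` is the trivial
`ℍ²`-bundle and `L` is the line bundle spanned by `(f, 1)`: it is the lift of `(α, 0)` mod `L`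
whose derivative takes values in `L`. -/
def IsProlongation (f α : ℂ → ℍ) (P : ℂ → ℍ × ℍ) : Prop :=
  ContDiff ℝ ∞ P ∧ (∀ z, (P z).1 - α z = f z * (P z).2) ∧
    ∀ z v, (fderiv ℝ P z v).1 = f z * (fderiv ℝ P z v).2

/-- `F : ℂ → S⁴` is the Darboux transform of `f` given by the prolongation of `α`. -/
def IsDarbouxTransform (f α : ℂ → ℍ) (F : ℂ → OnePoint ℍ) : Prop :=
  ∃ P, IsProlongation f α P ∧ ∀ z, P z ≠ 0 ∧ F z = toS4 (P z)

end HSTorus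

end

open HSTorus

open scoped ComplexConjugate

noncomputable section

namespace HSTorus

/-! ### Complex coordinates on the quaternions -/

/-! A Lagrangian conformal immersion has left normal N = e^{jβ} i with an angle β, and the first
variation formula shows that stationarity under Hamiltonian variations forces β to be harmonic. On a
torus dβ is periodic, so by Liouville it is constant and β is affine; β is not constant, since
otherwise f would be assembled from bounded holomorphic and antiholomorphic functions and could not
be immersed. Thus N is determined by a frequency κ ≠ 0 and a unit number e₀
(`IsHamiltonianStationaryTorus.exists_isPhase`), and everything becomes explicit Fourier analysis.

In the coordinates q = (1 + k) a + (1 - k) b, left multiplication by N exchanges a and b up to unit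
factors and a shift of frequency. The equation *dα = N dα therefore splits into 2 × 2 linear
systems, one for each pair of frequencies (κ(l ± 1), conj κ (r ± 1)), and the determinant vanishes
exactly when l r = 1. So each l ∈ ℂ_* carries one solution `mode κ e₀ l`, and a section with
multiplier h is a finite sum of the modes with `modeMultiplier Γ κ l = h`
(`exists_sum_of_holSections`). The mode is also parallel for d^μ with μ = l², and a parallel section
contains no modes with l² ≠ μ (`eq_sq_of_eigenSections`). Hence Spec and Eig are the images of ℂ_*
under l ↦ h_l and l ↦ (l², h_l).

These maps are proper, immersive and injective off isolated points
(`isNormalizingMap_modeMultiplier`, `isNormalizingMap_eig`). Any normalization of such an image is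
ℂ_* itself (`IsNormalization.exists_coordinate`), which gives Φ and ι; both line bundles are spanned
by the mode, because they are so generically and a holomorphic line bundle is determined by its
generic fibres.

For the Darboux transforms, the mode is an eigenfunction of a directional derivative: dα(τ) = α k
with τ = iκ⁻¹ and k = l⁻¹ - l. This gives the closed formula f - α k⁻¹ α⁻¹ df(τ), which tends to f
for l → 0, ∞ and to the point ∞ for l → ±1. Its left normal is the conjugate of N by α k α⁻¹, which
only changes e₀ by a unit factor (`mode_conjugation`). As the spectra depend on κ alone, the
transforms are isospectral, and an affine phase makes them stationary again. Their branch points are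
isolated because their derivatives are finite exponential sums (`eventually_expSum_ne_zero`). A
constant transform would make the mode periodic, which happens for finitely many l only. -/

/-- The component `a` of `q = (1 + k) a + (1 - k) b`, `a, b ∈ ℂ`. -/
def coordA : ℍ →L[ℝ] ℂ := LinearMap.toContinuousLinearMap
  { toFun := fun q => ⟨(q.re + q.imK) / 2, (q.imI + q.imJ) / 2⟩
    map_add' := fun p q => by apply Complex.ext <;> simp <;> ring
    map_smul' := fun r q => by apply Complex.ext <;> simp <;> ring }

/-- The component `b` of `q = (1 + k) a + (1 - k) b`, `a, b ∈ ℂ`. -/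
def coordB : ℍ →L[ℝ] ℂ := LinearMap.toContinuousLinearMap
  { toFun := fun q => ⟨(q.re - q.imK) / 2, (q.imI - q.imJ) / 2⟩
    map_add' := fun p q => by apply Complex.ext <;> simp <;> ring
    map_smul' := fun r q => by apply Complex.ext <;> simp <;> ring }

/-- The quaternion `(1 + k) a + (1 - k) b`. -/
def ofCoord : ℂ × ℂ →L[ℝ] ℍ := LinearMap.toContinuousLinearMap
  { toFun := fun p => ⟨p.1.re + p.2.re, p.1.im + p.2.im, p.1.im - p.2.im, p.1.re - p.2.re⟩
    map_add' := fun p q => by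
      ext
      exacts [add_add_add_comm _ _ _ _, add_add_add_comm _ _ _ _, add_sub_add_comm _ _ _ _,
        add_sub_add_comm _ _ _ _]
    map_smul' := fun r q => by
      ext <;> simp only [Prod.smul_fst, Prod.smul_snd, Complex.smul_re, Complex.smul_im,
        smul_eq_mul, ← mul_add, ← mul_sub] <;> rfl }

/-- The quaternion `e i`, where `e` is a number in the span of `1` and `j` (with `j` written
as the imaginary unit). -/
def normalOf : ℂ →L[ℝ] ℍ := LinearMap.toContinuousLinearMap
  { toFun := fun e => ⟨0, e.re, 0, -e.im⟩
    map_add' := fun p q => by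
      ext
      exacts [(add_zero (0 : ℝ)).symm, rfl, (add_zero (0 : ℝ)).symm, neg_add _ _]
    map_smul' := fun r q => by
      ext
      exacts [(mul_zero r).symm, by simp; rfl, (mul_zero r).symm, by simp; exact
          (mul_neg _ _).symm] }

@[simp] theorem re_ofCoord (p : ℂ × ℂ) : (ofCoord p).re = p.1.re + p.2.re := rfl

@[simp] theorem imI_ofCoord (p : ℂ × ℂ) : (ofCoord p).imI = p.1.im + p.2.im := rfl

@[simp] theorem imJ_ofCoord (p : ℂ × ℂ) : (ofCoord p).imJ = p.1.im - p.2.im := rfl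

@[simp] theorem imK_ofCoord (p : ℂ × ℂ) : (ofCoord p).imK = p.1.re - p.2.re := rfl

@[simp] theorem re_normalOf (e : ℂ) : (normalOf e).re = 0 := rfl

@[simp] theorem imI_normalOf (e : ℂ) : (normalOf e).imI = e.re := rfl

@[simp] theorem imJ_normalOf (e : ℂ) : (normalOf e).imJ = 0 := rfl

@[simp] theorem imK_normalOf (e : ℂ) : (normalOf e).imK = -e.im := rfl

@[simp] theorem re_qj : (qj).re = 0 := rfl

@[simp] theorem imI_qj : (qj).imI = 0 := rfl

@[simp] theorem imJ_qj : (qj).imJ = 1 := rfl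

@[simp] theorem imK_qj : (qj).imK = 0 := rfl

theorem coordA_apply (q : ℍ) : coordA q = ⟨(q.re + q.imK) / 2, (q.imI + q.imJ) / 2⟩ := rfl

theorem coordB_apply (q : ℍ) : coordB q = ⟨(q.re - q.imK) / 2, (q.imI - q.imJ) / 2⟩ := rfl

@[simp] theorem coordA_ofCoord (p : ℂ × ℂ) : coordA (ofCoord p) = p.1 := by
  apply Complex.ext <;> simp [coordA_apply]

@[simp] theorem coordB_ofCoord (p : ℂ × ℂ) : coordB (ofCoord p) = p.2 := by
  apply Complex.ext <;> simp [coordB_apply]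

@[simp] theorem ofCoord_coord (q : ℍ) : ofCoord (coordA q, coordB q) = q := by
  ext <;> simp [coordA_apply, coordB_apply] <;> ring

theorem ext_coord {p q : ℍ} (hA : coordA p = coordA q) (hB : coordB p = coordB q) : p = q := by
  rw [← ofCoord_coord p, ← ofCoord_coord q, hA, hB]

@[simp] theorem coordA_mul_coe (q : ℍ) (c : ℂ) : coordA (q * (c : ℍ)) = coordA q * c := by
  apply Complex.ext <;> simp [coordA_apply] <;> ring

@[simp] theorem coordB_mul_coe (q : ℍ) (c : ℂ) : coordB (q * (c : ℍ)) = coordB q * c := by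
  apply Complex.ext <;> simp [coordB_apply] <;> ring

@[simp] theorem coordA_normalOf_mul (e : ℂ) (q : ℍ) :
    coordA (normalOf e * q) = Complex.I * e * coordB q := by
  apply Complex.ext <;> simp [coordA_apply, coordB_apply] <;> ring

@[simp] theorem coordB_normalOf_mul (e : ℂ) (q : ℍ) :
    coordB (normalOf e * q) = Complex.I * conj e * coordA q := by
  apply Complex.ext <;> simp [coordA_apply, coordB_apply] <;> ring

theorem compU_eq (q : ℍ) : compU q = coordA q + coordB q := by
  apply Complex.ext <;> simp [coordA_apply, coordB_apply, compU] <;> ring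

theorem compV_eq (q : ℍ) : compV q = -Complex.I * (coordA q - coordB q) := by
  apply Complex.ext <;> simp [coordA_apply, coordB_apply, compV] <;> ring

theorem coordA_eq (q : ℍ) : coordA q = (compU q + Complex.I * compV q) / 2 := by
  rw [compU_eq, compV_eq]; linear_combination (coordA q - coordB q) / 2 * Complex.I_sq

theorem coordB_eq (q : ℍ) : coordB q = (compU q - Complex.I * compV q) / 2 := by
  rw [compU_eq, compV_eq]; linear_combination -(coordA q - coordB q) / 2 * Complex.I_sq

/-- The quaternion with left multiplication `(a, b) ↦ (m a + n b, conj m b - conj n a)`. -/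
def leftMul (m n : ℂ) : ℍ := ⟨m.re, n.im, m.im, n.re⟩

@[simp] theorem re_leftMul (m n : ℂ) : (leftMul m n).re = m.re := rfl

@[simp] theorem imI_leftMul (m n : ℂ) : (leftMul m n).imI = n.im := rfl

@[simp] theorem imJ_leftMul (m n : ℂ) : (leftMul m n).imJ = m.im := rfl

@[simp] theorem imK_leftMul (m n : ℂ) : (leftMul m n).imK = n.re := rfl

@[simp] theorem coordA_leftMul (m n : ℂ) (q : ℍ) :
    coordA (leftMul m n * q) = m * coordA q + n * coordB q := by
  apply Complex.ext <;> simp [coordA_apply, coordB_apply] <;> ring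

@[simp] theorem coordB_leftMul (m n : ℂ) (q : ℍ) :
    coordB (leftMul m n * q) = conj m * coordB q - conj n * coordA q := by
  apply Complex.ext <;> simp [coordA_apply, coordB_apply] <;> ring

theorem normalOf_eq_leftMul (e : ℂ) : normalOf e = leftMul 0 (Complex.I * e) := by
  ext <;> simp

theorem normalOf_mul_self {e : ℂ} (he : ‖e‖ = 1) : normalOf e * normalOf e = -1 := by
  have h : Complex.normSq e = 1 := by rw [Complex.normSq_eq_norm_sq, he]; norm_num
  rw [Complex.normSq_apply] at h
  ext <;> simp <;> linarith

theorem conj_eq_inv_of_norm {e : ℂ} (he : ‖e‖ = 1) : conj e = e⁻¹ := by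
  rw [Complex.inv_def, Complex.normSq_eq_norm_sq, he]; simp

theorem coordA_smul (r : ℝ) (q : ℍ) : coordA (r • q) = r * coordA q := by
  rw [map_smul, Complex.real_smul]

theorem coordB_smul (r : ℝ) (q : ℍ) : coordB (r • q) = r * coordB q := by
  rw [map_smul, Complex.real_smul]

theorem fderiv_coordA {α : ℂ → ℍ} {z : ℂ} (h : DifferentiableAt ℝ α z) (v : ℂ) :
    fderiv ℝ (fun w => coordA (α w)) z v = coordA (fderiv ℝ α z v) := by
  have := (coordA.hasFDerivAt.comp z h.hasFDerivAt).fderiv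
  rw [show (fun w => coordA (α w)) = coordA ∘ α from rfl, this]; rfl

theorem fderiv_coordB {α : ℂ → ℍ} {z : ℂ} (h : DifferentiableAt ℝ α z) (v : ℂ) :
    fderiv ℝ (fun w => coordB (α w)) z v = coordB (fderiv ℝ α z v) := by
  have := (coordB.hasFDerivAt.comp z h.hasFDerivAt).fderiv
  rw [show (fun w => coordB (α w)) = coordB ∘ α from rfl, this]; rfl

theorem fderiv_normalOf {e : ℂ → ℂ} {z : ℂ} (h : DifferentiableAt ℝ e z) (v : ℂ) :
    fderiv ℝ (fun w => normalOf (e w)) z v = normalOf (fderiv ℝ e z v) := by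
  have := (normalOf.hasFDerivAt.comp z h.hasFDerivAt).fderiv
  rw [show (fun w => normalOf (e w)) = normalOf ∘ e from rfl, this]; rfl

/-! ### Plane waves -/

/-- The exponential `exp (i (p z + q conj z))`. -/
def planeWave (p q z : ℂ) : ℂ := Complex.exp (Complex.I * (p * z + q * conj z))

theorem planeWave_add (p q z w : ℂ) :
    planeWave p q (z + w) = planeWave p q z * planeWave p q w := by
  simp only [planeWave, ← Complex.exp_add, map_add]; ring_nf

theorem planeWave_mul (p q p' q' z : ℂ) :
    planeWave p q z * planeWave p' q' z = planeWave (p + p') (q + q') z := by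
  simp only [planeWave, ← Complex.exp_add]; ring_nf

theorem planeWave_ne_zero (p q z : ℂ) : planeWave p q z ≠ 0 := Complex.exp_ne_zero _

theorem planeWave_zero (p q : ℂ) : planeWave p q 0 = 1 := by simp [planeWave]

theorem planeWave_zero_zero (z : ℂ) : planeWave 0 0 z = 1 := by simp [planeWave]

theorem planeWave_neg (p q z : ℂ) : planeWave (-p) (-q) z = (planeWave p q z)⁻¹ := by
  rw [planeWave, planeWave, ← Complex.exp_neg]; ring_nf

theorem norm_planeWave_conj (p z : ℂ) : ‖planeWave p (conj p) z‖ = 1 := by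
  rw [planeWave, Complex.norm_exp]
  simp; ring

theorem contDiff_planeWave_joint : ContDiff ℝ ∞
    (fun x : ℂ × ℂ × ℂ => planeWave x.1 x.2.1 x.2.2) := by
  have h : ContDiff ℝ ∞ (fun x : ℂ × ℂ × ℂ => conj x.2.2) :=
    Complex.conjCLE.contDiff.comp (contDiff_snd.comp contDiff_snd)
  unfold planeWave
  have h1 : ContDiff ℝ ∞ (fun x : ℂ × ℂ × ℂ => x.1) := contDiff_fst
  have h2 : ContDiff ℝ ∞ (fun x : ℂ × ℂ × ℂ => x.2.1) := contDiff_fst.comp contDiff_snd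
  have h3 : ContDiff ℝ ∞ (fun x : ℂ × ℂ × ℂ => x.2.2) := contDiff_snd.comp contDiff_snd
  exact (contDiff_const.mul ((h1.mul h3).add (h2.mul h))).cexp

theorem contDiff_planeWave (p q : ℂ) : ContDiff ℝ ∞ (planeWave p q) :=
  contDiff_planeWave_joint.comp (contDiff_const.prodMk (contDiff_const.prodMk contDiff_id))

theorem continuous_planeWave (p q : ℂ) : Continuous (planeWave p q) :=
  (contDiff_planeWave p q).continuous

theorem differentiable_planeWave (p q : ℂ) : Differentiable ℝ (planeWave p q) :=
  (contDiff_planeWave p q).differentiable (by simp)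

theorem hasFDerivAt_planeWave (p q z : ℂ) : HasFDerivAt (planeWave p q)
    ((planeWave p q z * Complex.I) • (p • (ContinuousLinearMap.id ℝ ℂ)
      + q • (Complex.conjCLE : ℂ →L[ℝ] ℂ))) z := by
  have h1 : HasFDerivAt (fun w : ℂ => Complex.I * (p * w + q * conj w))
      (Complex.I • (p • (ContinuousLinearMap.id ℝ ℂ) + q • (Complex.conjCLE : ℂ →L[ℝ] ℂ))) z :=
    (((hasFDerivAt_id z).const_mul p).add
      (Complex.conjCLE.hasFDerivAt.const_mul q)).const_mul Complex.I
  have h2 := h1.cexp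
  rwa [smul_smul] at h2

theorem fderiv_planeWave (p q z v : ℂ) : fderiv ℝ (planeWave p q) z v =
    Complex.I * (p * v + q * conj v) * planeWave p q z := by
  rw [(hasFDerivAt_planeWave p q z).fderiv]
  simp; ring

/-- A real linear form `p v + q conj v` vanishes identically only if `p = q = 0`. -/
theorem linear_form_eq {p q p' q' : ℂ} (h : ∀ v : ℂ, p * v + q * conj v = p' * v + q' * conj v) :
    p = p' ∧ q = q' := by
  have h1 := h 1
  have h2 := h Complex.I
  simp only [map_one, mul_one, Complex.conj_I] at h1 h2
  have h3 : p - q = p' - q' := by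
    apply mul_right_cancel₀ Complex.I_ne_zero; linear_combination h2
  constructor
  · linear_combination (h1 + h3) / 2
  · linear_combination (h1 - h3) / 2

end HSTorus

end

open scoped ComplexConjugate Pointwise

noncomputable section

namespace HSTorus

/-! ### Integrals of periodic functions -/

section Periodic

variable {Γ : Submodule ℤ ℂ}

theorem IsPeriodic.comp {E F : Type*} {f : ℂ → E} (hf : IsPeriodic Γ f) (g : E → F) :
    IsPeriodic Γ (fun z => g (f z)) := fun γ hγ z => congrArg g (hf γ hγ z)

theorem IsPeriodic.fderiv {E : Type*} [NormedAddCommGroup E] [NormedSpace ℝ E] {f : ℂ → E}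
    (hf : IsPeriodic Γ f) : IsPeriodic Γ (fderiv ℝ f) := by
  intro γ hγ z
  have h : (fun w => f (w + γ)) = f := funext fun w => hf γ hγ w
  rw [← fderiv_comp_add_right, h]

theorem IsPeriodic.fderiv_apply {E : Type*} [NormedAddCommGroup E] [NormedSpace ℝ E] {f : ℂ → E}
    (hf : IsPeriodic Γ f) (v : ℂ) : IsPeriodic Γ (fun z => _root_.fderiv ℝ f z v) :=
  hf.fderiv.comp (fun L : ℂ →L[ℝ] E => L v)

theorem IsPeriodic.vadd {E : Type*} {f : ℂ → E} (hf : IsPeriodic Γ f) (γ : Γ) (z : ℂ) :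
    f (γ +ᵥ z) = f z := by
  rw [show γ +ᵥ z = z + (γ : ℂ) from add_comm _ _, hf _ γ.2]

/-- `ψ (z + γ) = ψ z * h γ` for complex valued functions. -/
def HasComplexMultiplier (h : AddChar Γ ℂ) (ψ : ℂ → ℂ) : Prop :=
  ∀ (γ : Γ) (z : ℂ), ψ (z + γ) = ψ z * h γ

theorem isPeriodic_mul_planeWave_neg {h : AddChar Γ ℂ} {ψ : ℂ → ℂ}
    (hψ : HasComplexMultiplier h ψ) {p q : ℂ} (hpq : ∀ γ : Γ, planeWave p q γ = h γ) :
    IsPeriodic Γ (fun z => ψ z * planeWave (-p) (-q) z) := by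
  intro γ hγ z
  have h1 := hψ ⟨γ, hγ⟩ z
  have h2 := hpq ⟨γ, hγ⟩
  simp only at h1 h2 ⊢
  rw [planeWave_neg, planeWave_neg, planeWave_add, h1, h2]
  have h3 : h ⟨γ, hγ⟩ ≠ 0 := by rw [← h2]; exact planeWave_ne_zero _ _ _
  field_simp

instance : VAddInvariantMeasure Γ ℂ volume :=
  ⟨fun γ s _ => measure_preimage_add volume (γ : ℂ) s⟩

variable [DiscreteTopology Γ] [IsZLattice ℝ Γ] {D : Set ℂ}

theorem exists_bound_of_periodic {E : Type*} [NormedAddCommGroup E] {f : ℂ → E}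
    (hf : Continuous f) (hp : IsPeriodic Γ f) : ∃ C, ∀ z, ‖f z‖ ≤ C := by
  have h := IsZLattice.isCompact_range_of_periodic Γ f hf fun z w hw => hp w hw z
  obtain ⟨C, hC⟩ := h.isBounded.exists_norm_le
  exact ⟨C, fun z => hC _ (mem_range_self z)⟩

variable (Γ) in
theorem exists_lattice_basis : Nonempty (Module.Basis (Fin 2) ℤ Γ) := by
  have : Module.finrank ℤ Γ = 2 := by rw [ZLattice.rank ℝ Γ, Complex.finrank_real_complex]
  exact ⟨Module.finBasisOfFinrankEq ℤ Γ this⟩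

variable (Γ) in
theorem exists_fundamentalDomain : ∃ D : Set ℂ, IsAddFundamentalDomain Γ D volume := by
  obtain ⟨b⟩ := exists_lattice_basis Γ
  exact ⟨_, ZLattice.isAddFundamentalDomain b volume⟩

theorem volume_lt_top_of_fundamentalDomain (hD : IsAddFundamentalDomain Γ D volume) :
    volume D < ⊤ := by
  obtain ⟨b⟩ := exists_lattice_basis Γ
  rw [hD.measure_eq (ZLattice.isAddFundamentalDomain b volume)]
  exact (ZSpan.fundamentalDomain_isBounded _).measure_lt_top

theorem integrableOn_of_periodic {E : Type*} [NormedAddCommGroup E] {f : ℂ → E}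
    (hD : IsAddFundamentalDomain Γ D volume) (hf : Continuous f) (hp : IsPeriodic Γ f) :
    IntegrableOn f D := by
  obtain ⟨C, hC⟩ := exists_bound_of_periodic hf hp
  exact Measure.integrableOn_of_bounded (volume_lt_top_of_fundamentalDomain hD).ne
    hf.aestronglyMeasurable (ae_of_all _ hC)

/-- A translate of a fundamental domain is again one, and a periodic function has the same integral
over both. -/
theorem setIntegral_comp_add {E : Type*} [NormedAddCommGroup E] [NormedSpace ℝ E] {f : ℂ → E}
    (hD : IsAddFundamentalDomain Γ D volume) (hp : IsPeriodic Γ f) (w : ℂ) :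
    ∫ z in D, f (z + w) = ∫ z in D, f z := by
  have hD' : IsAddFundamentalDomain Γ (w +ᵥ D) volume := by
    refine hD.image_of_equiv (Equiv.addLeft w)
      (measurePreserving_add_left volume (-w)).quasiMeasurePreserving (Equiv.refl _) fun g x => ?_
    change w + (g + x) = g + (w + x)
    ring
  rw [hD.setIntegral_eq hD' hp.vadd]
  have h := (measurePreserving_add_right (volume : Measure ℂ) w).setIntegral_preimage_emb
    (measurableEmbedding_addRight w) f (w +ᵥ D)
  rw [← h]
  congr 2
  ext z
  rw [mem_preimage, mem_vadd_set_iff_neg_vadd_mem]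
  simp

/-- The integral of f(z + t v) over D does not depend on t; differentiate under the integral at t =
0. This replaces Stokes' theorem on the torus. -/
theorem setIntegral_fderiv_eq_zero {E : Type*} [NormedAddCommGroup E] [NormedSpace ℝ E]
    [CompleteSpace E] {f : ℂ → E} (hD : IsAddFundamentalDomain Γ D volume) (hf : ContDiff ℝ 1 f)
    (hp : IsPeriodic Γ f) (v : ℂ) : ∫ z in D, fderiv ℝ f z v = 0 := by
  have hc : Continuous (fun z => fderiv ℝ f z v) :=
    (hf.continuous_fderiv one_ne_zero).clm_apply continuous_const
  obtain ⟨C, hC⟩ := exists_bound_of_periodic hc (hp.fderiv_apply v)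
  have hfin := volume_lt_top_of_fundamentalDomain hD
  have key := (hasDerivAt_integral_of_dominated_loc_of_deriv_le (μ := volume.restrict D)
    (F := fun (t : ℝ) z => f (z + t • v)) (F' := fun t z => fderiv ℝ f (z + t • v) v)
    (x₀ := 0) (s := univ) (bound := fun _ => C) univ_mem
    (Eventually.of_forall fun t => (hf.continuous.comp (by fun_prop)).aestronglyMeasurable)
    (by simpa using (integrableOn_of_periodic hD hf.continuous hp).integrable)
    (by simpa using hc.aestronglyMeasurable)
    (ae_of_all _ fun z t _ => hC _) (integrableOn_const hfin.ne)
    (ae_of_all _ fun z t _ => by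
      have h1 : HasFDerivAt f (fderiv ℝ f (z + t • v)) (z + t • v) :=
        (hf.differentiable one_ne_zero _).hasFDerivAt
      have h2 : HasDerivAt (fun t : ℝ => z + t • v) v t := by
        simpa using ((hasDerivAt_id t).smul_const v).const_add z
      exact h1.comp_hasDerivAt t h2)).2
  simp only [setIntegral_comp_add hD hp] at key
  simpa using key.unique (hasDerivAt_const _ _)

theorem ae_of_ae_fundamentalDomain (hD : IsAddFundamentalDomain Γ D volume) {P : ℂ → Prop}
    (hP : ∀ γ ∈ Γ, ∀ z, P (z + γ) ↔ P z) (h : ∀ᵐ z ∂volume.restrict D, P z) : ∀ᵐ z, P z := by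
  refine hD.measure_zero_of_invariant {z | ¬ P z} (fun γ => ?_) ?_
  · ext z
    rw [mem_vadd_set_iff_neg_vadd_mem]
    have := hP _ (neg_mem γ.2) z
    simp only [mem_ofPred_eq, not_iff_not]
    rw [show -γ +ᵥ z = z + -(γ : ℂ) from add_comm _ _]
    exact this
  · have := ae_iff.1 h
    rwa [Measure.restrict_apply₀'] at this
    exact hD.nullMeasurableSet

theorem eq_zero_of_setIntegral_eq_zero {g : ℂ → ℝ} (hD : IsAddFundamentalDomain Γ D volume)
    (hg : Continuous g) (hp : IsPeriodic Γ g) (h0 : ∀ z, 0 ≤ g z) (hI : ∫ z in D, g z = 0) :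
    g = 0 := by
  have h1 : g =ᵐ[volume.restrict D] 0 :=
    (integral_eq_zero_iff_of_nonneg h0 (integrableOn_of_periodic hD hg hp)).1 hI
  have h2 : g =ᵐ[volume] 0 :=
    ae_of_ae_fundamentalDomain hD (P := fun z => g z = 0) (fun γ hγ z => by rw [hp γ hγ]) h1
  exact (hg.ae_eq_iff_eq volume continuous_zero).1 h2

/-! ### Completeness of the exponentials -/

theorem exists_linear_form (φ : ℂ →ₗ[ℝ] ℂ) : ∃ p q : ℂ, ∀ z, φ z = p * z + q * conj z := by
  refine ⟨(φ 1 - Complex.I * φ Complex.I) / 2, (φ 1 + Complex.I * φ Complex.I) / 2, fun z => ?_⟩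
  have h : φ z = z.re * φ 1 + z.im * φ Complex.I := by
    conv_lhs => rw [show z = z.re • (1 : ℂ) + z.im • Complex.I by simp]
    rw [map_add, map_smul, map_smul, Complex.real_smul, Complex.real_smul]
  rw [h]
  have h1 : conj z = z.re - z.im * Complex.I := by apply Complex.ext <;> simp
  rw [h1]
  nth_rw 3 [← Complex.re_add_im z]
  linear_combination (z.im * φ Complex.I) * Complex.I_sq

variable (Γ) in
/-- The trigonometric polynomials on `ℂ / Γ`. -/
def trigPolynomials : Submodule ℂ (ℂ → ℂ) :=
  Submodule.span ℂ {w | ∃ p q, w = planeWave p q ∧ IsPeriodic Γ w}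

/-- Real coordinates with respect to a lattice basis turn ℂ / Γ into the standard torus, where the
Fourier monomials span a dense subspace of the continuous functions. -/
theorem exists_trigPolynomial_near {ξ : ℂ → ℂ} (hξ : Continuous ξ) (hp : IsPeriodic Γ ξ) {ε : ℝ}
    (hε : 0 < ε) : ∃ T ∈ trigPolynomials Γ, ∀ z, ‖ξ z - T z‖ ≤ ε := by
  obtain ⟨b⟩ := exists_lattice_basis Γ
  set B := b.ofZLatticeBasis ℝ Γ with hB
  let mk : (Fin 2 → ℝ) → UnitAddTorus (Fin 2) := Pi.map fun _ x => (x : UnitAddCircle)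
  have hmk : IsOpenQuotientMap mk :=
    IsOpenQuotientMap.piMap fun _ => QuotientAddGroup.isOpenQuotientMap_mk
  let G : (Fin 2 → ℝ) → ℂ := fun x => ξ (B.equivFun.symm x)
  have hGc : Continuous G :=
    hξ.comp (LinearMap.continuous_of_finiteDimensional (B.equivFun.symm : (Fin 2 → ℝ) →ₗ[ℝ] ℂ))
  have hG : ∀ x y, mk x = mk y → G x = G y := by
    intro x y hxy
    have h1 : ∀ i, ∃ n : ℤ, n • (1 : ℝ) = -x i + y i := fun i =>
      AddSubgroup.mem_zmultiples_iff.1 (QuotientAddGroup.eq.1 (congrFun hxy i))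
    choose n hn using h1
    have h2 : B.equivFun.symm y = B.equivFun.symm x + ((∑ i, n i • b i : Γ) : ℂ) := by
      rw [Module.Basis.equivFun_symm_apply, Module.Basis.equivFun_symm_apply,
        Submodule.coe_sum, ← Finset.sum_add_distrib]
      refine Finset.sum_congr rfl fun i _ => ?_
      have : y i = x i + n i := by have := hn i; simp at this; linarith
      rw [this, hB, Module.Basis.ofZLatticeBasis_apply ℝ Γ b i, add_smul]
      simp
    change ξ _ = ξ _
    rw [h2, hp _ (Submodule.coe_mem _)]
  -- The descended function is defined through an arbitrary choice of lifts; its continuity is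
  -- tested after composition with the quotient map.
  let Φ : C(UnitAddTorus (Fin 2), ℂ) :=
    ⟨fun t => G (Function.surjInv hmk.surjective t), by
      rw [hmk.isQuotientMap.continuous_iff]
      convert hGc using 1
      ext x
      exact hG _ _ (Function.surjInv_eq hmk.surjective _)⟩
  have hΦ : ∀ x, Φ (mk x) = G x := fun x => hG _ _ (Function.surjInv_eq hmk.surjective _)
  have hclosure : Φ ∈ closure ((Submodule.span ℂ
      (range (UnitAddTorus.mFourier (d := Fin 2))) : Submodule ℂ _) : Set C(UnitAddTorus
          (Fin 2), ℂ)) := by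
    have := UnitAddTorus.span_mFourier_closure_eq_top (d := Fin 2)
    rw [← Submodule.topologicalClosure_coe, this]
    trivial
  obtain ⟨T, hT, hdist⟩ := Metric.mem_closure_iff.1 hclosure ε hε
  refine ⟨fun z => T (mk (B.equivFun z)), ?_, fun z => ?_⟩
  · clear hdist
    let R : C(UnitAddTorus (Fin 2), ℂ) →ₗ[ℂ] (ℂ → ℂ) :=
      { toFun := fun T z => T (mk (B.equivFun z))
        map_add' := fun _ _ => rfl
        map_smul' := fun _ _ => rfl }
    have : Submodule.span ℂ (range (UnitAddTorus.mFourier (d := Fin 2))) ≤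
        (trigPolynomials Γ).comap R := by
      rw [Submodule.span_le]
      rintro _ ⟨n, rfl⟩
      let φ : ℂ →ₗ[ℝ] ℂ := ∑ i, (2 * Real.pi * n i : ℝ) •
        (Complex.ofRealLI.toLinearMap ∘ₗ (LinearMap.proj i ∘ₗ (B.equivFun : ℂ →ₗ[ℝ] (Fin 2 → ℝ))))
      obtain ⟨p, q, hpq⟩ := exists_linear_form φ
      refine Submodule.subset_span ⟨p, q, ?_, ?_⟩
      · ext z
        change UnitAddTorus.mFourier n (mk (B.equivFun z)) = _
        rw [planeWave, ← hpq]
        simp only [UnitAddTorus.mFourier, ContinuousMap.coe_mk, mk, Pi.map_apply,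
          fourier_coe_apply]
        rw [← Complex.exp_sum]
        congr 1
        simp only [φ, LinearMap.sum_apply, LinearMap.smul_apply, LinearMap.comp_apply,
          Finset.mul_sum]
        refine Finset.sum_congr rfl fun i _ => ?_
        simp
        ring
      · intro γ hγ z
        change UnitAddTorus.mFourier n (mk (B.equivFun (z + γ))) =
          UnitAddTorus.mFourier n (mk (B.equivFun z))
        congr 1
        ext i
        simp only [mk, Pi.map_apply, map_add, Pi.add_apply, AddCircle.coe_add]
        have h3 : B.equivFun γ i = ((b.repr ⟨γ, hγ⟩ i : ℤ) : ℝ) := by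
          rw [Module.Basis.equivFun_apply]
          exact b.ofZLatticeBasis_repr_apply ℝ Γ ⟨γ, hγ⟩ i
        rw [h3, add_eq_left, AddCircle.coe_eq_zero_iff]
        exact ⟨b.repr ⟨γ, hγ⟩ i, by simp⟩
    exact this hT
  · have h1 : ξ z = Φ (mk (B.equivFun z)) := by
      rw [hΦ]; change _ = ξ _; rw [LinearEquiv.symm_apply_apply]
    rw [h1, ← dist_eq_norm]
    exact (ContinuousMap.dist_apply_le_dist _).trans hdist.le

/-- If T is a trigonometric polynomial within ε of conj ξ, then ∫ |ξ|² = ∫ ξ (conj ξ - T) is at most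
ε ∫ |ξ|. -/
theorem eq_zero_of_periodic_of_integral_planeWave {ξ : ℂ → ℂ}
    (hD : IsAddFundamentalDomain Γ D volume) (hξ : Continuous ξ) (hp : IsPeriodic Γ ξ)
    (h : ∀ p q, IsPeriodic Γ (planeWave p q) → ∫ z in D, ξ z * planeWave p q z = 0) : ξ = 0 := by
  have hT : ∀ T ∈ trigPolynomials Γ, (Continuous T ∧ IsPeriodic Γ T) ∧ ∫ z in D, ξ z * T z = 0 := by
    intro T hT
    induction hT using Submodule.span_induction with
    | mem T hT =>
      obtain ⟨p, q, rfl, hper⟩ := hT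
      exact ⟨⟨continuous_planeWave p q, hper⟩, h p q hper⟩
    | zero => exact ⟨⟨continuous_zero, fun _ _ _ => rfl⟩, by simp⟩
    | add S T _ _ hS hT =>
      refine ⟨⟨hS.1.1.add hT.1.1, fun γ hγ z => ?_⟩, ?_⟩
      · simp only [Pi.add_apply, hS.1.2 γ hγ, hT.1.2 γ hγ]
      · simp only [Pi.add_apply, mul_add]
        rw [integral_add, hS.2, hT.2, add_zero]
        · exact integrableOn_of_periodic hD (hξ.mul hS.1.1)
            fun γ hγ z => by simp only [hp γ hγ, hS.1.2 γ hγ]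
        · exact integrableOn_of_periodic hD (hξ.mul hT.1.1)
            fun γ hγ z => by simp only [hp γ hγ, hT.1.2 γ hγ]
    | smul c T _ hT =>
      refine ⟨⟨hT.1.1.const_smul c, fun γ hγ z => ?_⟩, ?_⟩
      · simp only [Pi.smul_apply, hT.1.2 γ hγ]
      · simp only [Pi.smul_apply, smul_eq_mul, mul_left_comm _ c]
        rw [integral_const_mul, hT.2, mul_zero]
  have hint : IntegrableOn (fun z => ‖ξ z‖) D :=
    integrableOn_of_periodic hD hξ.norm (hp.comp _)
  set J := ∫ z in D, ‖ξ z‖ with hJ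
  have hJ0 : 0 ≤ J := integral_nonneg fun _ => norm_nonneg _
  have hle : ∀ ε > 0, ‖∫ z in D, ξ z * conj (ξ z)‖ ≤ ε * J := by
    intro ε hε
    obtain ⟨T, hTm, hTε⟩ := exists_trigPolynomial_near (ξ := fun z => conj (ξ z))
      (Complex.continuous_conj.comp hξ) (hp.comp _) hε
    obtain ⟨⟨hTc, hTp⟩, hT0⟩ := hT T hTm
    have h1 : ∫ z in D, ξ z * conj (ξ z) = ∫ z in D, ξ z * (conj (ξ z) - T z) := by
      simp only [mul_sub]
      rw [integral_sub, hT0, sub_zero]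
      · exact integrableOn_of_periodic hD (hξ.mul (Complex.continuous_conj.comp hξ))
          (hp.comp fun x => x * conj x)
      · exact integrableOn_of_periodic hD (hξ.mul hTc)
          fun γ hγ z => by simp only [hp γ hγ, hTp γ hγ]
    rw [h1, ← integral_const_mul]
    refine norm_integral_le_of_norm_le (hint.const_mul ε) (ae_of_all _ fun z => ?_)
    rw [norm_mul, mul_comm]
    exact mul_le_mul_of_nonneg_right (hTε z) (norm_nonneg _)
  have hz : ∫ z in D, ξ z * conj (ξ z) = 0 := by
    rw [← norm_le_zero_iff]
    refine le_of_forall_pos_le_add fun δ hδ => ?_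
    have hJ1 : 0 < J + 1 := by linarith
    refine (hle (δ / (J + 1)) (div_pos hδ hJ1)).trans ?_
    rw [zero_add, div_mul_eq_mul_div, div_le_iff₀ hJ1]
    nlinarith
  have hz2 : ∫ z in D, ‖ξ z‖ ^ 2 = 0 := by
    have : ∀ z, ξ z * conj (ξ z) = ((‖ξ z‖ ^ 2 : ℝ) : ℂ) := fun z => by
      rw [Complex.mul_conj, Complex.normSq_eq_norm_sq]
    simp only [this] at hz
    rw [integral_complex_ofReal] at hz
    exact_mod_cast hz
  have h3 := eq_zero_of_setIntegral_eq_zero hD (hξ.norm.pow 2) (hp.comp fun x => ‖x‖ ^ 2)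
    (fun z => sq_nonneg ‖ξ z‖) hz2
  ext z
  have := congrFun h3 z
  simpa using this

/-- Choose logarithms of h on a lattice basis and extend them real-linearly to ℂ; two homomorphisms
into ℂ_* that agree on a basis are equal. -/
theorem AddChar.exists_planeWave (h : AddChar Γ ℂ) : ∃ p q, ∀ γ : Γ, planeWave p q γ = h γ := by
  obtain ⟨b⟩ := exists_lattice_basis Γ
  let B := b.ofZLatticeBasis ℝ Γ
  have hne : ∀ γ : Γ, h γ ≠ 0 := fun γ h0 => by
    have := h.map_add_eq_mul γ (-γ)
    rw [h0, zero_mul, add_neg_cancel, h.map_zero_eq_one] at this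
    exact one_ne_zero this
  let φ : ℂ →ₗ[ℝ] ℂ := B.constr ℝ fun i => -Complex.I * Complex.log (h (b i))
  obtain ⟨p, q, hpq⟩ := exists_linear_form φ
  refine ⟨p, q, fun γ => ?_⟩
  let ψ₁ : Γ →+ Additive ℂˣ :=
    { toFun := fun γ => Additive.ofMul (Units.mk0 (planeWave p q γ) (planeWave_ne_zero _ _ _))
      map_zero' := by
        apply Additive.toMul.injective; ext; simp [planeWave_zero]
      map_add' := fun x y => by
        apply Additive.toMul.injective; ext; simp [planeWave_add] }
  let ψ₂ : Γ →+ Additive ℂˣ :=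
    { toFun := fun γ => Additive.ofMul (Units.mk0 (h γ) (hne γ))
      map_zero' := by
        apply Additive.toMul.injective; ext; simp
      map_add' := fun x y => by
        apply Additive.toMul.injective; ext; simp [h.map_add_eq_mul] }
  have hψ : ψ₁.toIntLinearMap = ψ₂.toIntLinearMap := by
    refine b.ext fun i => ?_
    apply Additive.toMul.injective
    ext
    change planeWave p q (b i) = h (b i)
    rw [planeWave, ← hpq]
    have : φ (b i : ℂ) = -Complex.I * Complex.log (h (b i)) := by
      have := B.constr_basis ℝ (fun i => -Complex.I * Complex.log (h (b i))) i
      rwa [Module.Basis.ofZLatticeBasis_apply ℝ Γ b i] at this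
    rw [this, ← mul_assoc, mul_neg, Complex.I_mul_I, neg_neg, one_mul, Complex.exp_log (hne _)]
  have h1 := congrArg (fun u : Additive ℂˣ => ((Additive.toMul u : ℂˣ) : ℂ))
    (LinearMap.congr_fun hψ γ)
  exact h1

/-- Division by one plane wave with multiplier h reduces the claim to periodic functions. -/
theorem eq_zero_of_multiplier_of_integral_planeWave {h : AddChar Γ ℂ} {ψ : ℂ → ℂ}
    (hD : IsAddFundamentalDomain Γ D volume) (hc : Continuous ψ) (hψ : HasComplexMultiplier h ψ)
    (h0 : ∀ p q, (∀ γ : Γ, planeWave p q γ = h γ) →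
      ∫ z in D, ψ z * planeWave (-p) (-q) z = 0) : ψ = 0 := by
  obtain ⟨p, q, hpq⟩ := AddChar.exists_planeWave h
  have key : (fun z => ψ z * planeWave (-p) (-q) z) = 0 := by
    refine eq_zero_of_periodic_of_integral_planeWave hD
      (hc.mul (continuous_planeWave _ _)) (isPeriodic_mul_planeWave_neg hψ hpq) ?_
    intro p' q' hper
    have h1 : ∀ γ : Γ, planeWave p' q' γ = 1 := fun γ => by
      have := hper γ γ.2 0
      rwa [zero_add, planeWave_zero] at this
    have := h0 (p - p') (q - q') fun γ => by
      have h2 := planeWave_mul (p - p') (q - q') p' q' γ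
      rw [h1, mul_one, sub_add_cancel, sub_add_cancel] at h2
      rw [h2, hpq]
    rw [← this]
    congr 1
    ext z
    rw [mul_assoc, planeWave_mul]
    ring_nf
  ext z
  exact (mul_eq_zero.1 (congrFun key z)).resolve_right (planeWave_ne_zero _ _ _)

/-- Up to a nonzero constant the wave is its own derivative in a suitable direction v. -/
theorem setIntegral_planeWave_eq_zero (hD : IsAddFundamentalDomain Γ D volume) {p q : ℂ}
    (hper : IsPeriodic Γ (planeWave p q)) (hpq : ¬ (p = 0 ∧ q = 0)) :
    ∫ z in D, planeWave p q z = 0 := by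
  obtain ⟨v, hv⟩ : ∃ v, p * v + q * conj v ≠ 0 := by
    by_contra! h
    exact hpq (linear_form_eq fun v => by rw [h v]; ring)
  have h1 := setIntegral_fderiv_eq_zero hD ((contDiff_planeWave p q).of_le (by simp)) hper v
  simp only [fderiv_planeWave] at h1
  rw [integral_const_mul] at h1
  exact (mul_eq_zero.1 h1).resolve_left (mul_ne_zero Complex.I_ne_zero hv)

end Periodic

/-! ### Left normals with linear phase -/

/-- The function `e₀ exp (i β)` with the real linear function `β z = 2 (κ z + conj (κ z))`. -/
def phase (κ e₀ z : ℂ) : ℂ := e₀ * planeWave (2 * κ) (2 * conj κ) z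

/-- The left normal `exp (j β) i` with real affine `β`. -/
def phaseNormal (κ e₀ z : ℂ) : ℍ := normalOf (phase κ e₀ z)

/-- The conditions under which `phaseNormal κ e₀` is a nonconstant left normal on `ℂ / Γ`. -/
structure IsPhase (Γ : Submodule ℤ ℂ) (κ e₀ : ℂ) : Prop where
  ne_zero : κ ≠ 0
  norm_eq_one : ‖e₀‖ = 1
  wave_eq_one : ∀ γ ∈ Γ, planeWave (2 * κ) (2 * conj κ) γ = 1

/-- The holomorphic section with parameter `l ∈ ℂ_*`. -/
def mode (κ e₀ l z : ℂ) : ℍ :=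
  ofCoord (e₀ * (l - 1) * planeWave (κ * (l + 1)) (conj κ * (l⁻¹ + 1)) z,
    (l + 1) * planeWave (κ * (l - 1)) (conj κ * (l⁻¹ - 1)) z)

/-- The multiplier of `mode κ e₀ l`. -/
def modeMultiplier (Γ : Submodule ℤ ℂ) (κ l : ℂ) : AddChar Γ ℂ where
  toFun γ := planeWave (κ * (l + 1)) (conj κ * (l⁻¹ + 1)) γ
  map_zero_eq_one' := planeWave_zero _ _
  map_add_eq_mul' x y := by rw [Submodule.coe_add, planeWave_add]

section Phase

variable {Γ : Submodule ℤ ℂ} {κ e₀ : ℂ}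

theorem modeMultiplier_apply (l : ℂ) (γ : Γ) :
    modeMultiplier Γ κ l γ = planeWave (κ * (l + 1)) (conj κ * (l⁻¹ + 1)) γ := rfl

theorem contDiff_phase (κ e₀ : ℂ) : ContDiff ℝ ∞ (phase κ e₀) :=
  contDiff_const.mul (contDiff_planeWave _ _)

theorem contDiff_phaseNormal (κ e₀ : ℂ) : ContDiff ℝ ∞ (phaseNormal κ e₀) :=
  normalOf.contDiff.comp (contDiff_phase κ e₀)

theorem differentiable_phase (κ e₀ : ℂ) : Differentiable ℝ (phase κ e₀) :=
  (contDiff_phase κ e₀).differentiable (by simp)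

theorem fderiv_const_mul_planeWave (c p q z v : ℂ) :
    fderiv ℝ (fun w => c * planeWave p q w) z v =
      Complex.I * (p * v + q * conj v) * (c * planeWave p q z) := by
  rw [fderiv_const_mul (differentiable_planeWave p q z)]
  simp only [_root_.smul_apply, fderiv_planeWave, smul_eq_mul]
  ring

theorem fderiv_phase (κ e₀ z v : ℂ) : fderiv ℝ (phase κ e₀) z v =
    Complex.I * (2 * κ * v + 2 * conj κ * conj v) * phase κ e₀ z :=
  fderiv_const_mul_planeWave _ _ _ _ _

theorem fderiv_phaseNormal (κ e₀ z v : ℂ) : fderiv ℝ (phaseNormal κ e₀) z v =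
    normalOf (Complex.I * (2 * κ * v + 2 * conj κ * conj v) * phase κ e₀ z) := by
  rw [← fderiv_phase, ← fderiv_normalOf (differentiable_phase κ e₀ z)]; rfl

theorem norm_phase (he : ‖e₀‖ = 1) (z : ℂ) : ‖phase κ e₀ z‖ = 1 := by
  have := norm_planeWave_conj (2 * κ) z
  rw [map_mul, Complex.conj_ofNat] at this
  rw [phase, norm_mul, he, this, one_mul]

theorem phase_ne_zero (he : ‖e₀‖ = 1) (z : ℂ) : phase κ e₀ z ≠ 0 := by
  rw [← norm_ne_zero_iff, norm_phase he]; exact one_ne_zero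

theorem conj_phase (he : ‖e₀‖ = 1) (z : ℂ) : conj (phase κ e₀ z) = (phase κ e₀ z)⁻¹ :=
  conj_eq_inv_of_norm (norm_phase he z)

theorem phaseNormal_sq (he : ‖e₀‖ = 1) (z : ℂ) :
    phaseNormal κ e₀ z * phaseNormal κ e₀ z = -1 := normalOf_mul_self (norm_phase he z)

theorem IsPhase.phase_add (h : IsPhase Γ κ e₀) {γ : ℂ} (hγ : γ ∈ Γ) (z : ℂ) :
    phase κ e₀ (z + γ) = phase κ e₀ z := by
  rw [phase, planeWave_add, h.wave_eq_one γ hγ, mul_one, phase]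

/-- The frequencies of the two coordinates of a mode differ by the frequency of the phase. On the
lattice the phase is trivial, so both coordinates have the same multiplier. -/
theorem planeWave_shift (κ l r z : ℂ) : planeWave (κ * (l + 1)) (conj κ * (r + 1)) z =
    planeWave (2 * κ) (2 * conj κ) z * planeWave (κ * (l - 1)) (conj κ * (r - 1)) z := by
  rw [planeWave_mul]; ring_nf

theorem coordA_mode (l z : ℂ) : coordA (mode κ e₀ l z) =
    e₀ * (l - 1) * planeWave (κ * (l + 1)) (conj κ * (l⁻¹ + 1)) z := coordA_ofCoord _

theorem coordB_mode (l z : ℂ) : coordB (mode κ e₀ l z) =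
    (l + 1) * planeWave (κ * (l - 1)) (conj κ * (l⁻¹ - 1)) z := coordB_ofCoord _

theorem coordA_mode_eq (l z : ℂ) : coordA (mode κ e₀ l z) =
    phase κ e₀ z * (l - 1) * planeWave (κ * (l - 1)) (conj κ * (l⁻¹ - 1)) z := by
  rw [coordA_mode, planeWave_shift, phase]; ring

theorem contDiff_mode (l : ℂ) : ContDiff ℝ ∞ (mode κ e₀ l) :=
  ofCoord.contDiff.comp ((contDiff_const.mul (contDiff_planeWave _ _)).prodMk
    (contDiff_const.mul (contDiff_planeWave _ _)))

theorem differentiable_mode (l : ℂ) : Differentiable ℝ (mode κ e₀ l) :=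
  (contDiff_mode l).differentiable (by simp)

theorem coordA_fderiv_mode (l z v : ℂ) : coordA (fderiv ℝ (mode κ e₀ l) z v) =
    Complex.I * (κ * (l + 1) * v + conj κ * (l⁻¹ + 1) * conj v) * coordA (mode κ e₀ l z) := by
  rw [← fderiv_coordA (differentiable_mode l z)]
  simp only [coordA_mode]
  exact fderiv_const_mul_planeWave _ _ _ _ _

theorem coordB_fderiv_mode (l z v : ℂ) : coordB (fderiv ℝ (mode κ e₀ l) z v) =
    Complex.I * (κ * (l - 1) * v + conj κ * (l⁻¹ - 1) * conj v) * coordB (mode κ e₀ l z) := by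
  rw [← fderiv_coordB (differentiable_mode l z)]
  simp only [coordB_mode]
  exact fderiv_const_mul_planeWave _ _ _ _ _

/-- The amplitudes l - 1 and l + 1 cannot both vanish. -/
theorem mode_ne_zero (he : ‖e₀‖ = 1) (l z : ℂ) : mode κ e₀ l z ≠ 0 := by
  intro h
  have hA := coordA_mode (κ := κ) (e₀ := e₀) l z
  have hB := coordB_mode (κ := κ) (e₀ := e₀) l z
  rw [h, map_zero] at hA hB
  have he0 : e₀ ≠ 0 := by rw [← norm_ne_zero_iff, he]; exact one_ne_zero
  have h1 := (mul_eq_zero.1 hA.symm).resolve_right (planeWave_ne_zero _ _ _)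
  have h2 := (mul_eq_zero.1 hB.symm).resolve_right (planeWave_ne_zero _ _ _)
  have h3 := (mul_eq_zero.1 h1).resolve_left he0
  have h4 : (2 : ℂ) = 0 := by linear_combination h2 - h3
  norm_num at h4

theorem IsPhase.hasMultiplier_mode (h : IsPhase Γ κ e₀) (l : ℂ) :
    HasMultiplier Γ (modeMultiplier Γ κ l) (mode κ e₀ l) := by
  intro γ z
  have h1 := planeWave_shift κ l l⁻¹ γ
  rw [h.wave_eq_one γ γ.2, one_mul] at h1
  apply ext_coord
  · rw [coordA_mul_coe, coordA_mode, coordA_mode, planeWave_add, modeMultiplier_apply]; ring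
  · rw [coordB_mul_coe, coordB_mode, coordB_mode, planeWave_add, modeMultiplier_apply, h1]; ring

/-- Left multiplication by the normal carries the wave of one coordinate to that of the other, so
the equation is algebraic in the amplitudes. It is satisfied because the parameter of the
antiholomorphic frequency is l⁻¹. -/
theorem IsPhase.mode_mem_holSections (h : IsPhase Γ κ e₀) {l : ℂ} (hl : l ≠ 0) :
    mode κ e₀ l ∈ holSections Γ (phaseNormal κ e₀) (modeMultiplier Γ κ l) := by
  refine ⟨contDiff_mode l, fun z v => ?_, h.hasMultiplier_mode l⟩
  have hE := phase_ne_zero (κ := κ) h.norm_eq_one z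
  apply ext_coord
  · rw [phaseNormal, coordA_normalOf_mul, coordA_fderiv_mode, coordB_fderiv_mode,
      coordA_mode_eq, coordB_mode]
    simp only [map_mul, Complex.conj_I]
    field_simp
    ring
  · rw [phaseNormal, coordB_normalOf_mul, coordA_fderiv_mode, coordB_fderiv_mode,
      coordA_mode_eq, coordB_mode, conj_phase h.norm_eq_one]
    simp only [map_mul, Complex.conj_I]
    field_simp
    ring

/-! ### The family of flat connections in coordinates -/

theorem I_pow_three : Complex.I ^ 3 = -Complex.I := by rw [pow_succ, Complex.I_sq, neg_one_mul]

theorem I_pow_five : Complex.I ^ 5 = Complex.I := by rw [pow_succ, Complex.I_pow_four, one_mul]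

/-- Since the normal and its derivative both exchange the two coordinates, parallel transport
becomes an explicit linear system with the coefficients κ v ± conj κ conj v. -/
theorem coordA_dmu (he : ‖e₀‖ = 1) {α : ℂ → ℍ} (μ z v : ℂ) :
    coordA (dmu (phaseNormal κ e₀) μ α z v) = coordA (fderiv ℝ α z v) +
      1 / 2 * ((κ * v + conj κ * conj v) * phase κ e₀ z *
        (Complex.I * (phase κ e₀ z)⁻¹ * coordA (α z) * (paramA μ - 1) + coordB (α z) * paramB μ)
        - (κ * v - conj κ * conj v) *
        (Complex.I * phase κ e₀ z * coordB (α z) * (paramA μ - 1) + coordA (α z) * paramB μ)) := by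
  have hE := phase_ne_zero (κ := κ) he z
  simp only [dmu, dNprime, map_add, coordA_smul, neg_mul, map_neg, smul_mul_assoc, sub_mul,
    map_sub, fderiv_phaseNormal, phaseNormal, coordA_normalOf_mul, coordB_normalOf_mul,
    mul_assoc (normalOf (phase κ e₀ z)), coordA_mul_coe, coordB_mul_coe, map_mul, Complex.conj_I,
    Complex.conj_conj, conj_phase he, map_ofNat]
  push_cast
  field_simp
  ring_nf
  simp only [Complex.I_sq, Complex.I_pow_four, I_pow_three, I_pow_five]
  ring

theorem coordB_dmu (he : ‖e₀‖ = 1) {α : ℂ → ℍ} (μ z v : ℂ) :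
    coordB (dmu (phaseNormal κ e₀) μ α z v) = coordB (fderiv ℝ α z v) -
      1 / 2 * ((κ * v + conj κ * conj v) * (phase κ e₀ z)⁻¹ *
        (Complex.I * phase κ e₀ z * coordB (α z) * (paramA μ - 1) + coordA (α z) * paramB μ)
        - (κ * v - conj κ * conj v) *
        (Complex.I * (phase κ e₀ z)⁻¹ * coordA (α z) * (paramA μ - 1)
          + coordB (α z) * paramB μ)) := by
  have hE := phase_ne_zero (κ := κ) he z
  simp only [dmu, dNprime, map_add, coordB_smul, neg_mul, map_neg, smul_mul_assoc, sub_mul,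
    map_sub, fderiv_phaseNormal, phaseNormal, coordA_normalOf_mul, coordB_normalOf_mul,
    mul_assoc (normalOf (phase κ e₀ z)), coordA_mul_coe, coordB_mul_coe, map_mul, Complex.conj_I,
    Complex.conj_conj, conj_phase he, map_ofNat]
  push_cast
  field_simp
  ring_nf
  simp only [Complex.I_sq, Complex.I_pow_four, I_pow_three, I_pow_five]
  ring

theorem IsPhase.mode_mem_eigenSections (h : IsPhase Γ κ e₀) {l : ℂ} (hl : l ≠ 0) :
    mode κ e₀ l ∈ eigenSections Γ (phaseNormal κ e₀) (l ^ 2) (modeMultiplier Γ κ l) := by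
  refine ⟨contDiff_mode l, fun z v => ?_, h.hasMultiplier_mode l⟩
  have hE := phase_ne_zero (κ := κ) h.norm_eq_one z
  apply ext_coord
  · rw [coordA_dmu h.norm_eq_one, coordA_fderiv_mode, coordA_mode_eq, coordB_mode, map_zero,
      paramA, paramB]
    field_simp
    ring
  · rw [coordB_dmu h.norm_eq_one, coordB_fderiv_mode, coordA_mode_eq, coordB_mode, map_zero,
      paramA, paramB]
    field_simp
    ring

/-- A section that is parallel for `d^μ` is holomorphic. -/
theorem eigenSections_subset_holSections (he : ‖e₀‖ = 1) (μ : ℂ) (h : AddChar Γ ℂ) :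
    eigenSections Γ (phaseNormal κ e₀) μ h ⊆ holSections Γ (phaseNormal κ e₀) h := by
  rintro α ⟨hα, hd, hm⟩
  refine ⟨hα, fun z v => ?_, hm⟩
  have hE := phase_ne_zero (κ := κ) he z
  have hA1 := coordA_dmu (κ := κ) he (α := α) μ z (Complex.I * v)
  have hB1 := coordB_dmu (κ := κ) he (α := α) μ z (Complex.I * v)
  have hA2 := coordA_dmu (κ := κ) he (α := α) μ z v
  have hB2 := coordB_dmu (κ := κ) he (α := α) μ z v
  rw [hd, map_zero] at hA1 hB1 hA2 hB2
  simp only [map_mul, Complex.conj_I] at hA1 hB1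
  apply ext_coord
  · rw [phaseNormal, coordA_normalOf_mul]
    -- Behind this cancellation is *(dN)' = N (dN)': the correction term of d^μ has the same type as
    -- the derivative of a holomorphic section.
    linear_combination (norm := skip) -hA1 + Complex.I * phase κ e₀ z * hB2
    field_simp
    ring_nf
  · rw [phaseNormal, coordB_normalOf_mul, conj_phase he]
    linear_combination (norm := skip) -hB1 + Complex.I * (phase κ e₀ z)⁻¹ * hA2
    field_simp
    ring_nf

/-- The `(1,0)`-part of the equation for parallel sections. -/
theorem coordA_eigenSection (hp : IsPhase Γ κ e₀) {μ : ℂ} (hμ : μ ≠ 0) {h : AddChar Γ ℂ}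
    {α : ℂ → ℍ} (hα : α ∈ eigenSections Γ (phaseNormal κ e₀) μ h) (z : ℂ) :
    coordA (fderiv ℝ α z (Complex.I * κ⁻¹)) + Complex.I * coordA (fderiv ℝ α z κ⁻¹) =
      (μ - 1) * (coordA (α z) - phase κ e₀ z * coordB (α z)) := by
  have hE := phase_ne_zero (κ := κ) hp.norm_eq_one z
  have hκ := hp.ne_zero
  have hκ' : conj κ ≠ 0 := (map_ne_zero _).2 hκ
  have h1 := coordA_dmu (κ := κ) hp.norm_eq_one (α := α) μ z (Complex.I * κ⁻¹)
  have h2 := coordA_dmu (κ := κ) hp.norm_eq_one (α := α) μ z κ⁻¹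
  rw [hα.2.1, map_zero] at h1 h2
  -- Evaluation on iκ⁻¹ plus i times evaluation on κ⁻¹ extracts the complex linear part of a
  -- one-form; the terms with conj v cancel.
  linear_combination (norm := skip) -h1 - Complex.I * h2
  simp only [map_mul, Complex.conj_I, map_inv₀, paramA, paramB]
  field_simp
  ring_nf
  simp only [Complex.I_sq]
  ring

end Phase

/-! ### Coincidences of multipliers -/

theorem planeWave_eq_one_iff {p q z : ℂ} :
    planeWave p q z = 1 ↔ ∃ n : ℤ, p * z + q * conj z = 2 * Real.pi * n := by
  rw [planeWave, Complex.exp_eq_one_iff]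
  refine exists_congr fun n => ?_
  rw [show (n : ℂ) * (2 * Real.pi * Complex.I) = Complex.I * (2 * Real.pi * n) by ring]
  exact mul_right_inj' Complex.I_ne_zero

theorem mul_mul_conj_sub_eq {l l' : ℂ} (hl : l ≠ 0) (hl' : l' ≠ 0)
    (h : l⁻¹ - l'⁻¹ = conj (l - l')) : l * l' * conj (l - l') = -(l - l') := by
  rw [← h]; field_simp; ring

/-- Two different parameters satisfy |l| |l'| = 1, by taking norms in `mul_mul_conj_sub_eq`, so l'
has norm |l|⁻¹. -/
theorem norm_sub_le_of_multiplier {l l' : ℂ} (hl : l ≠ 0) (hl' : l' ≠ 0)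
    (h : l⁻¹ - l'⁻¹ = conj (l - l')) : ‖l - l'‖ ≤ ‖l‖ + ‖l‖⁻¹ := by
  by_cases hll : l = l'
  · rw [hll, sub_self, norm_zero]; positivity
  have h1 := congrArg norm (mul_mul_conj_sub_eq hl hl' h)
  rw [norm_mul, norm_mul, RCLike.norm_conj, norm_neg] at h1
  have h2 : ‖l‖ * ‖l'‖ = 1 := by
    have : ‖l - l'‖ ≠ 0 := norm_ne_zero_iff.2 (sub_ne_zero.2 hll)
    exact mul_right_cancel₀ this (h1.trans (one_mul _).symm)
  rw [← eq_inv_of_mul_eq_one_right h2]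
  exact norm_sub_le _ _

section Lattice

variable {Γ : Submodule ℤ ℂ} {κ e₀ : ℂ} [DiscreteTopology Γ] [IsZLattice ℝ Γ]

theorem IsZLattice.linearMap_ext {F : Type*} [AddCommGroup F] [Module ℝ F]
    {φ ψ : ℂ →ₗ[ℝ] F} (h : ∀ γ ∈ Γ, φ γ = ψ γ) : φ = ψ :=
  LinearMap.ext_on (IsZLattice.span_top (K := ℝ) (L := Γ)) h

/-- The exponent p z + q conj z is real on Γ, and Γ spans ℂ over ℝ. So its imaginary part vanishes
identically. -/
theorem eq_conj_of_planeWave_eq_one {p q : ℂ}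
    (h : ∀ γ ∈ Γ, planeWave p q γ = 1) : q = conj p := by
  let φ : ℂ →ₗ[ℝ] ℝ := Complex.imLm ∘ₗ
    (LinearMap.mulLeft ℝ p + LinearMap.mulLeft ℝ q ∘ₗ Complex.conjAe.toLinearMap)
  have hφ : φ = 0 := IsZLattice.linearMap_ext fun γ hγ => by
    obtain ⟨n, hn⟩ := planeWave_eq_one_iff.1 (h γ hγ)
    change (p * γ + q * conj γ).im = 0
    rw [hn]
    simp
  have h1 : (p * 1 + q * conj 1).im = 0 := LinearMap.congr_fun hφ 1
  have h2 : (p * Complex.I + q * conj Complex.I).im = 0 := LinearMap.congr_fun hφ Complex.I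
  simp at h1 h2
  apply Complex.ext
  · simp; linarith
  · simp; linarith

variable (Γ) in
-- Such a p is determined by the exponents at two basis vectors, which are bounded integer multiples
-- of 2π.
theorem finite_dual_lattice (C : ℝ) :
    {p : ℂ | ‖p‖ ≤ C ∧ ∀ γ ∈ Γ, planeWave p (conj p) γ = 1}.Finite := by
  obtain ⟨b⟩ := exists_lattice_basis Γ
  let F : ℂ → Fin 2 → ℂ := fun p i => p * b i + conj p * conj (b i : ℂ)
  have hinj : Function.Injective F := by
    intro p q hpq
    have h1 : (LinearMap.mulLeft ℝ p + LinearMap.mulLeft ℝ (conj p) ∘ₗ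
        Complex.conjAe.toLinearMap : ℂ →ₗ[ℝ] ℂ) =
        LinearMap.mulLeft ℝ q + LinearMap.mulLeft ℝ (conj q) ∘ₗ Complex.conjAe.toLinearMap := by
      refine (b.ofZLatticeBasis ℝ Γ).ext fun i => ?_
      rw [Module.Basis.ofZLatticeBasis_apply ℝ Γ b i]
      exact congrFun hpq i
    exact (linear_form_eq fun v => LinearMap.congr_fun h1 v).1
  let M : Fin 2 → ℝ := fun i => 2 * C * ‖(b i : ℂ)‖
  have hfin : {x : Fin 2 → ℂ | ∀ i, x i ∈ (fun n : ℤ => (2 * Real.pi * n : ℂ)) ''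
      Set.Icc (-⌈M i⌉) ⌈M i⌉}.Finite :=
    Set.Finite.pi' fun i => (Set.finite_Icc _ _).image _
  refine (hfin.preimage hinj.injOn).subset ?_
  rintro p ⟨hpC, hp⟩ i
  obtain ⟨n, hn⟩ := planeWave_eq_one_iff.1 (hp _ (b i).2)
  refine ⟨n, ?_, hn.symm⟩
  have h1 : ‖p * b i + conj p * conj (b i : ℂ)‖ ≤ M i := by
    refine (norm_add_le _ _).trans ?_
    rw [norm_mul, norm_mul, RCLike.norm_conj, RCLike.norm_conj]
    have := mul_le_mul_of_nonneg_right hpC (norm_nonneg (b i : ℂ))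
    simp only [M]; linarith
  rw [hn, norm_mul, norm_mul, Complex.norm_ofNat, Complex.norm_real, Real.norm_eq_abs,
    abs_of_pos Real.pi_pos, Complex.norm_intCast] at h1
  have h2 : |(n : ℝ)| ≤ M i := by
    have := Real.pi_gt_three
    nlinarith [abs_nonneg (n : ℝ)]
  have h3 := abs_le.1 (h2.trans (Int.le_ceil _))
  exact ⟨by exact_mod_cast h3.1, by exact_mod_cast h3.2⟩

/-- The quotient of the two multipliers comes from a plane wave that is trivial on Γ. Thus κ(l - l')
lies in the dual lattice, which is what makes coincidences rare. -/
theorem modeMultiplier_eq (hp : IsPhase Γ κ e₀) {l l' : ℂ}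
    (h : modeMultiplier Γ κ l = modeMultiplier Γ κ l') :
    l⁻¹ - l'⁻¹ = conj (l - l') ∧
      ∀ γ ∈ Γ, planeWave (κ * (l - l')) (conj (κ * (l - l'))) γ = 1 := by
  have h1 : ∀ γ ∈ Γ, planeWave (κ * (l - l')) (conj κ * (l⁻¹ - l'⁻¹)) γ = 1 := fun γ hγ => by
    have h2 := DFunLike.congr_fun h ⟨γ, hγ⟩
    rw [modeMultiplier_apply, modeMultiplier_apply] at h2
    have h3 := planeWave_mul (κ * (l - l')) (conj κ * (l⁻¹ - l'⁻¹)) (κ * (l' + 1))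
      (conj κ * (l'⁻¹ + 1)) γ
    rw [show κ * (l - l') + κ * (l' + 1) = κ * (l + 1) by ring,
      show conj κ * (l⁻¹ - l'⁻¹) + conj κ * (l'⁻¹ + 1) = conj κ * (l⁻¹ + 1) by ring] at h3
    simp only at h2
    rw [h2] at h3
    exact mul_right_cancel₀ (planeWave_ne_zero _ _ _) (h3.trans (one_mul _).symm)
  have h4 := eq_conj_of_planeWave_eq_one h1
  refine ⟨?_, fun γ hγ => by rw [← h4]; exact h1 γ hγ⟩
  rw [map_mul] at h4
  exact mul_left_cancel₀ ((map_ne_zero _).2 hp.ne_zero) h4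

/-- Fix one parameter l₀ of h. All others differ from it by p / κ with p in a bounded part of the
dual lattice. -/
theorem finite_fiber (hp : IsPhase Γ κ e₀) (h : AddChar Γ ℂ) :
    {l : ℂ | l ≠ 0 ∧ modeMultiplier Γ κ l = h}.Finite := by
  rcases Set.eq_empty_or_nonempty {l : ℂ | l ≠ 0 ∧ modeMultiplier Γ κ l = h} with he | ⟨l₀, hl₀, h₀⟩
  · rw [he]; exact Set.finite_empty
  refine ((finite_dual_lattice Γ (‖κ‖ * (‖l₀‖ + ‖l₀‖⁻¹))).image (fun p => l₀ - p / κ)).subset ?_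
  rintro l ⟨hl, hlh⟩
  obtain ⟨h1, h2⟩ := modeMultiplier_eq hp (h₀.trans hlh.symm)
  refine ⟨κ * (l₀ - l), ⟨?_, h2⟩, ?_⟩
  · rw [norm_mul]
    exact mul_le_mul_of_nonneg_left (norm_sub_le_of_multiplier hl₀ hl h1) (norm_nonneg _)
  · simp only
    rw [mul_div_cancel_left₀ _ hp.ne_zero, sub_sub_cancel]

/-- The double points of the map `l ↦ modeMultiplier Γ κ l` are isolated. -/
theorem eventually_modeMultiplier_injective (hp : IsPhase Γ κ e₀) {l₀ : ℂ} (hl₀ : l₀ ≠ 0) :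
    ∀ᶠ l in 𝓝[≠] l₀, ∀ l' ≠ 0, modeMultiplier Γ κ l' = modeMultiplier Γ κ l → l' = l := by
  -- This bounds κ(l - l') as soon as |l₀| / 2 < |l| < 2 |l₀|.
  set C := ‖κ‖ * (2 * ‖l₀‖ + 2 * ‖l₀‖⁻¹) with hC
  -- For each of the finitely many nonzero differences q = p / κ, the equation l (l - q) conj q = -q
  -- is quadratic in l. So only finitely many l in the neighbourhood have a partner with this
  -- difference.
  have hfin : (⋃ p ∈ {p : ℂ | ‖p‖ ≤ C ∧ ∀ γ ∈ Γ, planeWave p (conj p) γ = 1},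
      {l : ℂ | p ≠ 0 ∧ l * (l - p / κ) * conj (p / κ) = -(p / κ)}).Finite := by
    refine (finite_dual_lattice Γ C).biUnion fun p _ => ?_
    by_cases hp0 : p = 0
    · simp [hp0]
    have hq0 : p / κ ≠ 0 := div_ne_zero hp0 hp.ne_zero
    set q := p / κ
    let Q : Polynomial ℂ := Polynomial.X * (Polynomial.X - Polynomial.C q) *
      Polynomial.C (conj q) + Polynomial.C q
    have hQ : Q ≠ 0 := by
      intro h0
      have := congrArg (Polynomial.eval 0) h0
      simp [Q] at this
      exact hq0 this
    refine (Polynomial.finite_setOfPred_isRoot hQ).subset ?_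
    rintro l ⟨_, hl⟩
    change Polynomial.eval l Q = 0
    simp only [Q, Polynomial.eval_add, Polynomial.eval_mul, Polynomial.eval_X, Polynomial.eval_sub,
      Polynomial.eval_C]
    rw [hl]; ring
  have hnhds : ∀ᶠ l in 𝓝[≠] l₀, ‖l‖ < 2 * ‖l₀‖ ∧ ‖l₀‖ / 2 < ‖l‖ := by
    have hpos : 0 < ‖l₀‖ := norm_pos_iff.2 hl₀
    have h1 : Tendsto (fun l : ℂ => ‖l‖) (𝓝[≠] l₀) (𝓝 ‖l₀‖) :=
      (continuous_norm.tendsto l₀).mono_left nhdsWithin_le_nhds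
    exact (h1.eventually_lt_const (by linarith)).and (h1.eventually_const_lt (by linarith))
  have hcompl := mem_nhdsWithin_of_mem_nhds (t := {l₀}ᶜ)
    ((hfin.subset sdiff_subset).isClosed.isOpen_compl.mem_nhds
      (fun h => h.2 rfl : l₀ ∈ (_ \ {l₀})ᶜ))
  filter_upwards [hnhds, hcompl, self_mem_nhdsWithin] with l hl hnot hne l' hl' hll
  by_contra hne'
  refine hnot ⟨?_, hne⟩
  have hl0 : l ≠ 0 := by
    rintro rfl
    rw [norm_zero] at hl
    linarith [norm_nonneg l₀]
  obtain ⟨h1, h2⟩ := modeMultiplier_eq hp hll.symm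
  have h3 : κ * (l - l') / κ = l - l' := mul_div_cancel_left₀ _ hp.ne_zero
  refine Set.mem_biUnion (x := κ * (l - l')) ⟨?_, h2⟩ ⟨?_, ?_⟩
  · rw [norm_mul]
    refine mul_le_mul_of_nonneg_left ((norm_sub_le_of_multiplier hl0 hl' h1).trans ?_)
      (norm_nonneg _)
    have hpos : 0 < ‖l₀‖ := norm_pos_iff.2 hl₀
    have : ‖l‖⁻¹ ≤ 2 * ‖l₀‖⁻¹ := by
      rw [inv_le_comm₀ (by linarith) (by positivity), mul_inv, inv_inv]; linarith
    linarith
  · exact mul_ne_zero hp.ne_zero (sub_ne_zero.2 (Ne.symm hne'))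
  · rw [h3, sub_sub_cancel]
    exact mul_mul_conj_sub_eq hl0 hl' h1

/-! ### Properness of the family of multipliers -/

omit [DiscreteTopology Γ] [IsZLattice ℝ Γ] in
-- As 2κγ + conj(2κγ) is in 2πℤ, the summand 1 in l + 1 contributes only a sign. The modulus comes
-- from κlγ and |l|⁻² conj(κlγ) alone.
theorem log_norm_modeMultiplier (hp : IsPhase Γ κ e₀) {l : ℂ} (γ : Γ) :
    Real.log ‖modeMultiplier Γ κ l γ‖ = -((1 - (‖l‖ ^ 2)⁻¹) * (κ * l * γ).im) := by
  rw [modeMultiplier_apply, planeWave, Complex.norm_exp, Real.log_exp]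
  obtain ⟨n, hn⟩ := planeWave_eq_one_iff.1 (hp.wave_eq_one γ γ.2)
  have h1 : Complex.I * (κ * (l + 1) * γ + conj κ * (l⁻¹ + 1) * conj (γ : ℂ)) =
      Complex.I * (κ * l * γ + ((‖l‖ ^ 2)⁻¹ : ℝ) * conj (κ * l * γ) + Real.pi * n) := by
    have h2 : l⁻¹ = ((‖l‖ ^ 2)⁻¹ : ℝ) * conj l := by
      rw [Complex.inv_def, Complex.normSq_eq_norm_sq]; ring
    rw [h2]
    simp only [map_mul]
    linear_combination Complex.I / 2 * hn
  rw [h1]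
  simp only [Complex.mul_re, Complex.I_re, Complex.I_im, Complex.add_im, Complex.mul_im,
    Complex.ofReal_re, Complex.ofReal_im, Complex.conj_im, Complex.intCast_im, Complex.intCast_re]
  ring

/-- The real linear map w ↦ (Im(w bᵢ)) is injective because the bᵢ span ℂ over ℝ, and an injective
linear map in finite dimension is bounded below. -/
theorem exists_norm_le_im_basis (b : Module.Basis (Fin 2) ℤ Γ) :
    ∃ C : ℝ, ∀ w : ℂ, ∀ M : ℝ, (∀ i, |(w * b i).im| ≤ M) → ‖w‖ ≤ C * M := by
  let φ : ℂ →ₗ[ℝ] (Fin 2 → ℝ) :=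
    LinearMap.pi fun i => Complex.imLm ∘ₗ LinearMap.mulRight ℝ (b i : ℂ)
  have hinj : Function.Injective φ := by
    rw [injective_iff_map_eq_zero]
    intro w hw
    have h1 : Complex.imLm ∘ₗ LinearMap.mulLeft ℝ w = (0 : ℂ →ₗ[ℝ] ℝ) := by
      refine (b.ofZLatticeBasis ℝ Γ).ext fun i => ?_
      rw [Module.Basis.ofZLatticeBasis_apply ℝ Γ b i]
      exact congrFun hw i
    have h2 : (w * 1).im = 0 := LinearMap.congr_fun h1 1
    have h3 : (w * Complex.I).im = 0 := LinearMap.congr_fun h1 Complex.I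
    simp at h2 h3
    exact Complex.ext h3 h2
  obtain ⟨K, hK, hφ⟩ := φ.exists_antilipschitzWith (LinearMap.ker_eq_bot.2 hinj)
  refine ⟨K, fun w M hM => ?_⟩
  have h1 := hφ.le_mul_norm (map_zero φ) w
  have hM0 : 0 ≤ M := (abs_nonneg _).trans (hM 0)
  refine h1.trans (mul_le_mul_of_nonneg_left ?_ K.2)
  exact (pi_norm_le_iff_of_nonneg hM0).2 hM

/-- The parameters of the multipliers in a compact set stay away from `0` and `∞`. -/
theorem exists_bounds_of_isCompact (hp : IsPhase Γ κ e₀) {K : Set (AddChar Γ ℂ)}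
    (hK : IsCompact K) : ∃ R > 0, ∀ l ≠ 0, modeMultiplier Γ κ l ∈ K → R⁻¹ ≤ ‖l‖ ∧ ‖l‖ ≤ R := by
  obtain ⟨b⟩ := exists_lattice_basis Γ
  obtain ⟨C, hC⟩ := exists_norm_le_im_basis b
  have hcont : ∀ i, ContinuousOn (fun h : AddChar Γ ℂ => Real.log ‖h (b i)‖) K := by
    intro i
    have h1 : Continuous (fun h : AddChar Γ ℂ => h (b i)) :=
      (continuous_apply (b i)).comp continuous_induced_dom
    refine ContinuousOn.log h1.norm.continuousOn fun h _ => ?_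
    rw [norm_ne_zero_iff]
    obtain ⟨p, q, hpq⟩ := AddChar.exists_planeWave h
    rw [← hpq]
    exact planeWave_ne_zero _ _ _
  have hbdd : ∀ i, ∃ M, ∀ h ∈ K, |Real.log ‖h (b i)‖| ≤ M := fun i => by
    obtain ⟨M, hM⟩ := (hK.image_of_continuousOn (hcont i)).isBounded.exists_norm_le
    exact ⟨M, fun h hh => hM _ (mem_image_of_mem _ hh)⟩
  choose M hM using hbdd
  have hκ : 0 < ‖κ‖ := norm_pos_iff.2 hp.ne_zero
  set T : ℝ := |C * max (M 0) (M 1) / ‖κ‖| with hT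
  refine ⟨T + 1, by positivity, fun l hl hlK => ?_⟩
  have hl0 : 0 < ‖l‖ := norm_pos_iff.2 hl
  have h1 := hC (((1 - (‖l‖ ^ 2)⁻¹ : ℝ) : ℂ) * (κ * l)) (max (M 0) (M 1)) fun i => by
    have h2 := hM i _ hlK
    rw [log_norm_modeMultiplier hp, abs_neg] at h2
    rw [mul_assoc, Complex.im_ofReal_mul]
    refine h2.trans ?_
    fin_cases i
    · exact le_max_left _ _
    · exact le_max_right _ _
  rw [norm_mul, norm_mul, Complex.norm_real, Real.norm_eq_abs] at h1
  -- Bounds for the logarithms of the multiplier give a bound for ||l| - |l|⁻¹|, which keeps |l|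
  -- away from both 0 and ∞.
  have h2 : |‖l‖ - ‖l‖⁻¹| ≤ T := by
    have h3 : |1 - (‖l‖ ^ 2)⁻¹| * ‖l‖ = |‖l‖ - ‖l‖⁻¹| := by
      rw [show ‖l‖ - ‖l‖⁻¹ = (1 - (‖l‖ ^ 2)⁻¹) * ‖l‖ by field_simp, abs_mul, abs_of_pos hl0]
    rw [← h3, hT]
    refine le_trans ?_ (le_abs_self _)
    rw [le_div_iff₀ hκ]
    linarith
  obtain ⟨h4, h5⟩ := abs_le.1 h2
  have hT0 : 0 ≤ T := abs_nonneg _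
  have h6 : ‖l‖ * ‖l‖⁻¹ = 1 := mul_inv_cancel₀ hl0.ne'
  have h7 : 0 < ‖l‖⁻¹ := inv_pos.2 hl0
  constructor
  · rw [inv_le_comm₀ (by positivity) hl0]
    by_contra! hlt
    have : 1 < ‖l‖⁻¹ := by linarith
    have : ‖l‖ < 1 := by nlinarith
    linarith
  · by_contra! hlt
    have : 1 < ‖l‖ := by linarith
    have : ‖l‖⁻¹ < 1 := by nlinarith
    linarith

end Lattice

/-! ### Expansion of holomorphic sections with multiplier -/

/-- The Fourier coefficient of `ψ` for `planeWave p q`. -/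
def waveCoeff (D : Set ℂ) (ψ : ℂ → ℂ) (p q : ℂ) : ℂ := ∫ z in D, ψ z * planeWave (-p) (-q) z

section Multiplier

variable {Γ : Submodule ℤ ℂ} {h : AddChar Γ ℂ}

theorem HasMultiplier.coordA {α : ℂ → ℍ} (hα : HasMultiplier Γ h α) :
    HasComplexMultiplier h (fun z => coordA (α z)) := fun γ z => by
  simp only [hα γ z, coordA_mul_coe]

theorem HasMultiplier.coordB {α : ℂ → ℍ} (hα : HasMultiplier Γ h α) :
    HasComplexMultiplier h (fun z => coordB (α z)) := fun γ z => by
  simp only [hα γ z, coordB_mul_coe]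

theorem HasComplexMultiplier.fderiv_apply {ψ : ℂ → ℂ} (hψ : HasComplexMultiplier h ψ)
    (hd : Differentiable ℝ ψ) (v : ℂ) : HasComplexMultiplier h (fun z => fderiv ℝ ψ z v) := by
  intro γ z
  have h1 : (fun w => ψ (w + γ)) = fun w => ψ w * h γ := funext fun w => hψ γ w
  simp only
  rw [← fderiv_comp_add_right, h1, fderiv_mul_const (hd z)]
  simp [mul_comm]

theorem waveCoeff_planeWave_mul (D : Set ℂ) (ψ : ℂ → ℂ) (p q p' q' : ℂ) :
    waveCoeff D (fun z => planeWave p' q' z * ψ z) p q = waveCoeff D ψ (p - p') (q - q') := by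
  unfold waveCoeff
  congr 1
  ext z
  rw [mul_right_comm, planeWave_mul, mul_comm]
  ring_nf

theorem waveCoeff_const_mul (D : Set ℂ) (ψ : ℂ → ℂ) (p q c : ℂ) :
    waveCoeff D (fun z => c * ψ z) p q = c * waveCoeff D ψ p q := by
  simp only [waveCoeff, mul_assoc, integral_const_mul]

variable [DiscreteTopology Γ] [IsZLattice ℝ Γ] {D : Set ℂ} {κ e₀ : ℂ}

theorem integrableOn_mul_planeWave (hD : IsAddFundamentalDomain Γ D volume) {ψ : ℂ → ℂ}
    (hψ : HasComplexMultiplier h ψ) (hc : Continuous ψ) {p q : ℂ}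
    (hpq : ∀ γ : Γ, planeWave p q γ = h γ) :
    IntegrableOn (fun z => ψ z * planeWave (-p) (-q) z) D :=
  integrableOn_of_periodic hD (hc.mul (continuous_planeWave _ _))
    (isPeriodic_mul_planeWave_neg hψ hpq)

/-- Integration by parts: the product with the inverse wave is periodic, so its derivative has
integral zero. -/
theorem waveCoeff_fderiv (hD : IsAddFundamentalDomain Γ D volume) {ψ : ℂ → ℂ}
    (hψ : HasComplexMultiplier h ψ) (hd : ContDiff ℝ 1 ψ) {p q : ℂ}
    (hpq : ∀ γ : Γ, planeWave p q γ = h γ) (v : ℂ) :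
    waveCoeff D (fun z => fderiv ℝ ψ z v) p q =
      Complex.I * (p * v + q * conj v) * waveCoeff D ψ p q := by
  have hdiff : Differentiable ℝ ψ := hd.differentiable one_ne_zero
  have h1 := setIntegral_fderiv_eq_zero hD
    (hd.mul ((contDiff_planeWave (-p) (-q)).of_le (by simp)))
    (isPeriodic_mul_planeWave_neg hψ hpq) v
  have h2 : ∀ z, fderiv ℝ (fun y => ψ y * planeWave (-p) (-q) y) z v =
      fderiv ℝ ψ z v * planeWave (-p) (-q) z -
        Complex.I * (p * v + q * conj v) * (ψ z * planeWave (-p) (-q) z) := fun z => by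
    rw [fderiv_fun_mul (hdiff z) (differentiable_planeWave _ _ z)]
    simp only [_root_.add_apply, _root_.smul_apply, smul_eq_mul, fderiv_planeWave]
    ring
  change ∫ z in D, fderiv ℝ (fun y => ψ y * planeWave (-p) (-q) y) z v = 0 at h1
  simp only [h2] at h1
  rw [integral_sub, integral_const_mul, sub_eq_zero] at h1
  · exact h1
  · exact integrableOn_mul_planeWave hD (hψ.fderiv_apply hdiff v)
      ((hd.continuous_fderiv one_ne_zero).clm_apply continuous_const) hpq
  · exact (integrableOn_mul_planeWave hD hψ hd.continuous hpq).const_mul _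

omit [DiscreteTopology Γ] [IsZLattice ℝ Γ] in
theorem IsPhase.planeWave_shift (hp : IsPhase Γ κ e₀) (l r : ℂ) (γ : Γ) :
    planeWave (κ * (l - 1)) (conj κ * (r - 1)) γ =
      planeWave (κ * (l + 1)) (conj κ * (r + 1)) γ := by
  rw [HSTorus.planeWave_shift, hp.wave_eq_one γ γ.2, one_mul]

theorem waveCoeff_phase_mul (D : Set ℂ) (ψ : ℂ → ℂ) (l r : ℂ) :
    waveCoeff D (fun z => phase κ e₀ z * ψ z) (κ * (l + 1)) (conj κ * (r + 1)) =
      e₀ * waveCoeff D ψ (κ * (l - 1)) (conj κ * (r - 1)) := by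
  simp only [phase, mul_assoc e₀]
  rw [waveCoeff_const_mul, waveCoeff_planeWave_mul]
  ring_nf

/-- The differential equation of holomorphic sections in terms of Fourier coefficients. -/
theorem waveCoeff_holSections (hp : IsPhase Γ κ e₀) (hD : IsAddFundamentalDomain Γ D volume)
    {α : ℂ → ℍ} (hα : α ∈ holSections Γ (phaseNormal κ e₀) h) {l r : ℂ}
    (hlr : ∀ γ : Γ, planeWave (κ * (l + 1)) (conj κ * (r + 1)) γ = h γ) :
    (l + 1) * waveCoeff D (fun z => coordA (α z)) (κ * (l + 1)) (conj κ * (r + 1)) =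
      e₀ * (l - 1) * waveCoeff D (fun z => coordB (α z)) (κ * (l - 1)) (conj κ * (r - 1)) ∧
    -(r + 1) * waveCoeff D (fun z => coordA (α z)) (κ * (l + 1)) (conj κ * (r + 1)) =
      e₀ * (r - 1) * waveCoeff D (fun z => coordB (α z)) (κ * (l - 1)) (conj κ * (r - 1)) := by
  obtain ⟨hs, hd, hm⟩ := hα
  set a := waveCoeff D (fun z => coordA (α z)) (κ * (l + 1)) (conj κ * (r + 1))
  set b := waveCoeff D (fun z => coordB (α z)) (κ * (l - 1)) (conj κ * (r - 1))
  have hdiff : Differentiable ℝ α := hs.differentiable (by simp)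
  have hA : ContDiff ℝ 1 (fun z => coordA (α z)) := coordA.contDiff.comp (hs.of_le (by simp))
  have hB : ContDiff ℝ 1 (fun z => coordB (α z)) := coordB.contDiff.comp (hs.of_le (by simp))
  -- The star acts on the v-part by i and on the conj v-part by -i, whence the sign in the second
  -- coefficient. Comparing both parts gives the two linear equations.
  have key : ∀ v : ℂ, (κ * (l + 1) * a) * v + (-(conj κ * (r + 1)) * a) * conj v =
      (e₀ * (κ * (l - 1)) * b) * v + (e₀ * (conj κ * (r - 1)) * b) * conj v := by
    intro v
    have h1 := waveCoeff_fderiv hD hm.coordA hA hlr (Complex.I * v)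
    have h2 := waveCoeff_fderiv hD hm.coordB hB
      (fun γ => (hp.planeWave_shift l r γ).trans (hlr γ)) v
    have h3 : (fun z => fderiv ℝ (fun w => coordA (α w)) z (Complex.I * v)) =
        fun z => Complex.I * (phase κ e₀ z * fderiv ℝ (fun w => coordB (α w)) z v) := by
      ext z
      rw [fderiv_coordA (hdiff z), fderiv_coordB (hdiff z), hd, phaseNormal, coordA_normalOf_mul,
        mul_assoc]
    rw [h3, waveCoeff_const_mul, waveCoeff_phase_mul, h2] at h1
    simp only [map_mul, Complex.conj_I] at h1
    change Complex.I * (e₀ * (_ * b)) = _ * a at h1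
    linear_combination h1 -
      (e₀ * b * (κ * (l - 1) * v + conj κ * (r - 1) * conj v) -
        a * (κ * (l + 1) * v - conj κ * (r + 1) * conj v)) * Complex.I_sq
  obtain ⟨h1, h2⟩ := linear_form_eq key
  have hκ := hp.ne_zero
  have hκ' : conj κ ≠ 0 := (map_ne_zero _).2 hκ
  constructor
  · apply mul_left_cancel₀ hκ; linear_combination h1
  · apply mul_left_cancel₀ hκ'; linear_combination h2

/-- Only the frequencies of the sections `mode κ e₀ l` occur in a holomorphic section. -/
theorem exists_coeff_of_holSections (hp : IsPhase Γ κ e₀)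
    (hD : IsAddFundamentalDomain Γ D volume) {α : ℂ → ℍ}
    (hα : α ∈ holSections Γ (phaseNormal κ e₀) h) {l r : ℂ}
    (hlr : ∀ γ : Γ, planeWave (κ * (l + 1)) (conj κ * (r + 1)) γ = h γ) :
    ∃ c, waveCoeff D (fun z => coordA (α z)) (κ * (l + 1)) (conj κ * (r + 1)) = e₀ * (l - 1) * c ∧
      waveCoeff D (fun z => coordB (α z)) (κ * (l - 1)) (conj κ * (r - 1)) = (l + 1) * c ∧
      (c ≠ 0 → l * r = 1) := by
  obtain ⟨h1, h2⟩ := waveCoeff_holSections hp hD hα hlr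
  have he0 : e₀ ≠ 0 := by rw [← norm_ne_zero_iff, hp.norm_eq_one]; exact one_ne_zero
  set a := waveCoeff D (fun z => coordA (α z)) (κ * (l + 1)) (conj κ * (r + 1))
  set b := waveCoeff D (fun z => coordB (α z)) (κ * (l - 1)) (conj κ * (r - 1))
  -- The determinant of the linear system for (a, e₀ b) is, up to sign, (l + 1)(r - 1) + (r + 1)(l -
  -- 1) = 2(l r - 1).
  have hdet : a ≠ 0 ∨ b ≠ 0 → l * r = 1 := by
    rintro (h0 | h0)
    · have : a * (l * r - 1) = 0 := by
        linear_combination (r - 1) / 2 * h1 - (l - 1) / 2 * h2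
      linear_combination (mul_eq_zero.1 this).resolve_left h0
    · have : (e₀ * b) * (l * r - 1) = 0 := by
        linear_combination -(r + 1) / 2 * h1 - (l + 1) / 2 * h2
      linear_combination (mul_eq_zero.1 this).resolve_left (mul_ne_zero he0 h0)
  -- The scalar c is read off from the second coordinate unless l = -1, where that coefficient
  -- vanishes and the first one is used.
  by_cases hl : l + 1 = 0
  · have hl2 : l - 1 ≠ 0 := fun h0 => by
      have : (2 : ℂ) = 0 := by linear_combination hl - h0
      norm_num at this
    have hb : b = 0 := by
      rw [hl, zero_mul] at h1
      exact (mul_eq_zero.1 h1.symm).resolve_left (mul_ne_zero he0 hl2)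
    refine ⟨a / (e₀ * (l - 1)), ?_, ?_, fun hc => hdet (Or.inl ?_)⟩
    · rw [mul_div_cancel₀ _ (mul_ne_zero he0 hl2)]
    · rw [hl, zero_mul, hb]
    · rintro h0; rw [h0, zero_div] at hc; exact hc rfl
  · refine ⟨b / (l + 1), ?_, ?_, fun hc => hdet (Or.inr ?_)⟩
    · rw [mul_div_assoc', ← h1, mul_div_cancel_left₀ _ hl]
    · rw [mul_div_cancel₀ _ hl]
    · rintro h0; rw [h0, zero_div] at hc; exact hc rfl

theorem waveCoeff_planeWave (hD : IsAddFundamentalDomain Γ D volume) {p q p' q' : ℂ}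
    (h1 : ∀ γ : Γ, planeWave p q γ = h γ) (h2 : ∀ γ : Γ, planeWave p' q' γ = h γ) (c : ℂ) :
    waveCoeff D (fun z => c * planeWave p' q' z) p q =
      if p' = p ∧ q' = q then c * volume.real D else 0 := by
  rw [waveCoeff_const_mul, waveCoeff]
  simp only [planeWave_mul, ← sub_eq_add_neg]
  split_ifs with heq
  · rw [heq.1, heq.2, sub_self, sub_self]
    simp [planeWave_zero_zero, Measure.real]
  · rw [setIntegral_planeWave_eq_zero hD, mul_zero]
    · intro γ hγ z
      have h3 : planeWave (p' - p) (q' - q) γ = 1 := by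
        have h4 := planeWave_mul (p' - p) (q' - q) p q γ
        rw [sub_add_cancel, sub_add_cancel, h2 ⟨γ, hγ⟩, h1 ⟨γ, hγ⟩] at h4
        have h5 : h ⟨γ, hγ⟩ ≠ 0 := by rw [← h1]; exact planeWave_ne_zero _ _ _
        exact mul_right_cancel₀ h5 (h4.trans (one_mul _).symm)
      rw [planeWave_add, h3, mul_one]
    · rwa [sub_eq_zero, sub_eq_zero]

/-- The parameters of the multiplier `h`. -/
def parameters (hp : IsPhase Γ κ e₀) (h : AddChar Γ ℂ) : Finset ℂ := (finite_fiber hp h).toFinset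

theorem mem_parameters {hp : IsPhase Γ κ e₀} {l : ℂ} :
    l ∈ parameters hp h ↔ l ≠ 0 ∧ modeMultiplier Γ κ l = h := by
  rw [parameters, Set.Finite.mem_toFinset]; rfl

theorem volume_real_ne_zero (hD : IsAddFundamentalDomain Γ D volume) : volume.real D ≠ 0 := by
  have h1 := hD.measure_ne_zero (NeZero.ne _)
  exact (ENNReal.toReal_pos h1 (volume_lt_top_of_fundamentalDomain hD).ne).ne'

/-- The numbers c l are the Fourier coefficients of α divided by the volume of D. The sum of modes
and α have the same coefficients at every frequency, so completeness of the exponentials makes them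
equal. The relation to the coefficients is kept for the study of parallel sections. -/
theorem exists_sum_of_holSections (hp : IsPhase Γ κ e₀) {α : ℂ → ℍ}
    (hD : IsAddFundamentalDomain Γ D volume)
    (hα : α ∈ holSections Γ (phaseNormal κ e₀) h) :
    ∃ c : ℂ → ℂ, (∀ z, α z = ∑ l ∈ parameters hp h, mode κ e₀ l z * (c l : ℍ)) ∧
      ∀ l ∈ parameters hp h,
        waveCoeff D (fun z => coordA (α z)) (κ * (l + 1)) (conj κ * (l⁻¹ + 1)) =
          e₀ * (l - 1) * (c l * volume.real D) ∧
        waveCoeff D (fun z => coordB (α z)) (κ * (l - 1)) (conj κ * (l⁻¹ - 1)) =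
          (l + 1) * (c l * volume.real D) := by
  classical
  have hV : (volume.real D : ℂ) ≠ 0 := Complex.ofReal_ne_zero.2 (volume_real_ne_zero hD)
  have hκ := hp.ne_zero
  have hκ' : conj κ ≠ 0 := (map_ne_zero _).2 hκ
  have hex : ∀ l, ∃ c, l ∈ parameters hp h →
        waveCoeff D (fun z => coordA (α z)) (κ * (l + 1)) (conj κ * (l⁻¹ + 1)) =
          e₀ * (l - 1) * (c * volume.real D) ∧
        waveCoeff D (fun z => coordB (α z)) (κ * (l - 1)) (conj κ * (l⁻¹ - 1)) =
          (l + 1) * (c * volume.real D) := by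
    intro l
    by_cases hl : l ∈ parameters hp h
    · obtain ⟨hl0, hlh⟩ := mem_parameters.1 hl
      obtain ⟨c, h1, h2, -⟩ := exists_coeff_of_holSections hp hD hα (l := l) (r := l⁻¹)
        fun γ => by rw [← hlh]; rfl
      refine ⟨c / volume.real D, fun _ => ?_⟩
      rw [div_mul_cancel₀ _ hV]
      exact ⟨h1, h2⟩
    · exact ⟨0, fun h => absurd h hl⟩
  choose c hc using hex
  refine ⟨c, ?_, hc⟩
  set σ : ℂ → ℍ := fun z => ∑ l ∈ parameters hp h, mode κ e₀ l z * (c l : ℍ)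
  have hA : ∀ z, coordA (σ z) = ∑ l ∈ parameters hp h,
      (e₀ * (l - 1) * c l) * planeWave (κ * (l + 1)) (conj κ * (l⁻¹ + 1)) z := fun z => by
    simp only [σ, map_sum, coordA_mul_coe, coordA_mode]
    exact Finset.sum_congr rfl fun l _ => by ring
  have hB : ∀ z, coordB (σ z) = ∑ l ∈ parameters hp h,
      ((l + 1) * c l) * planeWave (κ * (l - 1)) (conj κ * (l⁻¹ - 1)) z := fun z => by
    simp only [σ, map_sum, coordB_mul_coe, coordB_mode]
    exact Finset.sum_congr rfl fun l _ => by ring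
  have hmodeA : ∀ l ∈ parameters hp h, ∀ γ : Γ,
      planeWave (κ * (l + 1)) (conj κ * (l⁻¹ + 1)) γ = h γ := fun l hl γ => by
    rw [← (mem_parameters.1 hl).2]; rfl
  have hmodeB : ∀ l ∈ parameters hp h, ∀ γ : Γ,
      planeWave (κ * (l - 1)) (conj κ * (l⁻¹ - 1)) γ = h γ := fun l hl γ => by
    rw [hp.planeWave_shift]; exact hmodeA l hl γ
  have hσ : HasMultiplier Γ h σ := fun γ z => by
    simp only [σ, Finset.sum_mul]
    refine Finset.sum_congr rfl fun l hl => ?_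
    rw [hp.hasMultiplier_mode l γ z, (mem_parameters.1 hl).2, mul_assoc, mul_assoc,
      ← Quaternion.coeComplex_mul, ← Quaternion.coeComplex_mul, mul_comm (h γ)]
  have hσc : Continuous σ := continuous_finsetSum _ fun l _ =>
    ((contDiff_mode l).continuous.mul continuous_const)
  have hcA : Continuous fun z => coordA (σ z) := coordA.continuous.comp hσc
  have hcB : Continuous fun z => coordB (σ z) := coordB.continuous.comp hσc
  have hαA : Continuous fun z => coordA (α z) := coordA.continuous.comp hα.1.continuous
  have hαB : Continuous fun z => coordB (α z) := coordB.continuous.comp hα.1.continuous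
  have sumCoeff : ∀ (g : ℂ → ℂ) (P Q : ℂ → ℂ) (p q : ℂ), (∀ γ : Γ, planeWave p q γ = h γ) →
      (∀ l ∈ parameters hp h, ∀ γ : Γ, planeWave (P l) (Q l) γ = h γ) →
      waveCoeff D (fun z => ∑ l ∈ parameters hp h, g l * planeWave (P l) (Q l) z) p q =
        ∑ l ∈ parameters hp h, if P l = p ∧ Q l = q then g l * volume.real D else 0 := by
    intro g P Q p q hpq hPQ
    rw [waveCoeff]
    simp only [Finset.sum_mul]
    rw [integral_finsetSum]
    · exact Finset.sum_congr rfl fun l hl => waveCoeff_planeWave hD hpq (hPQ l hl) _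
    · intro l hl
      refine integrableOn_mul_planeWave (h := h) hD (fun γ z => ?_)
        (continuous_const.mul (continuous_planeWave _ _)) hpq
      simp only [Pi.mul_apply]
      rw [planeWave_add, hPQ l hl γ, mul_assoc]
  have hzero : ∀ (ψ φ : ℂ → ℂ), HasComplexMultiplier h ψ → HasComplexMultiplier h φ →
      Continuous ψ → Continuous φ →
      (∀ p q, (∀ γ : Γ, planeWave p q γ = h γ) → waveCoeff D ψ p q = waveCoeff D φ p q) →
      ψ = φ := by
    intro ψ φ hψ hφ hψc hφc heq
    rw [← sub_eq_zero]
    refine eq_zero_of_multiplier_of_integral_planeWave (h := h) hD (hψc.sub hφc)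
      (fun γ z => ?_) fun p q hpq => ?_
    · simp only [Pi.sub_apply, hψ γ z, hφ γ z, sub_mul]
    · simp only [Pi.sub_apply, sub_mul]
      rw [integral_sub (integrableOn_mul_planeWave hD hψ hψc hpq)
        (integrableOn_mul_planeWave hD hφ hφc hpq), sub_eq_zero]
      exact heq p q hpq
  have hfreq : ∀ l m s t : ℂ, (∀ u : ℂ, κ * (l + u) = κ * (m + u) ↔ l = m) ∧
      (∀ u : ℂ, conj κ * (s + u) = conj κ * (t + u) ↔ s = t) := fun l m s t =>
    ⟨fun u => by rw [mul_right_inj' hκ, add_left_inj], fun u => by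
      rw [mul_right_inj' hκ', add_left_inj]⟩
  have hcond : ∀ m s : ℂ, ∀ u : ℂ, ∀ G : ℂ → ℂ,
      (∑ l ∈ parameters hp h, if κ * (l + u) = κ * (m + u) ∧ conj κ * (l⁻¹ + u) = conj κ * (s + u)
        then G l else 0) = if m ∈ parameters hp h ∧ m⁻¹ = s then G m else 0 := by
    intro m s u G
    have h1 : ∀ l, (κ * (l + u) = κ * (m + u) ∧ conj κ * (l⁻¹ + u) = conj κ * (s + u)) ↔
        l = m ∧ m⁻¹ = s := fun l => by
      rw [(hfreq l m l⁻¹ s).1, (hfreq l m l⁻¹ s).2]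
      constructor
      · rintro ⟨rfl, h⟩; exact ⟨rfl, h⟩
      · rintro ⟨rfl, h⟩; exact ⟨rfl, h⟩
    simp only [h1, ite_and, Finset.sum_ite_eq']
  -- At an arbitrary frequency (m, s) compatible with h, the coefficients of α vanish unless s = m⁻¹
  -- and m is a parameter of h.
  have main : ∀ m s : ℂ, (∀ γ : Γ, planeWave (κ * (m + 1)) (conj κ * (s + 1)) γ = h γ) →
      waveCoeff D (fun z => coordA (α z)) (κ * (m + 1)) (conj κ * (s + 1)) =
        (if m ∈ parameters hp h ∧ m⁻¹ = s then e₀ * (m - 1) * c m * volume.real D else 0) ∧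
      waveCoeff D (fun z => coordB (α z)) (κ * (m - 1)) (conj κ * (s - 1)) =
        (if m ∈ parameters hp h ∧ m⁻¹ = s then (m + 1) * c m * volume.real D else 0) := by
    intro m s hms
    split_ifs with hif
    · obtain ⟨hm, rfl⟩ := hif
      obtain ⟨h1, h2⟩ := hc m hm
      rw [h1, h2]
      constructor <;> ring
    · obtain ⟨c', h1, h2, h3⟩ := exists_coeff_of_holSections hp hD hα hms
      have hc0 : c' = 0 := by
        by_contra h0
        have h4 := h3 h0
        have hs := (eq_inv_of_mul_eq_one_right h4)
        have hm0 : m ≠ 0 := left_ne_zero_of_mul_eq_one h4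
        refine hif ⟨mem_parameters.2 ⟨hm0, ?_⟩, hs.symm⟩
        ext γ
        rw [modeMultiplier_apply, ← hs]
        exact hms γ
      rw [h1, h2, hc0, mul_zero, mul_zero]
      exact ⟨rfl, rfl⟩
  have hAeq : (fun z => coordA (α z)) = fun z => coordA (σ z) := by
    refine hzero _ _ hα.2.2.coordA hσ.coordA hαA hcA fun p q hpq => ?_
    -- Since κ ≠ 0, every frequency can be written in the normalized form.
    obtain ⟨m, rfl⟩ : ∃ m, p = κ * (m + 1) := ⟨p / κ - 1, by field_simp; ring⟩
    obtain ⟨s, rfl⟩ : ∃ s, q = conj κ * (s + 1) := ⟨q / conj κ - 1, by field_simp; ring⟩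
    rw [(main m s hpq).1, funext hA, sumCoeff _ _ _ _ _ hpq hmodeA, hcond]
  have hBeq : (fun z => coordB (α z)) = fun z => coordB (σ z) := by
    refine hzero _ _ hα.2.2.coordB hσ.coordB hαB hcB fun p q hpq => ?_
    obtain ⟨m, rfl⟩ : ∃ m, p = κ * (m - 1) := ⟨p / κ + 1, by field_simp; ring⟩
    obtain ⟨s, rfl⟩ : ∃ s, q = conj κ * (s - 1) := ⟨q / conj κ + 1, by field_simp; ring⟩
    rw [(main m s fun γ => by rw [← hp.planeWave_shift]; exact hpq γ).2, funext hB,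
      sumCoeff _ _ _ _ _ hpq hmodeB]
    simp only [sub_eq_add_neg, hcond]
  intro z
  exact ext_coord (congrFun hAeq z) (congrFun hBeq z)

end Multiplier

/-! ### The spectra of left normals with linear phase -/

section Spectra

variable {Γ : Submodule ℤ ℂ} {h : AddChar Γ ℂ} {κ e₀ : ℂ}

theorem mem_complexSpan_self (α : ℂ → ℍ) : α ∈ complexSpan α :=
  ⟨1, by ext1 z; rw [Quaternion.coeComplex_one, mul_one]⟩

theorem complexSpan_eq_of_mem {α β : ℂ → ℍ} (hβ : β ∈ complexSpan α) (hβ0 : β ≠ 0) :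
    complexSpan α = complexSpan β := by
  obtain ⟨c, rfl⟩ := hβ
  have hc : c ≠ 0 := by
    rintro rfl
    exact hβ0 (by ext1 z; simp)
  ext σ
  constructor
  · rintro ⟨d, rfl⟩
    refine ⟨c⁻¹ * d, ?_⟩
    ext1 z
    rw [mul_assoc, ← Quaternion.coeComplex_mul, mul_inv_cancel_left₀ hc]
  · rintro ⟨d, rfl⟩
    refine ⟨c * d, ?_⟩
    ext1 z
    rw [Quaternion.coeComplex_mul, mul_assoc]

theorem mul_coe_mem_holSections {N α : ℂ → ℍ} (hα : α ∈ holSections Γ N h) (c : ℂ) :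
    (fun z => α z * (c : ℍ)) ∈ holSections Γ N h := by
  obtain ⟨h1, h2, h3⟩ := hα
  refine ⟨h1.mul contDiff_const, fun z v => ?_, fun γ z => ?_⟩
  · have hd : DifferentiableAt ℝ α z := h1.differentiable (by simp) z
    rw [fderiv_mul_const' hd]
    simp only [_root_.smul_apply, MulOpposite.smul_eq_mul_unop, MulOpposite.unop_op]
    rw [h2, mul_assoc]
  · simp only [h3 γ z, mul_assoc, ← Quaternion.coeComplex_mul, mul_comm (h γ)]

theorem mul_coe_mem_eigenSections {N α : ℂ → ℍ} {μ : ℂ} (hα : α ∈ eigenSections Γ N μ h) (c : ℂ) :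
    (fun z => α z * (c : ℍ)) ∈ eigenSections Γ N μ h := by
  obtain ⟨h1, h2, h3⟩ := hα
  refine ⟨h1.mul contDiff_const, fun z v => ?_, fun γ z => ?_⟩
  · have hd : DifferentiableAt ℝ α z := h1.differentiable (by simp) z
    have h4 : ∀ d : ℂ, α z * (c : ℍ) * (d : ℍ) = α z * (d : ℍ) * (c : ℍ) := fun d => by
      rw [mul_assoc, mul_assoc, ← Quaternion.coeComplex_mul, ← Quaternion.coeComplex_mul, mul_comm]
    have h5 := congrArg (· * (c : ℍ)) (h2 z v)
    simp only [zero_mul] at h5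
    rw [← h5]
    simp only [dmu]
    rw [fderiv_mul_const' hd]
    simp only [_root_.smul_apply, MulOpposite.smul_eq_mul_unop, MulOpposite.unop_op, h4,
      ← mul_assoc (N z)]
    simp only [add_mul, mul_add, smul_mul_assoc, mul_assoc, h4]
  · simp only [h3 γ z, mul_assoc, ← Quaternion.coeComplex_mul, mul_comm (h γ)]

theorem complexSpan_subset_holSections {N α : ℂ → ℍ} (hα : α ∈ holSections Γ N h) :
    complexSpan α ⊆ holSections Γ N h := by
  rintro _ ⟨c, rfl⟩
  exact mul_coe_mem_holSections hα c

theorem complexSpan_subset_eigenSections {N α : ℂ → ℍ} {μ : ℂ}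
    (hα : α ∈ eigenSections Γ N μ h) : complexSpan α ⊆ eigenSections Γ N μ h := by
  rintro _ ⟨c, rfl⟩
  exact mul_coe_mem_eigenSections hα c

theorem mode_ne_zero' (he : ‖e₀‖ = 1) (l : ℂ) : mode κ e₀ l ≠ 0 := fun h0 =>
  mode_ne_zero he l 0 (congrFun h0 0)

theorem holSections_of_isComplexLine (hp : IsPhase Γ κ e₀) {l : ℂ} (hl : l ≠ 0)
    (hline : IsComplexLine (holSections Γ (phaseNormal κ e₀) (modeMultiplier Γ κ l))) :
    complexSpan (mode κ e₀ l) = holSections Γ (phaseNormal κ e₀) (modeMultiplier Γ κ l) := by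
  obtain ⟨α, -, h2⟩ := hline
  have h3 := hp.mode_mem_holSections hl
  rw [h2] at h3 ⊢
  exact (complexSpan_eq_of_mem h3 (mode_ne_zero' hp.norm_eq_one l)).symm

variable [DiscreteTopology Γ] [IsZLattice ℝ Γ]

theorem exists_parameter_of_holSections (hp : IsPhase Γ κ e₀) {α : ℂ → ℍ}
    (hα : α ∈ holSections Γ (phaseNormal κ e₀) h) (hα0 : α ≠ 0) :
    ∃ l ≠ 0, modeMultiplier Γ κ l = h := by
  obtain ⟨D, hD⟩ := exists_fundamentalDomain Γ
  obtain ⟨c, hc, -⟩ := exists_sum_of_holSections hp hD hα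
  by_contra! hne
  refine hα0 (funext fun z => ?_)
  rw [hc, Finset.sum_eq_zero]
  · rfl
  · intro l hl
    obtain ⟨hl0, hlh⟩ := mem_parameters.1 hl
    exact absurd hlh (hne l hl0)

theorem Spec_phaseNormal (hp : IsPhase Γ κ e₀) :
    Spec Γ (phaseNormal κ e₀) = modeMultiplier Γ κ '' {0}ᶜ := by
  ext h
  constructor
  · rintro ⟨α, hα, hα0⟩
    obtain ⟨l, hl, hlh⟩ := exists_parameter_of_holSections hp hα hα0
    exact ⟨l, hl, hlh⟩
  · rintro ⟨l, hl, rfl⟩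
    exact ⟨_, hp.mode_mem_holSections hl, mode_ne_zero' hp.norm_eq_one l⟩

/-- In the (1,0)-part of the equation, the Fourier coefficient at the frequency of l reads (l + 1)(l
- 1) e₀ c = (μ - 1) e₀ c up to the factor -2. -/
theorem eq_sq_of_eigenSections (hp : IsPhase Γ κ e₀) {D : Set ℂ}
    (hD : IsAddFundamentalDomain Γ D volume) {μ : ℂ} (hμ : μ ≠ 0) {α : ℂ → ℍ}
    (hα : α ∈ eigenSections Γ (phaseNormal κ e₀) μ h) {l c : ℂ}
    (hlh : modeMultiplier Γ κ l = h) (hc : c ≠ 0)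
    (hA : waveCoeff D (fun z => coordA (α z)) (κ * (l + 1)) (conj κ * (l⁻¹ + 1)) =
      e₀ * (l - 1) * c)
    (hB : waveCoeff D (fun z => coordB (α z)) (κ * (l - 1)) (conj κ * (l⁻¹ - 1)) =
      (l + 1) * c) : μ = l ^ 2 := by
  have he0 : e₀ ≠ 0 := by rw [← norm_ne_zero_iff, hp.norm_eq_one]; exact one_ne_zero
  have hκ := hp.ne_zero
  have hκ' : conj κ ≠ 0 := (map_ne_zero _).2 hκ
  have hs := hα.1
  have hd : Differentiable ℝ α := hs.differentiable (by simp)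
  have hsA : ContDiff ℝ 1 (fun z => coordA (α z)) := coordA.contDiff.comp (hs.of_le (by simp))
  have hsB : ContDiff ℝ 1 (fun z => coordB (α z)) := coordB.contDiff.comp (hs.of_le (by simp))
  have hmA := hα.2.2.coordA
  have hmB := hα.2.2.coordB
  have hpq : ∀ γ : Γ, planeWave (κ * (l + 1)) (conj κ * (l⁻¹ + 1)) γ = h γ := fun γ => by
    rw [← hlh]; rfl
  have hmE : HasComplexMultiplier h (fun z => phase κ e₀ z * coordB (α z)) := fun γ z => by
    simp only [hp.phase_add γ.2, hmB γ z, mul_assoc]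
  have hint1 : ∀ v, IntegrableOn (fun z => fderiv ℝ (fun w => coordA (α w)) z v *
      planeWave (-(κ * (l + 1))) (-(conj κ * (l⁻¹ + 1))) z) D := fun v =>
    integrableOn_mul_planeWave hD (hmA.fderiv_apply (hsA.differentiable one_ne_zero) v)
      ((hsA.continuous_fderiv one_ne_zero).clm_apply continuous_const) hpq
  have hint2 := integrableOn_mul_planeWave hD hmA hsA.continuous hpq
  have hint3 := integrableOn_mul_planeWave hD hmE
    ((contDiff_phase κ e₀).continuous.mul hsB.continuous) hpq
  have key : waveCoeff D (fun z => fderiv ℝ (fun w => coordA (α w)) z (Complex.I * κ⁻¹))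
        (κ * (l + 1)) (conj κ * (l⁻¹ + 1)) +
      Complex.I * waveCoeff D (fun z => fderiv ℝ (fun w => coordA (α w)) z κ⁻¹)
        (κ * (l + 1)) (conj κ * (l⁻¹ + 1)) =
      (μ - 1) * (waveCoeff D (fun z => coordA (α z)) (κ * (l + 1)) (conj κ * (l⁻¹ + 1)) -
        waveCoeff D (fun z => phase κ e₀ z * coordB (α z)) (κ * (l + 1)) (conj κ * (l⁻¹ + 1))) := by
    simp only [waveCoeff]
    rw [← integral_sub hint2 hint3, ← integral_const_mul, ← integral_const_mul,
      ← integral_add (hint1 _) ((hint1 _).const_mul _)]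
    congr 1
    ext z
    have := coordA_eigenSection hp hμ hα z
    rw [fderiv_coordA (hd z), fderiv_coordA (hd z)]
    linear_combination planeWave (-(κ * (l + 1))) (-(conj κ * (l⁻¹ + 1))) z * this
  rw [waveCoeff_fderiv hD hmA hsA hpq, waveCoeff_fderiv hD hmA hsA hpq, waveCoeff_phase_mul,
    hA, hB] at key
  simp only [map_mul, Complex.conj_I, map_inv₀] at key
  have h1 : κ * κ⁻¹ = 1 := mul_inv_cancel₀ hκ
  have h2 : conj κ * (conj κ)⁻¹ = 1 := mul_inv_cancel₀ hκ'
  have h3 : (2 * e₀ * c) * (μ - l ^ 2) = 0 := by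
    linear_combination (norm := skip) key
    field_simp
    ring_nf
    simp only [Complex.I_sq]
    ring
  have h4 : 2 * e₀ * c ≠ 0 := mul_ne_zero (mul_ne_zero two_ne_zero he0) hc
  exact sub_eq_zero.1 ((mul_eq_zero.1 h3).resolve_left h4)

/-- A parallel section is holomorphic and so a sum of modes; comparison of coefficients leaves only
the square roots of μ. -/
theorem exists_sum_of_eigenSections (hp : IsPhase Γ κ e₀) {μ : ℂ} (hμ : μ ≠ 0) {α : ℂ → ℍ}
    (hα : α ∈ eigenSections Γ (phaseNormal κ e₀) μ h) :
    ∃ c : ℂ → ℂ, (∀ z, α z = ∑ l ∈ parameters hp h, mode κ e₀ l z * (c l : ℍ)) ∧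
      ∀ l ∈ parameters hp h, c l ≠ 0 → μ = l ^ 2 := by
  obtain ⟨D, hD⟩ := exists_fundamentalDomain Γ
  obtain ⟨c, hc, hcoeff⟩ := exists_sum_of_holSections hp hD
    (eigenSections_subset_holSections hp.norm_eq_one μ h hα)
  refine ⟨c, hc, fun l hl hcl => ?_⟩
  obtain ⟨h1, h2⟩ := hcoeff l hl
  exact eq_sq_of_eigenSections hp hD hμ hα (mem_parameters.1 hl).2
    (mul_ne_zero hcl (Complex.ofReal_ne_zero.2 (volume_real_ne_zero hD))) h1 h2

theorem Eig_phaseNormal (hp : IsPhase Γ κ e₀) :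
    Eig Γ (phaseNormal κ e₀) = (fun l => (l ^ 2, modeMultiplier Γ κ l)) '' {0}ᶜ := by
  ext ⟨μ, h⟩
  constructor
  · rintro ⟨hμ, α, hα, hα0⟩
    obtain ⟨c, hc, hsq⟩ := exists_sum_of_eigenSections hp hμ hα
    obtain ⟨l, hl, hcl⟩ : ∃ l ∈ parameters hp h, c l ≠ 0 := by
      by_contra! h0
      refine hα0 (funext fun z => ?_)
      rw [hc, Finset.sum_eq_zero fun l hl => by rw [h0 l hl, Quaternion.coeComplex_zero, mul_zero]]
      rfl
    obtain ⟨hl0, hlh⟩ := mem_parameters.1 hl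
    exact ⟨l, hl0, Prod.ext (hsq l hl hcl).symm hlh⟩
  · rintro ⟨l, hl, heq⟩
    obtain ⟨rfl, rfl⟩ := Prod.ext_iff.1 heq
    exact ⟨pow_ne_zero 2 hl, _, hp.mode_mem_eigenSections hl, mode_ne_zero' hp.norm_eq_one l⟩

theorem holSections_eq_complexSpan (hp : IsPhase Γ κ e₀) {l : ℂ} (hl : l ≠ 0)
    (hinj : ∀ l' ≠ 0, modeMultiplier Γ κ l' = modeMultiplier Γ κ l → l' = l) :
    holSections Γ (phaseNormal κ e₀) (modeMultiplier Γ κ l) = complexSpan (mode κ e₀ l) := by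
  refine Subset.antisymm (fun α hα => ?_)
    (complexSpan_subset_holSections (hp.mode_mem_holSections hl))
  obtain ⟨D, hD⟩ := exists_fundamentalDomain Γ
  obtain ⟨c, hc, -⟩ := exists_sum_of_holSections hp hD hα
  refine ⟨c l, funext fun z => ?_⟩
  rw [hc, Finset.sum_eq_single_of_mem l (mem_parameters.2 ⟨hl, rfl⟩)]
  intro l' hl' hne
  obtain ⟨h1, h2⟩ := mem_parameters.1 hl'
  exact absurd (hinj l' h1 h2) hne

/-- Only the modes of l and -l can occur for μ = l², and the latter has another multiplier. -/
theorem eigenSections_eq_complexSpan (hp : IsPhase Γ κ e₀) {l : ℂ} (hl : l ≠ 0)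
    (hne : modeMultiplier Γ κ (-l) ≠ modeMultiplier Γ κ l) :
    eigenSections Γ (phaseNormal κ e₀) (l ^ 2) (modeMultiplier Γ κ l) =
      complexSpan (mode κ e₀ l) := by
  refine Subset.antisymm (fun α hα => ?_)
    (complexSpan_subset_eigenSections (hp.mode_mem_eigenSections hl))
  obtain ⟨c, hc, hsq⟩ := exists_sum_of_eigenSections hp (pow_ne_zero 2 hl) hα
  refine ⟨c l, funext fun z => ?_⟩
  rw [hc, Finset.sum_eq_single_of_mem l (mem_parameters.2 ⟨hl, rfl⟩)]
  intro l' hl' hne'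
  obtain ⟨h1, h2⟩ := mem_parameters.1 hl'
  by_cases hcl : c l' = 0
  · rw [hcl, Quaternion.coeComplex_zero, mul_zero]
  · rcases sq_eq_sq_iff_eq_or_eq_neg.1 (hsq l' hl' hcl) with h3 | h3
    · exact absurd h3.symm hne'
    · rw [h3, neg_neg] at hne
      exact absurd h2 (by rw [h3]; exact fun h4 => hne h4)

/-- The eigenlines where the monodromy has two different eigenvalues. -/
theorem eigenSections_of_exists_ne (hp : IsPhase Γ κ e₀) {l : ℂ} (hl : l ≠ 0)
    (hne : ∃ h, h ≠ modeMultiplier Γ κ l ∧ (l ^ 2, h) ∈ Eig Γ (phaseNormal κ e₀)) :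
    eigenSections Γ (phaseNormal κ e₀) (l ^ 2) (modeMultiplier Γ κ l) =
      complexSpan (mode κ e₀ l) := by
  obtain ⟨h, hh, hE⟩ := hne
  rw [Eig_phaseNormal hp] at hE
  obtain ⟨l', hl', heq⟩ := hE
  obtain ⟨h1, rfl⟩ := Prod.ext_iff.1 heq
  refine eigenSections_eq_complexSpan hp hl ?_
  rcases sq_eq_sq_iff_eq_or_eq_neg.1 h1 with h3 | h3
  · exact absurd (by rw [h3]) hh
  · rw [← h3]; exact hh

end Spectra

end HSTorus

end

noncomputable section

namespace HSTorus

/-! ### Holomorphic functions on Riemann surfaces -/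

section Surface

variable {S : Type*} [TopologicalSpace S] [ChartedSpace ℂ S]

theorem tendsto_chartAt_symm_nhdsNE (x : S) :
    Tendsto (chartAt ℂ x).symm (𝓝[≠] (chartAt ℂ x x)) (𝓝[≠] x) := by
  set φ := chartAt ℂ x
  have hx : x ∈ φ.source := mem_chart_source ℂ x
  refine tendsto_nhdsWithin_iff.2 ⟨?_, ?_⟩
  · have := (φ.continuousAt_symm (φ.map_source hx)).tendsto
    rw [φ.left_inv hx] at this
    exact this.mono_left nhdsWithin_le_nhds
  · filter_upwards [mem_nhdsWithin_of_mem_nhds (φ.open_target.mem_nhds (φ.map_source hx)),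
      self_mem_nhdsWithin] with w hw hne heq
    have heq : φ.symm w = x := heq
    exact hne (by rw [mem_singleton_iff, ← heq, φ.right_inv hw])

theorem tendsto_chartAt_nhdsNE (x : S) :
    Tendsto (chartAt ℂ x) (𝓝[≠] x) (𝓝[≠] (chartAt ℂ x x)) := by
  set φ := chartAt ℂ x
  have hx : x ∈ φ.source := mem_chart_source ℂ x
  refine tendsto_nhdsWithin_iff.2 ⟨(φ.continuousAt hx).tendsto.mono_left nhdsWithin_le_nhds, ?_⟩
  filter_upwards [mem_nhdsWithin_of_mem_nhds (φ.open_source.mem_nhds hx),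
    self_mem_nhdsWithin] with w hw hne heq
  exact hne (φ.injOn hw hx heq)

theorem nhdsNE_neBot_surface (x : S) : (𝓝[≠] x).NeBot :=
  (tendsto_chartAt_symm_nhdsNE x).neBot

theorem tendsto_chartAt_symm_nhds (x : S) :
    Tendsto (chartAt ℂ x).symm (𝓝 (chartAt ℂ x x)) (𝓝 x) := by
  have hx := mem_chart_source ℂ x
  have := ((chartAt ℂ x).continuousAt_symm ((chartAt ℂ x).map_source hx)).tendsto
  rwa [(chartAt ℂ x).left_inv hx] at this

theorem eventually_comp_chartAt_symm {f : S → ℂ} (x : S) :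
    ∀ᶠ y in 𝓝 x, (f ∘ (chartAt ℂ x).symm) (chartAt ℂ x y) = f y := by
  filter_upwards [(chartAt ℂ x).open_source.mem_nhds (mem_chart_source ℂ x)] with y hy
  rw [Function.comp_apply, (chartAt ℂ x).left_inv hy]

theorem mdifferentiableAt_iff_chart {f : S → ℂ} {x : S} :
    MDifferentiableAt 𝓘(ℂ) 𝓘(ℂ) f x ↔
      DifferentiableAt ℂ (f ∘ (chartAt ℂ x).symm) (chartAt ℂ x x) := by
  rw [mdifferentiableAt_iff]
  have h2 : (writtenInExtChartAt 𝓘(ℂ) 𝓘(ℂ) x f) = f ∘ (chartAt ℂ x).symm := by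
    ext; simp [writtenInExtChartAt, chartAt_self_eq]
  rw [h2]
  simp only [modelWithCornersSelf_coe, range_id, differentiableWithinAt_univ, extChartAt,
    OpenPartialHomeomorph.extend, modelWithCornersSelf_partialEquiv, PartialEquiv.trans_refl,
    OpenPartialHomeomorph.toFun_eq_coe]
  refine ⟨fun h => h.2, fun h => ⟨?_, h⟩⟩
  have h3 : ContinuousAt ((f ∘ (chartAt ℂ x).symm) ∘ chartAt ℂ x) x :=
    h.continuousAt.comp ((chartAt ℂ x).continuousAt (mem_chart_source ℂ x))
  exact h3.congr (eventually_comp_chartAt_symm x)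

variable [IsManifold 𝓘(ℂ) ω S]

theorem MDifferentiable.differentiableOn_chart {f : S → ℂ} (hf : MDifferentiable 𝓘(ℂ) 𝓘(ℂ) f)
    (x : S) : DifferentiableOn ℂ (f ∘ (chartAt ℂ x).symm) (chartAt ℂ x).target := by
  have : IsManifold 𝓘(ℂ) 1 S := IsManifold.of_le (n := ω) (by simp)
  rw [← mdifferentiableOn_iff_differentiableOn]
  exact hf.comp_mdifferentiableOn (mdifferentiableOn_atlas_symm (chart_mem_atlas ℂ x))

theorem MDifferentiable.analyticAt_chart {f : S → ℂ} (hf : MDifferentiable 𝓘(ℂ) 𝓘(ℂ) f)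
    (x : S) : AnalyticAt ℂ (f ∘ (chartAt ℂ x).symm) (chartAt ℂ x x) :=
  (hf.differentiableOn_chart x).analyticAt
    ((chartAt ℂ x).open_target.mem_nhds ((chartAt ℂ x).map_source (mem_chart_source ℂ x)))

/-- A holomorphic function that is not locally constant is open. -/
theorem nhds_le_map_of_holomorphic {f : S → ℂ} (hf : MDifferentiable 𝓘(ℂ) 𝓘(ℂ) f) {x : S}
    (hne : ∀ᶠ y in 𝓝[≠] x, f y ≠ f x) : 𝓝 (f x) ≤ map f (𝓝 x) := by
  have hx := mem_chart_source ℂ x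
  have hfx : (f ∘ (chartAt ℂ x).symm) (chartAt ℂ x x) = f x := by
    rw [Function.comp_apply, (chartAt ℂ x).left_inv hx]
  rcases (MDifferentiable.analyticAt_chart hf x).eventually_constant_or_nhds_le_map_nhds with h | h
  · exfalso
    have h1 := (tendsto_chartAt_symm_nhdsNE x).eventually hne
    obtain ⟨w, hw1, hw2⟩ := (h1.and (mem_nhdsWithin_of_mem_nhds h)).exists
    exact hw1 (hw2.trans hfx)
  · rw [hfx, ← Filter.map_map] at h
    exact h.trans (map_mono (tendsto_chartAt_symm_nhds x))

/-- A holomorphic function with a continuous right inverse has no critical points. -/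
theorem deriv_ne_zero_of_rightInverse {g k : ℂ → ℂ} {a : ℂ} (hg : AnalyticAt ℂ g a)
    (hk : ∀ᶠ w in 𝓝 (g a), ContinuousAt k w) (hgk : ∀ᶠ w in 𝓝 (g a), g (k w) = w)
    (hka : k (g a) = a) : deriv g a ≠ 0 := by
  have hka' : Tendsto k (𝓝 (g a)) (𝓝 a) := by
    have := hk.self_of_nhds.tendsto; rwa [hka] at this
  -- If the derivative vanished identically, g would be constant near a and could have no local
  -- right inverse.
  have hev : ∀ᶠ z in 𝓝[≠] a, deriv g z ≠ 0 := by
    refine (hg.deriv.eventually_eq_zero_or_eventually_ne_zero).resolve_left fun h0 => ?_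
    obtain ⟨r, hr, hball⟩ := Metric.eventually_nhds_iff_ball.1 (h0.and hg.eventually_analyticAt)
    have hconst : ∀ z ∈ Metric.ball a r, g z = g a := fun z hz =>
      (Metric.isOpen_ball.is_const_of_deriv_eq_zero (convex_ball a r).isPreconnected
        (fun w hw => (hball w hw).2.differentiableAt.differentiableWithinAt)
        (fun w hw => (hball w hw).1) hz (Metric.mem_ball_self hr))
    have h1 : ∀ᶠ w in 𝓝 (g a), w = g a := by
      filter_upwards [hgk, hka'.eventually (Metric.ball_mem_nhds a hr)] with w hw1 hw2
      rw [← hw1, hconst _ hw2]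
    have h2 : ∀ᶠ w in 𝓝[≠] (g a), w = g a := mem_nhdsWithin_of_mem_nhds h1
    obtain ⟨w, hw1, hw2⟩ := (h2.and self_mem_nhdsWithin).exists
    exact hw2 hw1
  -- Away from g a the derivative of g at k w does not vanish, so k is holomorphic there; being
  -- continuous at g a, it is holomorphic there as well. The chain rule for g ∘ k then concludes.
  have hkan : AnalyticAt ℂ k (g a) := by
    refine Complex.analyticAt_of_differentiable_on_punctured_nhds_of_continuousAt ?_
      hk.self_of_nhds
    have h2 : Tendsto k (𝓝[≠] (g a)) (𝓝[≠] a) := by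
      refine tendsto_nhdsWithin_iff.2 ⟨hka'.mono_left nhdsWithin_le_nhds, ?_⟩
      filter_upwards [mem_nhdsWithin_of_mem_nhds hgk, self_mem_nhdsWithin] with w hw hne heq
      have heq : k w = a := heq
      have hw : g (k w) = w := hw
      exact hne (by rw [mem_singleton_iff, ← hw, heq])
    filter_upwards [h2.eventually hev, mem_nhdsWithin_of_mem_nhds hk.eventually_nhds,
      mem_nhdsWithin_of_mem_nhds hgk.eventually_nhds,
      h2.eventually (mem_nhdsWithin_of_mem_nhds hg.eventually_analyticAt)] with w h3 h4 h5 h6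
    exact (HasDerivAt.of_local_left_inverse (Eventually.self_of_nhds h4)
      h6.differentiableAt.hasDerivAt h3 h5).differentiableAt
  have hd1 := hkan.differentiableAt.hasDerivAt
  have hd2 : HasDerivAt g (deriv g a) (k (g a)) := by
    rw [hka]; exact hg.differentiableAt.hasDerivAt
  have h3 := (hd2.comp (g a) hd1).congr_of_eventuallyEq (f₁ := id)
    (hgk.mono fun w hw => hw.symm)
  have h4 := h3.unique (hasDerivAt_id _)
  intro h0
  rw [h0, zero_mul] at h4
  exact zero_ne_one h4

end Surface

/-! ### Uniqueness of the normalization of a curve parametrized by `ℂ_*` -/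

/-- `n` parametrizes its image `n '' ℂ_*` as a normalization, and moreover has no critical
points. -/
structure IsNormalizingMap {Y ι : Type*} [TopologicalSpace Y] (c : ι → Y → ℂ) (n : ℂ → Y) :
    Prop where
  inducing : IsInducing (fun y i => c i y)
  holomorphic : ∀ i, DifferentiableOn ℂ (fun l => c i (n l)) {0}ᶜ
  immersion : ∀ l ≠ 0, ∃ i, deriv (fun l => c i (n l)) l ≠ 0
  proper : ∀ K ⊆ n '' {0}ᶜ, IsCompact K → IsCompact ({0}ᶜ ∩ n ⁻¹' K)
  injective : ∀ l ≠ 0, ∀ᶠ l' in 𝓝[≠] l, ∀ l'' ≠ 0, n l'' = n l' → l'' = l'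

section Lift

variable {Y ι : Type*} [TopologicalSpace Y] [T2Space Y] {c : ι → Y → ℂ} {n : ℂ → Y}
  {S : Type*} [TopologicalSpace S] [ChartedSpace ℂ S] {ν : S → Y}

omit [T2Space Y] in
theorem IsNormalizingMap.continuousOn (hn : IsNormalizingMap c n) : ContinuousOn n {0}ᶜ :=
  hn.inducing.continuousOn_iff.2 (continuousOn_pi.2 fun i => (hn.holomorphic i).continuousOn)

omit [T2Space Y] in
theorem IsNormalization.continuous (hn : IsNormalizingMap c n)
    {X : Set Y} (hν : IsNormalization c X ν) : Continuous ν :=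
  hn.inducing.continuous_iff.2 (continuous_pi fun i => (hν.holomorphic i).continuous)

omit [T2Space Y] in
theorem IsNormalization.eventually_notMem {X A : Set Y} (_hν : IsNormalization c X ν)
    (h1 : IsClosed (ν ⁻¹' A)) (h2 : IsDiscrete (ν ⁻¹' A)) (x : S) :
    ∀ᶠ y in 𝓝[≠] x, ν y ∉ A := by
  by_cases hx : x ∈ ν ⁻¹' A
  · have := (isDiscrete_iff_nhdsWithin.1 h2) x hx
    have h3 : ({x} : Set S) ∈ 𝓝[ν ⁻¹' A] x := by rw [this]; exact mem_pure.2 rfl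
    filter_upwards [mem_nhdsWithin_of_mem_nhds (mem_nhdsWithin_iff_eventually.1 h3),
      self_mem_nhdsWithin] with y hy hne hyA
    exact hne (hy hyA)
  · exact mem_nhdsWithin_of_mem_nhds (h1.isOpen_compl.mem_nhds hx)

omit [T2Space Y] in
/-- The fibres of a normalization are discrete. -/
theorem IsNormalization.eventually_ne {X : Set Y} (hν : IsNormalization c X ν) (x : S) :
    ∀ᶠ y in 𝓝[≠] x, ν y ≠ ν x := by
  obtain ⟨A, -, h1, h2, h3, -⟩ := hν.generic
  by_cases hx : ν x ∈ A
  · filter_upwards [hν.eventually_notMem h1 h2 x] with y hy heq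
    exact hy (by rw [heq]; exact hx)
  · filter_upwards [mem_nhdsWithin_of_mem_nhds (h1.isOpen_compl.mem_nhds hx),
      self_mem_nhdsWithin] with y hy hne heq
    exact hne (h3 hy hx heq)

variable (hn : IsNormalizingMap c n) (hν : IsNormalization c (n '' {0}ᶜ) ν)

include hn hν

omit [T2Space Y] in
theorem IsNormalization.exists_compact_nhds (x : S) : ∃ K, IsCompact K ∧ K ⊆ n '' {0}ᶜ ∧
    ∀ᶠ y in 𝓝 x, ν y ∈ K := by
  have : LocallyCompactSpace S := ChartedSpace.locallyCompactSpace ℂ S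
  obtain ⟨W, hW, hxW⟩ := exists_compact_mem_nhds x
  refine ⟨ν '' W, hW.image (hν.continuous hn), ?_, mem_of_superset hxW (subset_preimage_image _ _)⟩
  rw [← hν.range_eq]
  exact image_subset_range _ _

/-- Near any point, there is only one preimage under `n`. -/
theorem IsNormalization.eventually_unique (x : S) :
    ∀ᶠ y in 𝓝[≠] x, ∀ l ≠ 0, ∀ l' ≠ 0, n l = ν y → n l' = ν y → l = l' := by
  obtain ⟨K, hK, hKX, hxK⟩ := hν.exists_compact_nhds hn x
  have hC := hn.proper K hKX hK
  set C : Set ℂ := {0}ᶜ ∩ n ⁻¹' K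
  -- The parameters in C that share their image with another one. They are isolated and C is
  -- compact, so there are finitely many.
  set B : Set ℂ := {l ∈ C | ∃ l'' ≠ 0, n l'' = n l ∧ l'' ≠ l}
  have hB : B.Finite := by
    have hloc : ∀ l ∈ C, ∃ U ∈ 𝓝 l, (B ∩ U).Finite := fun l hl => by
      obtain ⟨U, hU, hU2⟩ := mem_nhdsWithin_iff_exists_mem_nhds_inter.1 (hn.injective l hl.1)
      refine ⟨U, hU, (finite_singleton l).subset ?_⟩
      rintro l' ⟨⟨_, l'', hl'', heq, hne⟩, hl'U⟩
      by_contra hne'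
      exact hne (hU2 ⟨hl'U, hne'⟩ l'' hl'' heq)
    choose! U hU hfin using hloc
    obtain ⟨t, htC, ht⟩ := hC.elim_nhds_subcover U hU
    refine (t.finite_toSet.biUnion fun l hl => hfin l (htC l hl)).subset fun l hl => ?_
    obtain ⟨a, ha, hla⟩ := mem_iUnion₂.1 (ht hl.1)
    exact mem_biUnion ha ⟨hl, hla⟩
  have hne : ∀ᶠ y in 𝓝[≠] x, ∀ l ∈ B, ν y ≠ n l := by
    rw [eventually_all_finite hB]
    intro l _
    by_cases hlx : n l = ν x
    · rw [hlx]; exact hν.eventually_ne x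
    · exact mem_nhdsWithin_of_mem_nhds
        ((hν.continuous hn).continuousAt.eventually_ne (Ne.symm hlx))
  filter_upwards [hne, mem_nhdsWithin_of_mem_nhds hxK] with y hy hyK l hl l' hl' h1 h2
  by_contra hll
  have hyK : ν y ∈ K := hyK
  refine hy l ⟨⟨hl, ?_⟩, l', hl', h2.trans h1.symm, Ne.symm hll⟩ h1.symm
  rw [mem_preimage, h1]; exact hyK

variable [IsManifold 𝓘(ℂ) ω S]

/-- A normalization factors through `n`. -/
theorem IsNormalization.exists_lift : ∃ ψ : S → ℂ, MDifferentiable 𝓘(ℂ) 𝓘(ℂ) ψ ∧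
    ∀ x, ψ x ≠ 0 ∧ n (ψ x) = ν x := by
  -- An arbitrary choice of parameters is continuous, hence holomorphic, off isolated points. Its
  -- limits at these points then define the holomorphic lift.
  have hex : ∀ x, ∃ l, l ≠ 0 ∧ n l = ν x := fun x => by
    have : ν x ∈ n '' {0}ᶜ := hν.range_eq ▸ mem_range_self x
    obtain ⟨l, hl, h⟩ := this
    exact ⟨l, hl, h⟩
  choose ψ₀ hψ₀ hnψ₀ using hex
  have hνc := hν.continuous hn
  have huniq := hν.eventually_unique hn
  -- continuity at points with a single preimage
  have hcont : ∀ x, (∀ l ≠ 0, ∀ l' ≠ 0, n l = ν x → n l' = ν x → l = l') →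
      ContinuousAt ψ₀ x := by
    intro x hx
    obtain ⟨K, hK, hKX, hxK⟩ := hν.exists_compact_nhds hn x
    have hC := hn.proper K hKX hK
    set C : Set ℂ := {0}ᶜ ∩ n ⁻¹' K
    refine tendsto_nhds.2 fun U hU hxU => ?_
    -- The image of the parameters outside U is closed and misses ν x, so nearby points of S have
    -- all their parameters in U.
    have hCU : IsCompact (n '' (C \ U)) :=
      (hC.diff hU).image_of_continuousOn (hn.continuousOn.mono fun l hl => hl.1.1)
    have hxn : ν x ∉ n '' (C \ U) := by
      rintro ⟨l, hl, hlx⟩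
      exact hl.2 (hx _ (hψ₀ x) _ hl.1.1 (hnψ₀ x) hlx ▸ hxU)
    filter_upwards [hxK, hνc.continuousAt.eventually (hCU.isClosed.isOpen_compl.mem_nhds hxn)]
      with y hyK hy
    by_contra hyU
    exact hy ⟨ψ₀ y, ⟨⟨hψ₀ y, by rw [mem_preimage, hnψ₀]; exact hyK⟩, hyU⟩, hnψ₀ y⟩
  -- differentiability in charts
  have hdiff : ∀ x, ∀ w ∈ (chartAt ℂ x).target, ContinuousAt ψ₀ ((chartAt ℂ x).symm w) →
      DifferentiableAt ℂ (ψ₀ ∘ (chartAt ℂ x).symm) w := by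
    intro x w hw hc
    set φ := chartAt ℂ x
    have hcw : ContinuousAt (ψ₀ ∘ φ.symm) w :=
      ContinuousAt.comp hc (φ.continuousAt_symm hw)
    -- One coordinate function c i ∘ n is locally invertible, and ψ₀ is its local inverse applied to
    -- the holomorphic function c i ∘ ν.
    obtain ⟨i, hi⟩ := hn.immersion _ (hψ₀ (φ.symm w))
    set F : ℂ → ℂ := fun l => c i (n l)
    have hF : HasStrictDerivAt F (deriv F (ψ₀ (φ.symm w))) (ψ₀ (φ.symm w)) :=
      ((hn.holomorphic i).analyticAt (isOpen_compl_singleton.mem_nhds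
        (hψ₀ (φ.symm w)))).hasStrictDerivAt
    have hG : DifferentiableAt ℂ ((fun x => c i (ν x)) ∘ φ.symm) w :=
      (MDifferentiable.differentiableOn_chart (hν.holomorphic i) x).differentiableAt
        (φ.open_target.mem_nhds hw)
    have hFG : ∀ v, F (ψ₀ (φ.symm v)) = c i (ν (φ.symm v)) := fun v => by
      simp only [F, hnψ₀]
    have hleft := hcw.eventually ((hF.hasStrictFDerivAt_equiv hi).eventually_left_inverse)
    have hinv := (hF.to_localInverse hi).hasDerivAt.differentiableAt
    have hGw : ((fun x => c i (ν x)) ∘ φ.symm) w = F (ψ₀ (φ.symm w)) := (hFG w).symm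
    rw [← hGw] at hinv
    refine (hinv.comp w hG).congr_of_eventuallyEq ?_
    filter_upwards [hleft] with v hv
    have hv' : hF.localInverse F (deriv F (ψ₀ (φ.symm w))) (ψ₀ (φ.symm w)) hi
      (F ((ψ₀ ∘ φ.symm) v)) = (ψ₀ ∘ φ.symm) v := hv
    rw [← hv']
    simp only [Function.comp_apply, hFG]
  have hpun : ∀ x, ∀ᶠ w in 𝓝[≠] (chartAt ℂ x x),
      DifferentiableAt ℂ (ψ₀ ∘ (chartAt ℂ x).symm) w := by
    intro x
    have hx := mem_chart_source ℂ x
    filter_upwards [(tendsto_chartAt_symm_nhdsNE x).eventually (huniq x),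
      mem_nhdsWithin_of_mem_nhds ((chartAt ℂ x).open_target.mem_nhds
        ((chartAt ℂ x).map_source hx))] with w h1 h2
    exact hdiff x w h2 (hcont _ h1)
  -- By properness the chosen parameters stay in a compact subset of ℂ_*. This makes the
  -- singularities removable and keeps the limits away from 0.
  have hbd : ∀ x, ∃ C : Set ℂ, IsCompact C ∧ C ⊆ {0}ᶜ ∧ ∀ᶠ y in 𝓝 x, ψ₀ y ∈ C := by
    intro x
    obtain ⟨K, hK, hKX, hxK⟩ := hν.exists_compact_nhds hn x
    refine ⟨_, hn.proper K hKX hK, inter_subset_left, ?_⟩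
    filter_upwards [hxK] with y hy
    exact ⟨hψ₀ y, by rw [mem_preimage, hnψ₀]; exact hy⟩
  have hlim : ∀ x, ∃ l, Tendsto ψ₀ (𝓝[≠] x) (𝓝 l) := by
    intro x
    obtain ⟨C, hC, -, hxC⟩ := hbd x
    obtain ⟨M, hM⟩ := hC.isBounded.exists_norm_le
    have h1 := Complex.tendsto_limUnder_of_differentiable_on_punctured_nhds_of_bounded_under
      (hpun x) ⟨M + ‖(ψ₀ ∘ (chartAt ℂ x).symm) (chartAt ℂ x x)‖, eventually_map.2 ?_⟩
    · have h2 := h1.comp (tendsto_chartAt_nhdsNE x)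
      refine ⟨_, h2.congr' ?_⟩
      exact mem_nhdsWithin_of_mem_nhds (eventually_comp_chartAt_symm x)
    · filter_upwards [(tendsto_chartAt_symm_nhdsNE x).eventually
        (mem_nhdsWithin_of_mem_nhds hxC)] with w hw
      exact norm_sub_le_of_le (hM _ hw) le_rfl
  choose ψ hψ using hlim
  have hψeq : ∀ x, ∀ᶠ y in 𝓝[≠] x, ψ y = ψ₀ y := by
    intro x
    filter_upwards [huniq x] with y hy
    have := nhdsNE_neBot_surface y
    exact tendsto_nhds_unique (hψ y) ((hcont y hy).tendsto.mono_left nhdsWithin_le_nhds)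
  refine ⟨ψ, fun x => ?_, fun x => ?_⟩
  · rw [mdifferentiableAt_iff_chart]
    have hx := mem_chart_source ℂ x
    refine (Complex.analyticAt_of_differentiable_on_punctured_nhds_of_continuousAt ?_
      ?_).differentiableAt
    · have h1 := (tendsto_chartAt_symm_nhdsNE x).eventually (hψeq x)
      filter_upwards [hpun x, eventually_nhdsNE_eventually_nhds_iff.2 h1] with w h2 h3
      exact h2.congr_of_eventuallyEq h3
    · rw [continuousAt_iff_punctured_nhds]
      have h1 : (ψ ∘ (chartAt ℂ x).symm) (chartAt ℂ x x) = ψ x := by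
        rw [Function.comp_apply, (chartAt ℂ x).left_inv hx]
      rw [h1]
      exact ((hψ x).congr' ((hψeq x).mono fun _ h => h.symm)).comp (tendsto_chartAt_symm_nhdsNE x)
  · obtain ⟨C, hC, hC0, hxC⟩ := hbd x
    have := nhdsNE_neBot_surface x
    have h1 : ψ x ∈ C := hC.isClosed.mem_of_tendsto (hψ x) (mem_nhdsWithin_of_mem_nhds hxC)
    refine ⟨hC0 h1, ?_⟩
    have h2 : Tendsto (fun y => n (ψ₀ y)) (𝓝[≠] x) (𝓝 (n (ψ x))) :=
      ((hn.continuousOn.continuousAt (isOpen_compl_singleton.mem_nhds (hC0 h1))).tendsto).comp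
          (hψ x)
    simp only [hnψ₀] at h2
    exact tendsto_nhds_unique h2 (hνc.continuousAt.tendsto.mono_left nhdsWithin_le_nhds)

end Lift

end HSTorus

end

noncomputable section

namespace HSTorus

/-! ### Riemann surfaces that are open pieces of the plane -/

section Surface

variable {S : Type*} [TopologicalSpace S] [ChartedSpace ℂ S]

theorem mfderiv_eq_chart {f : S → ℂ} {x : S} (hf : MDifferentiableAt 𝓘(ℂ) 𝓘(ℂ) f x) :
    mfderiv 𝓘(ℂ) 𝓘(ℂ) f x = fderiv ℂ (f ∘ (chartAt ℂ x).symm) (chartAt ℂ x x) := by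
  have h2 : (writtenInExtChartAt 𝓘(ℂ) 𝓘(ℂ) x f) = f ∘ (chartAt ℂ x).symm := by
    ext; simp [writtenInExtChartAt, chartAt_self_eq]
  rw [hf.mfderiv, h2]
  simp only [modelWithCornersSelf_coe, range_id, fderivWithin_univ, extChartAt,
    OpenPartialHomeomorph.extend, modelWithCornersSelf_partialEquiv, PartialEquiv.trans_refl,
    OpenPartialHomeomorph.toFun_eq_coe]
  rfl

variable [IsManifold 𝓘(ℂ) ω S]

/-- The inverse of the embedding, read in the chart, is a continuous right inverse, so
`deriv_ne_zero_of_rightInverse` applies. -/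
theorem deriv_chart_ne_zero_of_isOpenEmbedding {ψ : S → ℂ} (hψ : MDifferentiable 𝓘(ℂ) 𝓘(ℂ) ψ)
    (ho : IsOpenEmbedding ψ) (x : S) :
    deriv (ψ ∘ (chartAt ℂ x).symm) (chartAt ℂ x x) ≠ 0 := by
  have hx := mem_chart_source ℂ x
  set φ := chartAt ℂ x
  have : Nonempty S := ⟨x⟩
  set e := ho.toOpenPartialHomeomorph ψ
  have hρ : (ψ ∘ φ.symm) (φ x) = ψ x := by rw [Function.comp_apply, φ.left_inv hx]
  have hes : e.source = univ := ho.toOpenPartialHomeomorph_source ψ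
  have het : ψ x ∈ e.target := e.map_source (by rw [hes]; trivial)
  have hex : e.symm (ψ x) = x := e.left_inv (by rw [hes]; trivial)
  have htend : Tendsto e.symm (𝓝 (ψ x)) (𝓝 x) := by
    have := (e.continuousAt_symm het).tendsto
    rwa [hex] at this
  have hsrc : ∀ᶠ w in 𝓝 (ψ x), w ∈ e.target ∧ e.symm w ∈ φ.source :=
    Eventually.and (e.open_target.mem_nhds het) (htend.eventually (φ.open_source.mem_nhds hx))
  refine deriv_ne_zero_of_rightInverse (k := φ ∘ e.symm) (MDifferentiable.analyticAt_chart hψ x)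
    ?_ ?_ ?_ <;> rw [hρ]
  · filter_upwards [hsrc] with w hw
    exact (φ.continuousAt hw.2).comp (e.continuousAt_symm hw.1)
  · filter_upwards [hsrc] with w hw
    rw [Function.comp_apply, Function.comp_apply, φ.left_inv hw.2]
    exact e.right_inv hw.1
  · rw [Function.comp_apply, hex]

theorem mfderiv_ne_zero_of_isOpenEmbedding {ψ : S → ℂ} (hψ : MDifferentiable 𝓘(ℂ) 𝓘(ℂ) ψ)
    (ho : IsOpenEmbedding ψ) (x : S) : mfderiv 𝓘(ℂ) 𝓘(ℂ) ψ x ≠ 0 := by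
  rw [mfderiv_eq_chart (hψ x)]
  intro h
  apply deriv_chart_ne_zero_of_isOpenEmbedding hψ ho x
  rw [← fderiv_apply_one_eq_deriv, h]
  rfl

/-- A map into an open piece `S` of `ℂ` is holomorphic if it is so in the global coordinate. -/
theorem mdifferentiable_of_comp_isOpenEmbedding {T : Type*} [TopologicalSpace T]
    [ChartedSpace ℂ T] {ψ : S → ℂ} (hψ : MDifferentiable 𝓘(ℂ) 𝓘(ℂ) ψ)
    (ho : IsOpenEmbedding ψ) {g : T → S} (hg : MDifferentiable 𝓘(ℂ) 𝓘(ℂ) (ψ ∘ g)) :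
    MDifferentiable 𝓘(ℂ) 𝓘(ℂ) g := by
  intro t
  have hgc : Continuous g := ho.isInducing.continuous_iff.2 hg.continuous
  rw [mdifferentiableAt_iff_target]
  refine ⟨hgc.continuousAt, ?_⟩
  have hx := mem_chart_source ℂ (g t)
  have h0 := deriv_chart_ne_zero_of_isOpenEmbedding hψ ho (g t)
  have hρ := (MDifferentiable.analyticAt_chart hψ (g t)).hasStrictDerivAt
  set φ := chartAt ℂ (g t)
  set ρ := ψ ∘ φ.symm
  have hρφ : ρ (φ (g t)) = ψ (g t) := congrArg ψ (φ.left_inv hx)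
  have hinv := (hρ.to_localInverse h0).hasDerivAt.differentiableAt
  rw [hρφ] at hinv
  have h1 : MDifferentiableAt 𝓘(ℂ) 𝓘(ℂ)
      (hρ.localInverse ρ (deriv ρ (φ (g t))) (φ (g t)) h0 ∘ (ψ ∘ g)) t :=
    MDifferentiableAt.comp t hinv.mdifferentiableAt (hg t)
  refine h1.congr_of_eventuallyEq ?_
  have hφg : ContinuousAt (φ ∘ g) t := (φ.continuousAt hx).comp hgc.continuousAt
  filter_upwards [hφg.eventually ((hρ.hasStrictFDerivAt_equiv h0).eventually_left_inverse),
    hgc.continuousAt.eventually (φ.open_source.mem_nhds hx)] with s hs hs2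
  have hs' : hρ.localInverse ρ (deriv ρ (φ (g t))) (φ (g t)) h0 (ρ ((φ ∘ g) s)) = (φ ∘ g) s := hs
  have h2 : ρ ((φ ∘ g) s) = (ψ ∘ g) s := by
    simp only [ρ, Function.comp_apply, φ.left_inv hs2]
  refine Eq.trans ?_ (hs'.symm.trans (congrArg _ h2))
  simp [extChartAt, φ]

theorem mdifferentiable_onePoint_coe :
    MDifferentiable 𝓘(ℂ) 𝓘(ℂ) (fun w : ℂ => (w : OnePoint ℂ)) := by
  have : IsManifold 𝓘(ℂ) 1 (OnePoint ℂ) := IsManifold.of_le (n := ω) (by simp)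
  have h : chartZero ∈ atlas ℂ (OnePoint ℂ) := Or.inl rfl
  have := mdifferentiableOn_atlas_symm (I := 𝓘(ℂ)) h
  rw [show chartZero.target = univ by simp [chartZero]] at this
  exact mdifferentiableOn_univ.1 this

theorem isHolomorphicOpenEmbedding_coe_comp {ψ : S → ℂ} (hψ : MDifferentiable 𝓘(ℂ) 𝓘(ℂ) ψ)
    (ho : IsOpenEmbedding ψ) :
    IsHolomorphicOpenEmbedding (fun x => (ψ x : OnePoint ℂ)) where
  isOpenEmbedding := OnePoint.isOpenEmbedding_coe.comp ho
  holomorphic := mdifferentiable_onePoint_coe.comp hψ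
  mfderiv_ne_zero x h := by
    have : IsManifold 𝓘(ℂ) 1 (OnePoint ℂ) := IsManifold.of_le (n := ω) (by simp)
    have h1 : MDifferentiableAt 𝓘(ℂ) 𝓘(ℂ) chartZero ((ψ x : ℂ) : OnePoint ℂ) :=
      mdifferentiableAt_atlas (Or.inl rfl) (by rw [chartZero_source]; exact ⟨_, rfl⟩)
    have h2 := mfderiv_comp x h1 ((mdifferentiable_onePoint_coe.comp hψ) x)
    have h3 : (chartZero ∘ ((fun w : ℂ => (w : OnePoint ℂ)) ∘ ψ)) = ψ :=
      funext fun y => chartZero_coe _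
    rw [h3] at h2
    refine mfderiv_ne_zero_of_isOpenEmbedding hψ ho x (h2.trans ?_)
    have h4 : mfderiv 𝓘(ℂ) 𝓘(ℂ) ((fun w : ℂ => (w : OnePoint ℂ)) ∘ ψ) x = 0 := h
    rw [h4]
    exact ContinuousLinearMap.comp_zero _

end Surface

/-! ### Every normalization is a copy of the punctured plane -/

section Lift

variable {Y ι : Type*} [TopologicalSpace Y] [T2Space Y] {c : ι → Y → ℂ} {n : ℂ → Y}
  {S : Type*} [TopologicalSpace S] [ChartedSpace ℂ S] {ν : S → Y}
  (hn : IsNormalizingMap c n) (hν : IsNormalization c (n '' {0}ᶜ) ν)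
  [T2Space S] [IsManifold 𝓘(ℂ) ω S]

include hn hν

/-- Any normalization of `n '' ℂ_*` is `ℂ_*`. -/
theorem IsNormalization.exists_coordinate : ∃ ψ : S → ℂ, MDifferentiable 𝓘(ℂ) 𝓘(ℂ) ψ ∧
    IsOpenEmbedding ψ ∧ range ψ = {0}ᶜ ∧ ∀ x, n (ψ x) = ν x := by
  obtain ⟨ψ, hψ, hψn⟩ := hν.exists_lift hn
  have hne : ∀ x, ∀ᶠ y in 𝓝[≠] x, ψ y ≠ ψ x := fun x => by
    filter_upwards [hν.eventually_ne x] with y hy heq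
    exact hy (by rw [← (hψn y).2, heq, (hψn x).2])
  have hopen : ∀ x, 𝓝 (ψ x) ≤ map ψ (𝓝 x) := fun x => nhds_le_map_of_holomorphic hψ (hne x)
  obtain ⟨A, -, h1, h2, h3, -⟩ := hν.generic
  refine ⟨ψ, hψ, .of_continuous_injective_isOpenMap hψ.continuous ?_ (.of_nhds_le hopen), ?_,
    fun x => (hψn x).2⟩
  · intro x y hxy
    by_contra hne'
    obtain ⟨U, V, hU, hV, hxU, hyV, hUV⟩ := t2_separation hne'
    -- By openness, every value close to ψ x is attained near x off the exceptional set. If x and y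
    -- had the same image, disjoint neighbourhoods would contain different nonexceptional points
    -- with the same ν.
    have key : ∀ x, ∀ U ∈ 𝓝 x, ∀ᶠ l in 𝓝[≠] (ψ x), ∃ x' ∈ U, ψ x' = l ∧ ν x' ∉ A := by
      intro x U hU
      obtain ⟨W, hW, hWA⟩ := mem_nhdsWithin_iff_exists_mem_nhds_inter.1
        (hν.eventually_notMem h1 h2 x)
      have h4 := hopen x (image_mem_map (inter_mem hU hW))
      filter_upwards [mem_nhdsWithin_of_mem_nhds h4, self_mem_nhdsWithin] with l hl hlx
      obtain ⟨x', hx', rfl⟩ := hl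
      exact ⟨x', hx'.1, rfl, hWA ⟨hx'.2, fun h => hlx (congrArg ψ h)⟩⟩
    have hy := key y V (hV.mem_nhds hyV)
    rw [← hxy] at hy
    obtain ⟨l, ⟨x', hx', hxl, hxA⟩, y', hy', hyl, hyA⟩ :=
      ((key x U (hU.mem_nhds hxU)).and hy).exists
    have : x' = y' := h3 hxA hyA (by rw [← (hψn x').2, ← (hψn y').2, hxl, hyl])
    exact disjoint_left.1 hUV hx' (this ▸ hy')
  · refine Subset.antisymm (range_subset_iff.2 fun x => (hψn x).1) fun l hl => ?_
    -- All parameters near l, except possibly l, are the only ones over their image and are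
    -- therefore attained. Properness makes the attained set over a compact neighbourhood closed, so
    -- it contains l.
    have hlK : ({0}ᶜ : Set ℂ) ∈ 𝓝 l := isOpen_compl_singleton.mem_nhds hl
    obtain ⟨B, hB, hB0, hBc⟩ := local_compact_nhds hlK
    have hK : IsCompact (n '' B) := hBc.image_of_continuousOn (hn.continuousOn.mono hB0)
    have hK2 := (hν.proper _ (image_mono hB0) hK).image hψ.continuous
    have hev : ∀ᶠ l' in 𝓝[≠] l, l' ∈ ψ '' (ν ⁻¹' (n '' B)) := by
      filter_upwards [hn.injective l hl, mem_nhdsWithin_of_mem_nhds hB] with l' h4 h5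
      have : n l' ∈ range ν := by rw [hν.range_eq]; exact mem_image_of_mem _ (hB0 h5)
      obtain ⟨x, hx⟩ := this
      refine ⟨x, ⟨l', h5, hx.symm⟩, h4 _ (hψn x).1 ((hψn x).2.trans hx)⟩
    obtain ⟨x, -, hx⟩ := hK2.isClosed.mem_of_frequently_of_tendsto hev.frequently
      (tendsto_id.mono_left nhdsWithin_le_nhds)
    exact ⟨x, hx⟩

end Lift

/-! ### The punctured plane as a normalization -/

section Existence

variable {Y ι : Type*} [TopologicalSpace Y] [T2Space Y] {c : ι → Y → ℂ} {n : ℂ → Y}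

/-- The punctured plane. -/
abbrev puncturedPlane : TopologicalSpace.Opens ℂ := ⟨{0}ᶜ, isOpen_compl_singleton⟩

omit [T2Space Y] in
theorem IsNormalizingMap.isNormalization (hn : IsNormalizingMap c n) :
    IsNormalization c (n '' {0}ᶜ) (fun x : puncturedPlane => n x) := by
  have hval : MDifferentiable 𝓘(ℂ) 𝓘(ℂ) (Subtype.val : puncturedPlane → ℂ) := fun x =>
    (contMDiff_subtype_val (n := 1)).mdifferentiable one_ne_zero x
  have hmd : ∀ i, MDifferentiable 𝓘(ℂ) 𝓘(ℂ) (fun x : puncturedPlane => c i (n x)) := fun i x =>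
    MDifferentiableAt.comp (g := fun l => c i (n l)) x
      ((hn.holomorphic i).differentiableAt
        (isOpen_compl_singleton.mem_nhds x.2)).mdifferentiableAt (hval x)
  refine ⟨hmd, ?_, ?_, ?_⟩
  · ext y; simp
  · intro K hK hKc
    rw [Topology.IsInducing.subtypeVal.isCompact_iff]
    convert hn.proper K hK hKc using 1
    ext l
    constructor
    · rintro ⟨x, hx, rfl⟩
      exact ⟨x.2, hx⟩
    · exact fun hl => ⟨⟨l, hl.1⟩, hl.2, rfl⟩
  · set A : Set Y := {y | ∃ l ≠ 0, ∃ l' ≠ 0, l ≠ l' ∧ n l = y ∧ n l' = y}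
    have hA : ∀ x : puncturedPlane, n x ∈ A ↔ ∃ l' : ℂ, l' ≠ 0 ∧ l' ≠ x ∧ n l' = n x := by
      intro x
      constructor
      · rintro ⟨l, hl, l', hl', hne, h1, h2⟩
        by_cases h : l = x
        · exact ⟨l', hl', h ▸ hne.symm, h2⟩
        · exact ⟨l, hl, h, h1⟩
      · rintro ⟨l', hl', hne, h⟩
        exact ⟨l', hl', x, x.2, hne, h, rfl⟩
    have hcd : IsClosed ((fun x : puncturedPlane => n x) ⁻¹' A) ∧
        IsDiscrete ((fun x : puncturedPlane => n x) ⁻¹' A) := by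
      rw [isClosed_and_discrete_iff]
      intro x
      rw [disjoint_principal_right]
      have h1 : Tendsto (Subtype.val : puncturedPlane → ℂ) (𝓝[≠] x) (𝓝[≠] (x : ℂ)) := by
        refine tendsto_nhdsWithin_iff.2 ⟨continuousAt_subtype_val.mono_left nhdsWithin_le_nhds, ?_⟩
        filter_upwards [self_mem_nhdsWithin] with y hy h
        exact hy (Subtype.ext h)
      filter_upwards [h1.eventually (hn.injective x x.2)] with y hy hyA
      obtain ⟨l', hl', hne, h⟩ := (hA y).1 hyA
      exact hne (hy l' hl' h)
    refine ⟨A, ?_, hcd.1, hcd.2, ?_, ?_⟩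
    · rintro y ⟨l, hl, -, -, -, h, -⟩
      exact ⟨l, hl, h⟩
    · intro x hx y hy hxy
      by_contra hne
      exact hx ((hA x).2 ⟨y, y.2, fun h => hne (Subtype.ext h.symm), hxy.symm⟩)
    · intro x _
      obtain ⟨i, hi⟩ := hn.immersion x x.2
      refine ⟨i, fun h => ?_⟩
      have h1 := deriv_chart_ne_zero_of_isOpenEmbedding hval
        (isOpen_compl_singleton.isOpenEmbedding_subtypeVal) x
      have h2 := (MDifferentiable.analyticAt_chart hval x).differentiableAt.hasDerivAt
      set φ := chartAt ℂ x
      have hx : (Subtype.val ∘ φ.symm) (φ x) = (x : ℂ) :=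
        congrArg Subtype.val (φ.left_inv (mem_chart_source ℂ x))
      have hd := ((hn.holomorphic i).differentiableAt
        (isOpen_compl_singleton.mem_nhds x.2)).hasDerivAt
      rw [← hx] at hd hi
      have h3 := (hd.comp _ h2).deriv
      rw [mfderiv_eq_chart (hmd i x)] at h
      refine mul_ne_zero hi h1 (h3.symm.trans ?_)
      rw [← fderiv_apply_one_eq_deriv]
      exact congrArg (fun L : ℂ →L[ℂ] ℂ => L 1) h

end Existence

/-! ### The spectral curves -/

instance (Γ : Submodule ℤ ℂ) : T2Space (AddChar Γ ℂ) :=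
  .of_injective_continuous (f := fun h : AddChar Γ ℂ => (h : Γ → ℂ)) DFunLike.coe_injective
    continuous_induced_dom

section Model

variable {Γ : Submodule ℤ ℂ} {κ e₀ : ℂ}

theorem isInducing_multiplierCoord : IsInducing (fun h γ => multiplierCoord Γ γ h) := ⟨rfl⟩

theorem isInducing_eigCoord : IsInducing (fun p i => eigCoord Γ i p) := by
  have h1 : Continuous (fun p : ℂ × AddChar Γ ℂ => fun i => eigCoord Γ i p) := by
    refine continuous_pi fun i => ?_
    cases i with
    | none => exact continuous_fst
    | some γ =>
      exact ((continuous_apply γ).comp isInducing_multiplierCoord.continuous).comp continuous_snd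
  have h2 : Continuous (fun u : Option Γ → ℂ => (u none, fun γ : Γ => u (some γ))) := by
    fun_prop
  exact .of_comp h1 h2 (IsInducing.id.prodMap (isInducing_multiplierCoord (Γ := Γ)))

theorem hasDerivAt_modeMultiplier {l : ℂ} (hl : l ≠ 0) (γ : Γ) :
    HasDerivAt (fun l => modeMultiplier Γ κ l γ)
      (modeMultiplier Γ κ l γ * (Complex.I * (κ * γ - conj κ * (l ^ 2)⁻¹ * conj (γ : ℂ)))) l := by
  have h1 : HasDerivAt (fun l : ℂ => Complex.I * (κ * (l + 1) * γ + conj κ * (l⁻¹ + 1) *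
      conj (γ : ℂ))) (Complex.I * (κ * 1 * γ + conj κ * (-(l ^ 2)⁻¹) * conj (γ : ℂ))) l :=
    (((((hasDerivAt_id l).add_const 1).const_mul κ).mul_const (γ : ℂ)).add
      ((((hasDerivAt_inv hl).add_const 1).const_mul (conj κ)).mul_const _)).const_mul _
  refine (h1.cexp : HasDerivAt (fun l => modeMultiplier Γ κ l γ) _ l).congr_deriv ?_
  rw [modeMultiplier_apply, planeWave]
  ring

theorem differentiableOn_modeMultiplier (γ : Γ) :
    DifferentiableOn ℂ (fun l => modeMultiplier Γ κ l γ) {0}ᶜ := fun _ hl =>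
  (hasDerivAt_modeMultiplier hl γ).differentiableAt.differentiableWithinAt

theorem continuousOn_modeMultiplier : ContinuousOn (modeMultiplier Γ κ) {0}ᶜ :=
  isInducing_multiplierCoord.continuousOn_iff.2
    (continuousOn_pi.2 fun γ => (differentiableOn_modeMultiplier γ).continuousOn)

variable [DiscreteTopology Γ] [IsZLattice ℝ Γ]

theorem isCompact_preimage_modeMultiplier (hp : IsPhase Γ κ e₀) {K : Set (AddChar Γ ℂ)}
    (hK : IsCompact K) : IsCompact ({0}ᶜ ∩ modeMultiplier Γ κ ⁻¹' K) := by
  obtain ⟨R, hR, hRK⟩ := exists_bounds_of_isCompact hp hK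
  set C : Set ℂ := Metric.closedBall 0 R \ Metric.ball 0 R⁻¹ with hC
  have hC0 : C ⊆ {0}ᶜ := fun l hl h0 => by
    rw [mem_singleton_iff.1 h0] at hl
    exact hl.2 (Metric.mem_ball_self (inv_pos.2 hR))
  have hCc : IsCompact C := (isCompact_closedBall 0 R).diff Metric.isOpen_ball
  have h1 := (continuousOn_modeMultiplier (Γ := Γ) (κ := κ)).mono hC0
  have h2 : {0}ᶜ ∩ modeMultiplier Γ κ ⁻¹' K = C ∩ modeMultiplier Γ κ ⁻¹' K := by
    refine Subset.antisymm (fun l hl => ⟨?_, hl.2⟩) (inter_subset_inter_left _ hC0)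
    obtain ⟨h3, h4⟩ := hRK l hl.1 hl.2
    exact ⟨by simpa using h4, by simpa using h3⟩
  rw [h2]
  exact hCc.of_isClosed_subset (h1.preimage_isClosed_of_isClosed hCc.isClosed hK.isClosed)
    inter_subset_left

/-- If all coordinates had a critical point at l, then κγ = conj κ l⁻² conj γ on the lattice. Both
sides are real linear, so this would hold on all of ℂ and force κ = 0. -/
theorem isNormalizingMap_modeMultiplier (hp : IsPhase Γ κ e₀) :
    IsNormalizingMap (multiplierCoord Γ) (modeMultiplier Γ κ) where
  inducing := isInducing_multiplierCoord
  holomorphic := differentiableOn_modeMultiplier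
  immersion l hl := by
    by_contra! h
    have h1 : ∀ γ : Γ, κ * γ = conj κ * (l ^ 2)⁻¹ * conj (γ : ℂ) := fun γ => by
      have h2 := h γ
      change deriv (fun l => modeMultiplier Γ κ l γ) l = 0 at h2
      rw [(hasDerivAt_modeMultiplier hl γ).deriv, modeMultiplier_apply] at h2
      have h3 := (mul_eq_zero.1 h2).resolve_left (planeWave_ne_zero _ _ _)
      exact sub_eq_zero.1 ((mul_eq_zero.1 h3).resolve_left Complex.I_ne_zero)
    have h2 : LinearMap.mulLeft ℝ κ =
        LinearMap.mulLeft ℝ (conj κ * (l ^ 2)⁻¹) ∘ₗ Complex.conjAe.toLinearMap :=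
      IsZLattice.linearMap_ext fun γ hγ => h1 ⟨γ, hγ⟩
    refine hp.ne_zero (linear_form_eq (p := κ) (q := 0) (p' := 0)
      (q' := conj κ * (l ^ 2)⁻¹) fun v => ?_).1
    have h3 := LinearMap.congr_fun h2 v
    simpa [mul_assoc] using h3
  proper K _ hK := isCompact_preimage_modeMultiplier hp hK
  injective l hl := eventually_modeMultiplier_injective hp hl

/-- The coordinate μ = l² has no critical point in ℂ_*. Properness and generic injectivity are
inherited from the multiplier. -/
theorem isNormalizingMap_eig (hp : IsPhase Γ κ e₀) :
    IsNormalizingMap (eigCoord Γ) (fun l => (l ^ 2, modeMultiplier Γ κ l)) where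
  inducing := isInducing_eigCoord
  holomorphic i := by
    cases i with
    | none => exact (differentiable_pow 2).differentiableOn
    | some γ => exact differentiableOn_modeMultiplier γ
  immersion l hl := ⟨none, by
    change deriv (fun l : ℂ => l ^ 2) l ≠ 0
    simpa using hl⟩
  proper K _ hK := by
    have h1 := isCompact_preimage_modeMultiplier hp (hK.image continuous_snd)
    have h2 : ContinuousOn (fun l => (l ^ 2, modeMultiplier Γ κ l)) {0}ᶜ :=
      (continuous_pow 2).continuousOn.prodMk continuousOn_modeMultiplier
    have h3 := (h2.mono inter_subset_left).preimage_isClosed_of_isClosed h1.isClosed hK.isClosed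
    have h4 : {0}ᶜ ∩ (fun l => (l ^ 2, modeMultiplier Γ κ l)) ⁻¹' K ⊆
        {0}ᶜ ∩ modeMultiplier Γ κ ⁻¹' (Prod.snd '' K) := fun l hl =>
      ⟨hl.1, mem_image_of_mem Prod.snd hl.2⟩
    refine h1.of_isClosed_subset ?_ h4
    convert h3 using 1
    exact Subset.antisymm (fun l hl => ⟨h4 hl, hl.2⟩) fun l hl => ⟨hl.1.1, hl.2⟩
  injective l hl := by
    filter_upwards [eventually_modeMultiplier_injective hp hl] with l' h l'' hl'' heq
    exact h l'' hl'' (congrArg Prod.snd heq)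

end Model

/-! ### Line bundles -/

theorem compU_mul_coe (q : ℍ) (c : ℂ) : compU (q * (c : ℍ)) = compU q * c := by
  rw [compU_eq, compU_eq, coordA_mul_coe, coordB_mul_coe, add_mul]

theorem compV_mul_coe (q : ℍ) (c : ℂ) : compV (q * (c : ℍ)) = compV q * c := by
  rw [compV_eq, compV_eq, coordA_mul_coe, coordB_mul_coe, ← sub_mul, mul_assoc]

theorem ext_comp {p q : ℍ} (hU : compU p = compU q) (hV : compV p = compV q) : p = q := by
  apply ext_coord
  · rw [coordA_eq, coordA_eq, hU, hV]
  · rw [coordB_eq, coordB_eq, hU, hV]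

section Bundle

variable {S : Type*} [TopologicalSpace S] [ChartedSpace ℂ S]

/-- A holomorphic line subbundle is determined by its fibres over a dense set. -/
theorem IsHolomorphicLineSubbundle.eq_of_eventually_eq {L L' : S → Set (ℂ → ℍ)}
    (hL : IsHolomorphicLineSubbundle L) (hL' : IsHolomorphicLineSubbundle L')
    (h : ∀ x, ∀ᶠ y in 𝓝[≠] x, L y = L' y) : L = L' := by
  funext x
  obtain ⟨U, hU, hxU, s, -, hsU, hsV, hs⟩ := hL x
  obtain ⟨U', hU', hxU', s', -, hsU', hsV', hs'⟩ := hL' x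
  have := nhdsNE_neBot_surface x
  -- All the complex component functions of a section at all points z, indexed by z and the choice
  -- of component.
  let F : (S → ℂ → ℍ) → ℂ × Bool → S → ℂ := fun s a y =>
    cond a.2 (compU (s y a.1)) (compV (s y a.1))
  have hF : ∀ a, ContinuousAt (F s a) x := by
    rintro ⟨z, _ | _⟩
    · exact ((hsV z).continuousOn.continuousAt (hU.mem_nhds hxU))
    · exact ((hsU z).continuousOn.continuousAt (hU.mem_nhds hxU))
  have hF' : ∀ a, ContinuousAt (F s' a) x := by
    rintro ⟨z, _ | _⟩
    · exact ((hsV' z).continuousOn.continuousAt (hU'.mem_nhds hxU'))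
    · exact ((hsU' z).continuousOn.continuousAt (hU'.mem_nhds hxU'))
  have hext : ∀ (s s' : S → ℂ → ℍ) (c : ℂ) y, (∀ a, F s a y = F s' a y * c) →
      s y = fun z => s' y z * (c : ℍ) := fun s s' c y h => funext fun z =>
    ext_comp ((h (z, true)).trans (compU_mul_coe _ _).symm)
      ((h (z, false)).trans (compV_mul_coe _ _).symm)
  -- Proportionality of the two local frames means that these 2 × 2 minors vanish. They do so next
  -- to x, and by continuity also at x.
  have hmin : ∀ a b, F s' a x * F s b x = F s' b x * F s a x := by
    intro a b
    refine tendsto_nhds_unique_of_eventuallyEq (l := 𝓝[≠] x)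
      (((hF' a).mul (hF b)).tendsto.mono_left nhdsWithin_le_nhds)
      (((hF' b).mul (hF a)).tendsto.mono_left nhdsWithin_le_nhds) ?_
    filter_upwards [h x, mem_nhdsWithin_of_mem_nhds (hU.mem_nhds hxU),
      mem_nhdsWithin_of_mem_nhds (hU'.mem_nhds hxU')] with y hy hyU hyU'
    have h1 : s' y ∈ complexSpan (s y) := by
      rw [← (hs y hyU).2, hy, (hs' y hyU').2]
      exact mem_complexSpan_self _
    obtain ⟨c, hc⟩ := h1
    have h2 : ∀ a, F s' a y = F s a y * c := by
      rintro ⟨z, _ | _⟩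
      · exact (congrArg compV (congrFun hc z)).trans (compV_mul_coe _ _)
      · exact (congrArg compU (congrFun hc z)).trans (compU_mul_coe _ _)
    change F s' a y * F s b y = F s' b y * F s a y
    rw [h2 a, h2 b]; ring
  obtain ⟨a, ha⟩ : ∃ a, F s a x ≠ 0 := by
    by_contra! h0
    refine (hs x hxU).1 ?_
    have := hext s s 0 x fun a => by rw [h0 a, zero_mul]
    rw [this]
    ext1 z
    rw [Quaternion.coeComplex_zero, mul_zero]; rfl
  have h3 : s' x ∈ complexSpan (s x) := by
    refine ⟨F s' a x / F s a x, hext s' s _ x fun b => ?_⟩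
    have := hmin a b
    field_simp
    linear_combination -this
  rw [(hs x hxU).2, (hs' x hxU').2, complexSpan_eq_of_mem h3 (hs' x hxU').1]

theorem contMDiffAt_real_of_mdifferentiable [IsManifold 𝓘(ℂ) ω S] {ψ : S → ℂ}
    (hψ : MDifferentiable 𝓘(ℂ) 𝓘(ℂ) ψ) (x : S) : ContMDiffAt 𝓘(ℝ, ℂ) 𝓘(ℝ, ℂ) ∞ ψ x := by
  rw [contMDiffAt_iff]
  refine ⟨(hψ x).continuousAt, ?_⟩
  have h1 := (MDifferentiable.analyticAt_chart hψ x).contDiffAt (n := ∞)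
  have h2 := (h1.restrict_scalars ℝ).contDiffWithinAt (s := univ)
  simpa [chartAt_self_eq] using h2

variable [IsManifold 𝓘(ℂ) ω S] {ψ : S → ℂ} {κ e₀ : ℂ}

theorem contMDiffAt_comp_prod {E : Type*} [NormedAddCommGroup E] [NormedSpace ℝ E]
    {G : ℂ × ℂ → E} (hψ : MDifferentiable 𝓘(ℂ) 𝓘(ℂ) ψ) {x : S} {z : ℂ}
    (hG : ContDiffAt ℝ ∞ G (ψ x, z)) :
    ContMDiffAt (𝓘(ℝ, ℂ).prod 𝓘(ℝ, ℂ)) 𝓘(ℝ, E) ∞ (fun p : S × ℂ => G (ψ p.1, p.2)) (x, z) := by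
  have h1 : ContMDiffAt (𝓘(ℝ, ℂ).prod 𝓘(ℝ, ℂ)) 𝓘(ℝ, ℂ × ℂ) ∞
      (fun p : S × ℂ => (ψ p.1, p.2)) (x, z) :=
    ((contMDiffAt_real_of_mdifferentiable hψ x).comp (x, z) contMDiffAt_fst).prodMk_space
      contMDiffAt_snd
  exact ContMDiffAt.comp (x, z) (I' := 𝓘(ℝ, ℂ × ℂ)) (g := G) hG.contMDiffAt h1

theorem contDiffAt_mode {p : ℂ × ℂ} (hp : p.1 ≠ 0) :
    ContDiffAt ℝ ∞ (fun p : ℂ × ℂ => mode κ e₀ p.1 p.2) p := by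
  have h1 : ContDiffAt ℝ ∞ (fun p : ℂ × ℂ => p.1) p := contDiffAt_fst
  have h2 : ContDiffAt ℝ ∞ (fun p : ℂ × ℂ => p.1⁻¹) p := h1.inv hp
  have h3 : ContDiffAt ℝ ∞ (fun p : ℂ × ℂ => p.2) p := contDiffAt_snd
  have hw : ∀ c : ℂ, ContDiffAt ℝ ∞ (fun p : ℂ × ℂ =>
      planeWave (κ * (p.1 + c)) (conj κ * (p.1⁻¹ + c)) p.2) p := fun c =>
    contDiff_planeWave_joint.contDiffAt.comp p ((contDiffAt_const.mul
      (h1.add contDiffAt_const)).prodMk ((contDiffAt_const.mul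
          (h2.add contDiffAt_const)).prodMk h3))
  refine ofCoord.contDiff.contDiffAt.comp p ?_
  refine ((contDiffAt_const.mul (h1.sub contDiffAt_const)).mul (hw 1)).prodMk
    ((h1.add contDiffAt_const).mul ?_)
  simpa only [sub_eq_add_neg] using hw (-1)

/-- The modes are a global frame, nowhere zero and holomorphic in l. -/
theorem isHolomorphicLineSubbundle_mode (hψ : MDifferentiable 𝓘(ℂ) 𝓘(ℂ) ψ) (h0 : ∀ x, ψ x ≠ 0)
    (he : ‖e₀‖ = 1) : IsHolomorphicLineSubbundle (fun x => complexSpan (mode κ e₀ (ψ x))) := by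
  have hw : ∀ p q z : ℂ, ∀ l ≠ 0,
      DifferentiableAt ℂ (fun l : ℂ => planeWave (κ * (l + p)) (conj κ * (l⁻¹ + q)) z) l := by
    intro p q z l hl
    unfold planeWave
    have := differentiableAt_inv (𝕜 := ℂ) hl
    fun_prop
  have hA : ∀ z, ∀ l ≠ 0, DifferentiableAt ℂ (fun l => coordA (mode κ e₀ l z)) l := by
    intro z l hl
    simp only [coordA_mode]
    have := hw 1 1 z l hl
    fun_prop
  have hB : ∀ z, ∀ l ≠ 0, DifferentiableAt ℂ (fun l => coordB (mode κ e₀ l z)) l := by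
    intro z l hl
    simp only [coordB_mode, sub_eq_add_neg]
    have := hw (-1) (-1) z l hl
    fun_prop
  refine fun x₀ => ⟨univ, isOpen_univ, mem_univ _, fun x => mode κ e₀ (ψ x), ?_, ?_, ?_, ?_⟩
  · rintro ⟨x, z⟩ -
    refine ContMDiffAt.contMDiffWithinAt ?_
    exact contMDiffAt_comp_prod hψ (contDiffAt_mode (p := (ψ x, z)) (h0 x))
  · intro z x _
    simp only [compU_eq]
    refine MDifferentiableAt.mdifferentiableWithinAt ?_
    exact MDifferentiableAt.comp (g := fun l => coordA (mode κ e₀ l z) + coordB (mode κ e₀ l z)) x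
      ((hA z _ (h0 x)).add (hB z _ (h0 x))).mdifferentiableAt (hψ x)
  · intro z x _
    simp only [compV_eq]
    refine MDifferentiableAt.mdifferentiableWithinAt ?_
    exact MDifferentiableAt.comp
      (g := fun l => -Complex.I * (coordA (mode κ e₀ l z) - coordB (mode κ e₀ l z))) x
      (((hA z _ (h0 x)).sub (hB z _ (h0 x))).const_mul _).mdifferentiableAt (hψ x)
  · exact fun x _ => ⟨mode_ne_zero' he _, rfl⟩

omit [ChartedSpace ℂ S] [IsManifold 𝓘(ℂ) ω S] in
theorem tendsto_nhdsNE_of_injective {T : Type*} [TopologicalSpace T] {f : S → T}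
    (hf : Continuous f) (hi : Function.Injective f) (x : S) : Tendsto f (𝓝[≠] x) (𝓝[≠] (f x)) :=
  tendsto_nhdsWithin_iff.2 ⟨hf.continuousAt.tendsto.mono_left nhdsWithin_le_nhds,
    eventually_nhdsWithin_of_forall fun _ hy h => hy (hi h)⟩

variable {Γ : Submodule ℤ ℂ} [DiscreteTopology Γ] [IsZLattice ℝ Γ]

/-- Off isolated points the multiplier determines its parameter, so the fibre is spanned by the
mode, and the bundle extends in one way only. Conversely, wherever the space of sections is a line
it is spanned by the mode, which it always contains. -/
theorem isKernelBundle_iff (hp : IsPhase Γ κ e₀) (hψ : MDifferentiable 𝓘(ℂ) 𝓘(ℂ) ψ)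
    (hi : Function.Injective ψ) (h0 : ∀ x, ψ x ≠ 0) {ν : S → AddChar Γ ℂ}
    (hν : ∀ x, modeMultiplier Γ κ (ψ x) = ν x) (L : S → Set (ℂ → ℍ)) :
    IsKernelBundle Γ (phaseNormal κ e₀) ν L ↔ L = fun x => complexSpan (mode κ e₀ (ψ x)) := by
  have hb := isHolomorphicLineSubbundle_mode (κ := κ) hψ h0 hp.norm_eq_one
  constructor
  · intro hL
    refine hL.1.eq_of_eventually_eq hb fun x => ?_
    filter_upwards [(tendsto_nhdsNE_of_injective hψ.continuous hi x).eventually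
      (eventually_modeMultiplier_injective hp (h0 x))] with y hy
    have h1 := holSections_eq_complexSpan hp (h0 y) hy
    rw [hν] at h1
    rw [hL.2 y ⟨_, mode_ne_zero' hp.norm_eq_one _, h1⟩, h1]
  · rintro rfl
    refine ⟨hb, fun x hx => ?_⟩
    rw [← hν] at hx ⊢
    exact holSections_of_isComplexLine hp (h0 x) hx

/-- The eigenvalues over μ = l² belong to l and -l. Off isolated points they are different, because
the multiplier already determines the parameter there. -/
theorem isEigenlineBundle_iff (hp : IsPhase Γ κ e₀) (hψ : MDifferentiable 𝓘(ℂ) 𝓘(ℂ) ψ)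
    (hi : Function.Injective ψ) (h0 : ∀ x, ψ x ≠ 0) {ν : S → ℂ × AddChar Γ ℂ}
    (hν : ∀ x, (ψ x ^ 2, modeMultiplier Γ κ (ψ x)) = ν x) (E : S → Set (ℂ → ℍ)) :
    IsEigenlineBundle Γ (phaseNormal κ e₀) ν E ↔ E = fun x => complexSpan (mode κ e₀ (ψ x)) := by
  have hb := isHolomorphicLineSubbundle_mode (κ := κ) hψ h0 hp.norm_eq_one
  constructor
  · intro hE
    refine hE.1.eq_of_eventually_eq hb fun x => ?_
    filter_upwards [(tendsto_nhdsNE_of_injective hψ.continuous hi x).eventually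
      (eventually_modeMultiplier_injective hp (h0 x))] with y hy
    have hne : modeMultiplier Γ κ (-ψ y) ≠ modeMultiplier Γ κ (ψ y) := fun h =>
      h0 y (neg_eq_self.1 (hy _ (neg_ne_zero.2 (h0 y)) h))
    rw [hE.2 y, ← hν, eigenSections_eq_complexSpan hp (h0 y) hne]
    refine ⟨_, by rw [← hν]; exact hne, ?_⟩
    rw [Eig_phaseNormal hp, ← hν]
    exact ⟨-ψ y, neg_ne_zero.2 (h0 y), by simp only [neg_sq]⟩
  · rintro rfl
    refine ⟨hb, fun x hx => ?_⟩
    rw [← hν] at hx ⊢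
    exact (eigenSections_of_exists_ne hp (h0 x) hx).symm

end Bundle

/-! ### The first variation of the area -/

theorem inner_eq (p q : ℍ) :
    inner ℝ p q = p.re * q.re + p.imI * q.imI + p.imJ * q.imJ + p.imK * q.imK := by
  rw [Quaternion.inner_def]; simp

theorem norm_sq_eq (p : ℍ) : ‖p‖ ^ 2 = p.re ^ 2 + p.imI ^ 2 + p.imJ ^ 2 + p.imK ^ 2 := by
  rw [← real_inner_self_eq_norm_sq, inner_eq]; ring

/-- Lagrange's identity. It rewrites the area density as the norm of a polynomial expression in the
derivatives, quadratic in the variation parameter. -/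
theorem sqrt_gram_eq_norm (p q : ℍ) :
    √(‖p‖ ^ 2 * ‖q‖ ^ 2 - inner ℝ p q ^ 2) = ‖(star p * q).im‖ := by
  rw [← Real.sqrt_sq (norm_nonneg (star p * q).im)]
  congr 1
  rw [norm_sq_eq, norm_sq_eq, norm_sq_eq, inner_eq]
  simp
  ring

theorem norm_im_le (p : ℍ) : ‖p.im‖ ≤ ‖p‖ := by
  refine abs_le_of_sq_le_sq' ?_ (norm_nonneg _) |>.2
  rw [norm_sq_eq, norm_sq_eq]
  simp
  positivity

theorem im_quadratic (p q p' q' : ℍ) (t : ℝ) : (star (p + t • p') * (q + t • q')).im =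
    (star p * q).im + t • (star p * q' + star p' * q).im + t ^ 2 • (star p' * q').im := by
  ext <;> simp <;> ring

/-- The derivative of the norm of a at t = 0 is ⟨a, b⟩ / |a|. For orthogonal p and q of equal
length, |a| = |p|² and ⟨a, b⟩ = (⟨p, p'⟩ + ⟨q, q'⟩) |p|². -/
theorem hasDerivAt_norm_im {p q : ℍ} (p' q' : ℍ) (hp : p ≠ 0) (hpq : ‖q‖ = ‖p‖)
    (hi : inner ℝ p q = 0) :
    HasDerivAt (fun t : ℝ => ‖(star (p + t • p') * (q + t • q')).im‖)
      (inner ℝ p p' + inner ℝ q q') 0 := by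
  have hn : 0 < ‖p‖ ^ 2 := by have := norm_pos_iff.2 hp; positivity
  set a := (star p * q).im
  set b := (star p * q' + star p' * q).im with hb
  set c := (star p' * q').im
  have ha : ‖a‖ = ‖p‖ ^ 2 := by
    rw [← sqrt_gram_eq_norm, hi, hpq, show ‖p‖ ^ 2 * ‖p‖ ^ 2 - 0 ^ 2 = (‖p‖ ^ 2) ^ 2 by ring,
      Real.sqrt_sq hn.le]
  have hab : inner ℝ a b = (inner ℝ p p' + inner ℝ q q') * ‖p‖ ^ 2 := by
    have h1 : inner ℝ a b = inner ℝ p p' * ‖q‖ ^ 2 + inner ℝ q q' * ‖p‖ ^ 2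
        - inner ℝ p q * (inner ℝ p q' + inner ℝ p' q) := by
      simp only [inner_eq, norm_sq_eq, a, b]; simp; ring
    rw [h1, hi, hpq]; ring
  have h1 : HasDerivAt (fun t : ℝ => a + t • b + t ^ 2 • c) b 0 := by
    have h2 := (((hasDerivAt_id (0 : ℝ)).smul_const b).const_add a).add
      (((hasDerivAt_id (0 : ℝ)).pow 2).smul_const c)
    exact h2.congr_deriv (by simp)
  have h2 := h1.norm_sq.sqrt (by simp [ha]; exact hp)
  simp only [zero_smul, add_zero, zero_pow two_ne_zero, Real.sqrt_sq (norm_nonneg _)] at h2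
  simp only [im_quadratic]
  refine h2.congr_deriv ?_
  rw [hab, ha]
  field_simp

/-- This domination also holds where p = 0 and the norm need not be differentiable, so branch points
are admitted in the first variation. -/
theorem lipschitzOnWith_norm_im (p q p' q' : ℍ) :
    LipschitzOnWith (Real.nnabs (‖p‖ * ‖q'‖ + ‖p'‖ * ‖q‖ + 2 * (‖p'‖ * ‖q'‖)))
      (fun t : ℝ => ‖(star (p + t • p') * (q + t • q')).im‖) (Metric.ball 0 1) := by
  refine LipschitzOnWith.of_dist_le_mul fun s hs t ht => ?_
  have hs : |s| < 1 := by simpa using hs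
  have ht : |t| < 1 := by simpa using ht
  simp only [im_quadratic]
  set a := (star p * q).im
  set b := (star p * q' + star p' * q).im with hb
  set c := (star p' * q').im
  have hb' : ‖b‖ ≤ ‖p‖ * ‖q'‖ + ‖p'‖ * ‖q‖ := by
    refine (norm_im_le _).trans ((norm_add_le _ _).trans ?_)
    rw [norm_mul, norm_mul, norm_star, norm_star]
  have hc : ‖c‖ ≤ ‖p'‖ * ‖q'‖ := by
    refine (norm_im_le _).trans ?_
    rw [norm_mul, norm_star]
  rw [Real.dist_eq, Real.dist_eq]
  refine (abs_norm_sub_norm_le _ _).trans ?_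
  have h1 : a + s • b + s ^ 2 • c - (a + t • b + t ^ 2 • c) = (s - t) • (b + (s + t) • c) := by
    module
  have h2 : ‖b + (s + t) • c‖ ≤ ‖p‖ * ‖q'‖ + ‖p'‖ * ‖q‖ + 2 * (‖p'‖ * ‖q'‖) := by
    refine (norm_add_le _ _).trans (add_le_add hb' ?_)
    rw [norm_smul, Real.norm_eq_abs]
    have : |s + t| ≤ 2 := (abs_add_le _ _).trans (by linarith)
    gcongr
  rw [h1, norm_smul, Real.norm_eq_abs, mul_comm]
  gcongr
  exact h2.trans (le_abs_self _)

section FirstVariation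

variable {Γ : Submodule ℤ ℂ} [DiscreteTopology Γ] [IsZLattice ℝ Γ] {D : Set ℂ} {f Z : ℂ → ℍ}

omit [DiscreteTopology Γ] [IsZLattice ℝ Γ] in
theorem ContDiff.fderiv_apply_const {E : Type*} [NormedAddCommGroup E] [NormedSpace ℝ E]
    {f : ℂ → E} (hf : ContDiff ℝ ∞ f) (v : ℂ) : ContDiff ℝ ∞ (fun z => fderiv ℝ f z v) :=
  (hf.fderiv_right (by simp)).clm_apply contDiff_const

/-- The integrand is uniformly Lipschitz in t with a periodic bound, and differentiable outside the
null set of branch points. -/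
theorem hasDerivAt_area (hD : IsAddFundamentalDomain Γ D volume) (hf : ContDiff ℝ ∞ f)
    (hfp : IsPeriodic Γ f) (hZ : ContDiff ℝ ∞ Z) (hZp : IsPeriodic Γ Z)
    (hnorm : ∀ z, ‖fderiv ℝ f z Complex.I‖ = ‖fderiv ℝ f z 1‖)
    (hinner : ∀ z, inner ℝ (fderiv ℝ f z 1) (fderiv ℝ f z Complex.I) = 0)
    (hbranch : ∀ᵐ z, fderiv ℝ f z 1 ≠ 0) :
    HasDerivAt (fun t : ℝ => ∫ z in D, areaDensity (fun w => f w + t • Z w) z)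
      (∫ z in D, (inner ℝ (fderiv ℝ f z 1) (fderiv ℝ Z z 1) +
        inner ℝ (fderiv ℝ f z Complex.I) (fderiv ℝ Z z Complex.I))) 0 := by
  have hc : ∀ v, Continuous (fun z => fderiv ℝ f z v) := fun v =>
    (hf.fderiv_apply_const v).continuous
  have hcZ : ∀ v, Continuous (fun z => fderiv ℝ Z z v) := fun v =>
    (hZ.fderiv_apply_const v).continuous
  have hdens : ∀ (t : ℝ) z, areaDensity (fun w => f w + t • Z w) z =
      ‖(star (fderiv ℝ f z 1 + t • fderiv ℝ Z z 1) *
        (fderiv ℝ f z Complex.I + t • fderiv ℝ Z z Complex.I)).im‖ := by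
    intro t z
    have h1 : fderiv ℝ (fun w => f w + t • Z w) z = fderiv ℝ f z + t • fderiv ℝ Z z := by
      exact ((hf.differentiable (by simp) z).hasFDerivAt.add
      ((hZ.differentiable (by simp) z).hasFDerivAt.const_smul t)).fderiv
    rw [areaDensity, sqrt_gram_eq_norm, h1]
    rfl
  have hcont : ∀ t : ℝ, Continuous (fun z => ‖(star (fderiv ℝ f z 1 + t • fderiv ℝ Z z 1) *
        (fderiv ℝ f z Complex.I + t • fderiv ℝ Z z Complex.I)).im‖) := fun t =>
    (Quaternion.continuous_im.comp ((continuous_star.comp ((hc 1).add ((hcZ 1).const_smul t))).mul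
      ((hc Complex.I).add ((hcZ Complex.I).const_smul t)))).norm
  have hbound : Continuous (fun z => ‖fderiv ℝ f z 1‖ * ‖fderiv ℝ Z z Complex.I‖ +
      ‖fderiv ℝ Z z 1‖ * ‖fderiv ℝ f z Complex.I‖ +
      2 * (‖fderiv ℝ Z z 1‖ * ‖fderiv ℝ Z z Complex.I‖)) :=
    (((hc _).norm.mul (hcZ _).norm).add ((hcZ _).norm.mul (hc _).norm)).add
      (continuous_const.mul ((hcZ _).norm.mul (hcZ _).norm))
  simp only [hdens]
  refine (hasDerivAt_integral_of_dominated_loc_of_lip (Metric.ball_mem_nhds (0 : ℝ) one_pos)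
    (.of_forall fun t => (hcont t).aestronglyMeasurable) ?_ ?_
    (ae_of_all _ fun z => lipschitzOnWith_norm_im _ _ _ _) ?_
    (ae_restrict_of_ae (hbranch.mono fun z hz => hasDerivAt_norm_im _ _ hz (hnorm z) (hinner z)))).2
  · refine integrableOn_of_periodic hD (hcont 0) ?_
    intro γ hγ z
    simp only [hfp.fderiv γ hγ z, hZp.fderiv γ hγ z]
  · exact (((hc _).inner (hcZ _)).add ((hc _).inner (hcZ _))).aestronglyMeasurable
  · refine integrableOn_of_periodic hD hbound ?_
    intro γ hγ z
    simp only [hfp.fderiv γ hγ z, hZp.fderiv γ hγ z]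

/-- The first variation after an integration by parts. -/
theorem setIntegral_inner_fderiv (hD : IsAddFundamentalDomain Γ D volume) (hf : ContDiff ℝ ∞ f)
    (hfp : IsPeriodic Γ f) (hZ : ContDiff ℝ ∞ Z) (hZp : IsPeriodic Γ Z) (v : ℂ) :
    ∫ z in D, inner ℝ (fderiv ℝ f z v) (fderiv ℝ Z z v) =
      -∫ z in D, inner ℝ (fderiv ℝ (fun w => fderiv ℝ f w v) z v) (Z z) := by
  have hfv := hf.fderiv_apply_const v
  have hfv2 := (hfv.fderiv_apply_const v).continuous
  have hp1 : IsPeriodic Γ (fun z => fderiv ℝ f z v) := hfp.fderiv_apply v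
  have h1 := setIntegral_fderiv_eq_zero (f := fun z => inner ℝ (fderiv ℝ f z v) (Z z)) hD
    ((hfv.inner ℝ hZ).of_le (by simp)) (fun γ hγ z =>
      congrArg₂ _ (hp1 γ hγ z) (hZp γ hγ z)) v
  have h2 : ∀ z, fderiv ℝ (fun z => inner ℝ (fderiv ℝ f z v) (Z z)) z v =
      inner ℝ (fderiv ℝ f z v) (fderiv ℝ Z z v) +
        inner ℝ (fderiv ℝ (fun w => fderiv ℝ f w v) z v) (Z z) := fun z =>
    fderiv_inner_apply ℝ (hfv.differentiable (by simp) z) (hZ.differentiable (by simp) z) v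
  simp only [h2] at h1
  rw [integral_add] at h1
  · linarith
  · refine integrableOn_of_periodic hD
      (hfv.continuous.inner (hZ.fderiv_apply_const v).continuous) ?_
    intro γ hγ z
    simp only [hfp.fderiv γ hγ z, hZp.fderiv γ hγ z]
  · refine integrableOn_of_periodic hD (hfv2.inner hZ.continuous) ?_
    intro γ hγ z
    simp only [hZp γ hγ z, hp1.fderiv γ hγ z]

end FirstVariation

theorem normalOf_I_mul (e : ℂ) : normalOf (Complex.I * e) = qj * normalOf e := by
  rw [normalOf_eq_leftMul, normalOf_eq_leftMul]
  ext <;> simp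

theorem norm_normalOf {e : ℂ} (he : ‖e‖ = 1) (q : ℍ) : ‖normalOf e * q‖ = ‖q‖ := by
  have h : ‖normalOf e‖ ^ 2 = 1 := by
    rw [← one_pow 2, ← he, norm_sq_eq, ← Complex.normSq_eq_norm_sq, Complex.normSq_apply,
      normalOf_eq_leftMul]
    simp; ring
  rw [norm_mul, (pow_eq_one_iff_of_nonneg (norm_nonneg _) two_ne_zero).1 h, one_mul]

theorem inner_normalOf_mul (e : ℂ) (q : ℍ) : inner ℝ q (normalOf e * q) = 0 := by
  rw [inner_eq, normalOf_eq_leftMul]; simp; ring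

theorem fderiv_fderiv_comm {E : Type*} [NormedAddCommGroup E] [NormedSpace ℝ E] {f : ℂ → E}
    (hf : ContDiff ℝ ∞ f) (z v w : ℂ) :
    fderiv ℝ (fun x => fderiv ℝ f x v) z w = fderiv ℝ (fun x => fderiv ℝ f x w) z v := by
  have hd : DifferentiableAt ℝ (fderiv ℝ f) z :=
    (hf.fderiv_right (m := 1) (by norm_cast)).differentiable one_ne_zero z
  have h1 := hf.contDiffAt.isSymmSndFDerivAt (x := z) (by
    rw [minSmoothness_of_isRCLikeNormedField]; exact WithTop.coe_le_coe.2 le_top)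
  rw [fderiv_clm_apply hd (differentiableAt_const v), fderiv_clm_apply hd
      (differentiableAt_const w)]
  simpa using h1 w v

section Normal

variable {f Z : ℂ → ℍ} {e : ℂ → ℂ} {b₁ b₂ : ℂ → ℝ}

/-- Differentiate f_y = N f_x and use f_xy = f_yx, N_v = b_v j N and N j N = j. In geometric terms,
the mean curvature vector is the complex structure applied to the gradient of the Lagrangian angle.
-/
theorem laplacian_eq (hf : ContDiff ℝ ∞ f) (he : ContDiff ℝ ∞ e) (hn : ∀ z, ‖e z‖ = 1)
    (hstar : ∀ z v, fderiv ℝ f z (Complex.I * v) = normalOf (e z) * fderiv ℝ f z v)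
    (h1 : ∀ z, fderiv ℝ e z 1 = Complex.I * (b₁ z * e z))
    (h2 : ∀ z, fderiv ℝ e z Complex.I = Complex.I * (b₂ z * e z)) (z : ℂ) :
    fderiv ℝ (fun w => fderiv ℝ f w 1) z 1 +
      fderiv ℝ (fun w => fderiv ℝ f w Complex.I) z Complex.I =
        qj * (b₁ z • fderiv ℝ f z 1 + b₂ z • fderiv ℝ f z Complex.I) := by
  have hI : ∀ w, fderiv ℝ f w Complex.I = normalOf (e w) * fderiv ℝ f w 1 := fun w => by
    rw [← hstar, mul_one]
  have hd1 : DifferentiableAt ℝ (fun w => fderiv ℝ f w 1) z :=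
    (hf.fderiv_apply_const 1).differentiable (by simp) z
  have hed := he.differentiable (by simp) z
  have hN : DifferentiableAt ℝ (fun w => normalOf (e w)) z := normalOf.differentiableAt.comp z hed
  have hprod : ∀ v, fderiv ℝ (fun w => fderiv ℝ f w Complex.I) z v =
      normalOf (e z) * fderiv ℝ (fun w => fderiv ℝ f w 1) z v +
        normalOf (fderiv ℝ e z v) * fderiv ℝ f z 1 := fun v => by
    rw [show (fun w => fderiv ℝ f w Complex.I) = fun w => normalOf (e w) * fderiv ℝ f w 1 from
      funext hI, fderiv_fun_mul' hN hd1, ← fderiv_normalOf hed]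
    rfl
  have hbe : ∀ b : ℝ, normalOf (Complex.I * (b * e z)) = b • (qj * normalOf (e z)) := fun b => by
    rw [normalOf_I_mul, ← Complex.real_smul, map_smul, mul_smul_comm]
  rw [hprod Complex.I, fderiv_fderiv_comm hf z 1 Complex.I, hprod 1, h1, h2, hbe, hbe, hI, mul_add,
    ← mul_assoc, normalOf_mul_self (hn z)]
  have hj : normalOf (e z) * (qj * normalOf (e z)) = qj := by
    rw [← normalOf_I_mul]
    have h3 : normalOf (Complex.I * e z) * normalOf (e z) = -qj := by
      rw [normalOf_I_mul, mul_assoc, normalOf_mul_self (hn z), mul_neg, mul_one]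
    have h4 : normalOf (e z) * normalOf (Complex.I * e z) =
        -(normalOf (Complex.I * e z) * normalOf (e z)) := by
      simp only [normalOf_eq_leftMul]; ext <;> simp
    rw [h4, h3, neg_neg]
  rw [← mul_assoc (normalOf (e z)), mul_smul_comm, hj, smul_mul_assoc, smul_mul_assoc, mul_add,
    mul_smul_comm, mul_smul_comm, mul_assoc qj]
  noncomm_ring

variable {Γ : Submodule ℤ ℂ} [DiscreteTopology Γ] [IsZLattice ℝ Γ] {D : Set ℂ}

/-- After integration by parts the variation is -∫ ⟨Δf, Z⟩. With Δf = j(b₁ f_x + b₂ f_y) this pairs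
Z with df through the symplectic form, that is, it pairs b with dφ. -/
theorem hasDerivAt_area_hamiltonian (hD : IsAddFundamentalDomain Γ D volume)
    (hf : ContDiff ℝ ∞ f) (hfp : IsPeriodic Γ f) (he : ContDiff ℝ ∞ e) (hn : ∀ z, ‖e z‖ = 1)
    (hstar : ∀ z v, fderiv ℝ f z (Complex.I * v) = normalOf (e z) * fderiv ℝ f z v)
    (h1 : ∀ z, fderiv ℝ e z 1 = Complex.I * (b₁ z * e z))
    (h2 : ∀ z, fderiv ℝ e z Complex.I = Complex.I * (b₂ z * e z))
    (hbranch : ∀ᵐ z, fderiv ℝ f z 1 ≠ 0) (hZ : ContDiff ℝ ∞ Z) (hZp : IsPeriodic Γ Z)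
    {φ : ℂ → ℝ} (hφ : ∀ z v, omega (Z z) (fderiv ℝ f z v) = fderiv ℝ φ z v) :
    HasDerivAt (fun t : ℝ => ∫ z in D, areaDensity (fun w => f w + t • Z w) z)
      (∫ z in D, (b₁ z * fderiv ℝ φ z 1 + b₂ z * fderiv ℝ φ z Complex.I)) 0 := by
  have hI : ∀ w, fderiv ℝ f w Complex.I = normalOf (e w) * fderiv ℝ f w 1 := fun w => by
    rw [← hstar, mul_one]
  refine (hasDerivAt_area hD hf hfp hZ hZp (fun z => by rw [hI, norm_normalOf (hn z)])
    (fun z => by rw [hI, inner_normalOf_mul]) hbranch).congr_deriv ?_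
  have hc : ∀ v, Continuous (fun z => fderiv ℝ f z v) := fun v =>
    (hf.fderiv_apply_const v).continuous
  have hi : ∀ v, IntegrableOn (fun z => inner ℝ (fderiv ℝ f z v) (fderiv ℝ Z z v)) D := fun v =>
    integrableOn_of_periodic hD ((hc v).inner (hZ.fderiv_apply_const v).continuous)
      fun γ hγ z => by simp only [hfp.fderiv γ hγ z, hZp.fderiv γ hγ z]
  have hi2 : ∀ v, IntegrableOn
      (fun z => inner ℝ (fderiv ℝ (fun w => fderiv ℝ f w v) z v) (Z z)) D := fun v =>
    integrableOn_of_periodic hD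
      (((hf.fderiv_apply_const v).fderiv_apply_const v).continuous.inner hZ.continuous)
      fun γ hγ z => by simp only [(hfp.fderiv_apply v).fderiv γ hγ z, hZp γ hγ z]
  rw [integral_add (hi 1) (hi Complex.I), setIntegral_inner_fderiv hD hf hfp hZ hZp,
    setIntegral_inner_fderiv hD hf hfp hZ hZp, ← neg_add, ← integral_add (hi2 1) (hi2 Complex.I),
    ← integral_neg]
  congr 1
  ext z
  rw [← inner_add_left, laplacian_eq hf he hn hstar h1 h2, ← hφ, ← hφ]
  simp only [omega, inner_eq]
  simp
  ring

/-- Branched conformal immersions whose left normal has affine phase are stationary. -/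
theorem isHamiltonianCritical_of_phaseNormal {κ e₀ : ℂ} (he : ‖e₀‖ = 1) (hf : ContDiff ℝ ∞ f)
    (hfp : IsPeriodic Γ f)
    (hstar : ∀ z v, fderiv ℝ f z (Complex.I * v) = phaseNormal κ e₀ z * fderiv ℝ f z v)
    (hbranch : ∀ᵐ z, fderiv ℝ f z 1 ≠ 0) : IsHamiltonianCritical Γ f := by
  rintro Z ⟨hZ, hZp, φ, hφ, hφp, hω⟩ D hD
  have key : ∀ v z, fderiv ℝ (phase κ e₀) z v =
      Complex.I * (((4 * (κ * v).re : ℝ) : ℂ) * phase κ e₀ z) := fun v z => by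
    rw [fderiv_phase]
    have : 2 * κ * v + 2 * conj κ * conj v = ((4 * (κ * v).re : ℝ) : ℂ) := by
      apply Complex.ext <;> simp <;> ring
    rw [this]; ring
  refine (hasDerivAt_area_hamiltonian hD hf hfp (contDiff_phase κ e₀) (norm_phase he) hstar
    (key 1) (key Complex.I) hbranch hZ hZp hω).congr_deriv ?_
  have hi : ∀ v, IntegrableOn (fun z => fderiv ℝ φ z v) D := fun v =>
    integrableOn_of_periodic hD (hφ.fderiv_apply_const v).continuous (hφp.fderiv_apply v)
  rw [integral_add ((hi _).const_mul _) ((hi _).const_mul _), integral_const_mul,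
    integral_const_mul, setIntegral_fderiv_eq_zero hD (hφ.of_le (by simp)) hφp,
    setIntegral_fderiv_eq_zero hD (hφ.of_le (by simp)) hφp]
  simp

end Normal

/-! ### The left normal of a Hamiltonian stationary torus -/

theorem fderiv_apply_eq {E : Type*} [NormedAddCommGroup E] [NormedSpace ℝ E] (L : ℂ →L[ℝ] E)
    (v : ℂ) : L v = v.re • L 1 + v.im • L Complex.I := by
  conv_lhs => rw [show v = v.re • (1 : ℂ) + v.im • Complex.I by simp]
  rw [map_add, map_smul, map_smul]

/-- The real number `b` in `de v = i b e`. -/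
def angleForm (e : ℂ → ℂ) (v z : ℂ) : ℝ := (fderiv ℝ e z v * conj (e z)).im

section Angle

variable {e : ℂ → ℂ}

theorem contDiff_angleForm (he : ContDiff ℝ ∞ e) (v : ℂ) : ContDiff ℝ ∞ (angleForm e v) :=
  Complex.imCLM.contDiff.comp ((he.fderiv_apply_const v).mul (Complex.conjCLE.contDiff.comp he))

/-- As |e| = 1, the derivative of e is orthogonal to e. -/
theorem fderiv_eq_angleForm (he : ContDiff ℝ ∞ e) (hn : ∀ z, ‖e z‖ = 1) (z v : ℂ) :
    fderiv ℝ e z v = Complex.I * (angleForm e v z * e z) := by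
  have hd := he.differentiable (by simp) z
  have h1 : inner ℝ (e z) (fderiv ℝ e z v) = 0 := by
    have h2 := fderiv_inner_apply ℝ hd hd v
    have h3 : (fun w => inner ℝ (e w) (e w)) = fun _ => (1 : ℝ) := funext fun w => by
      rw [real_inner_self_eq_norm_sq, hn, one_pow]
    rw [h3, fderiv_fun_const] at h2
    have h4 : (0 : ℝ) = inner ℝ (e z) (fderiv ℝ e z v) + inner ℝ (fderiv ℝ e z v) (e z) := h2
    rw [real_inner_comm (e z)] at h4
    linarith
  have h5 : fderiv ℝ e z v * conj (e z) = Complex.I * angleForm e v z := by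
    rw [Complex.inner] at h1
    apply Complex.ext
    · simp at h1 ⊢; linarith
    · simp [angleForm]
  have h6 : conj (e z) * e z = 1 := by
    rw [mul_comm, Complex.mul_conj, Complex.normSq_eq_norm_sq, hn]; simp
  calc fderiv ℝ e z v = fderiv ℝ e z v * (conj (e z) * e z) := by rw [h6, mul_one]
    _ = _ := by rw [← mul_assoc, h5, mul_assoc]

theorem fderiv_angleForm (he : ContDiff ℝ ∞ e) (hn : ∀ z, ‖e z‖ = 1) (z v w : ℂ) :
    fderiv ℝ (angleForm e v) z w =
      (fderiv ℝ (fun x => fderiv ℝ e x v) z w * conj (e z)).im := by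
  have hd := he.differentiable (by simp) z
  have hd2 := (he.fderiv_apply_const v).differentiable (by simp) z
  have hc : HasFDerivAt (fun x => conj (e x)) ((Complex.conjCLE : ℂ →L[ℝ] ℂ) ∘L fderiv ℝ e z) z :=
    (Complex.conjCLE : ℂ →L[ℝ] ℂ).hasFDerivAt.comp z hd.hasFDerivAt
  have h1 := (Complex.imCLM.hasFDerivAt.comp z (hd2.hasFDerivAt.mul hc)).fderiv
  have h2 : angleForm e v = Complex.imCLM ∘ ((fun x => fderiv ℝ e x v) * fun x => conj (e x)) := rfl
  rw [h2, h1]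
  simp [fderiv_eq_angleForm he hn]
  ring

/-- Closedness of the angle form: locally it is the differential of the angle. -/
theorem fderiv_angleForm_comm (he : ContDiff ℝ ∞ e) (hn : ∀ z, ‖e z‖ = 1) (z v w : ℂ) :
    fderiv ℝ (angleForm e v) z w = fderiv ℝ (angleForm e w) z v := by
  rw [fderiv_angleForm he hn, fderiv_angleForm he hn, fderiv_fderiv_comm he]

/-- Liouville's theorem for real differentiable functions. -/
theorem apply_eq_apply_of_cauchyRiemann {u : ℂ → ℂ} (hu : Differentiable ℝ u)
    (hcr : ∀ z, fderiv ℝ u z Complex.I = Complex.I * fderiv ℝ u z 1) {C : ℝ}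
    (hb : ∀ z, ‖u z‖ ≤ C) (z w : ℂ) : u z = u w :=
  Differentiable.apply_eq_apply_of_bounded
    (fun z => differentiableAt_complex_iff_differentiableAt_real.2 ⟨hu z, hcr z⟩)
    (isBounded_iff_forall_norm_le.2 ⟨C, forall_mem_range.2 hb⟩) z w

/-- A closed form with vanishing divergence satisfies the Cauchy–Riemann equations in the shape b₁ -
i b₂, which is bounded and hence constant. Then e and a plane wave solve the same linear equation.
-/
theorem exists_eq_phase (he : ContDiff ℝ ∞ e) (hn : ∀ z, ‖e z‖ = 1)
    (hdiv : ∀ z, fderiv ℝ (angleForm e 1) z 1 + fderiv ℝ (angleForm e Complex.I) z Complex.I = 0)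
    {C : ℝ} (h1 : ∀ z, |angleForm e 1 z| ≤ C) (h2 : ∀ z, |angleForm e Complex.I z| ≤ C) :
    ∃ κ, e = phase κ (e 0) := by
  set u : ℂ → ℂ := fun z => (angleForm e 1 z : ℂ) - Complex.I * (angleForm e Complex.I z : ℂ)
  have hu : ∀ z, HasFDerivAt u (Complex.ofRealCLM ∘L fderiv ℝ (angleForm e 1) z -
      Complex.I • (Complex.ofRealCLM ∘L fderiv ℝ (angleForm e Complex.I) z)) z := fun z =>
    (Complex.ofRealCLM.hasFDerivAt.comp z
      ((contDiff_angleForm he 1).differentiable (by simp) z).hasFDerivAt).sub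
    ((Complex.ofRealCLM.hasFDerivAt.comp z
      ((contDiff_angleForm he Complex.I).differentiable (by simp) z).hasFDerivAt).const_mul _)
  have hconst := apply_eq_apply_of_cauchyRiemann (fun z => (hu z).differentiableAt)
    (fun z => by
      rw [(hu z).fderiv]
      have h3 := fderiv_angleForm_comm he hn z 1 Complex.I
      have h4 := hdiv z
      apply Complex.ext
      · simp [h3]
      · simp; linarith) (C := C + C) (fun z => by
      refine (norm_sub_le _ _).trans ?_
      rw [norm_mul, Complex.norm_I, one_mul, Complex.norm_real, Complex.norm_real]
      exact add_le_add (h1 z) (h2 z))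
  -- For dβ = 2κ dz + 2 conj κ dz̄ one has b₁ = 4 Re κ and b₂ = -4 Im κ, so b₁ - i b₂ = 4κ.
  refine ⟨u 0 / 4, ?_⟩
  set κ := u 0 / 4 with hκ
  have hde : ∀ z v, fderiv ℝ e z v = Complex.I * (2 * κ * v + 2 * conj κ * conj v) * e z := by
    intro z v
    rw [fderiv_apply_eq, fderiv_eq_angleForm he hn, fderiv_eq_angleForm he hn, Complex.real_smul,
      Complex.real_smul]
    have h3 : u z = 4 * κ := by rw [hκ, hconst z 0]; ring
    have h4 : 2 * κ * v + 2 * conj κ * conj v =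
        angleForm e 1 z * v.re + angleForm e Complex.I z * v.im := by
      have hre := congrArg Complex.re h3
      have him := congrArg Complex.im h3
      simp [u] at hre him
      apply Complex.ext
      · simp; rw [hre, show angleForm e Complex.I z = -(4 * κ.im) by linarith]; ring
      · simp; ring
    rw [h4]; ring
  have hd := he.differentiable (by simp)
  have hg : ∀ z w : ℂ, e z * planeWave (-(2 * κ)) (-(2 * conj κ)) z =
      e w * planeWave (-(2 * κ)) (-(2 * conj κ)) w := by
    refine is_const_of_fderiv_eq_zero (𝕜 := ℝ) (hd.mul (differentiable_planeWave _ _)) fun z => ?_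
    ext v
    have h5 := (hd z).hasFDerivAt.mul (differentiable_planeWave (-(2 * κ))
        (-(2 * conj κ)) z).hasFDerivAt
    change fderiv ℝ (e * planeWave _ _) z v = 0
    rw [h5.fderiv]
    simp only [_root_.add_apply, _root_.smul_apply, smul_eq_mul, hde, fderiv_planeWave]
    ring
  funext z
  have h6 := hg z 0
  rw [planeWave_zero, mul_one, planeWave_neg] at h6
  rw [phase, ← h6, mul_assoc, inv_mul_cancel₀ (planeWave_ne_zero _ _ _), mul_one]

end Angle

section Torus

variable {Γ : Submodule ℤ ℂ} {f : ℂ → ℍ}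

theorem IsHamiltonianStationaryTorus.leftNormal_mul (hf : IsHamiltonianStationaryTorus Γ f)
    (z : ℂ) : leftNormal f z * fderiv ℝ f z 1 = fderiv ℝ f z Complex.I := by
  rw [leftNormal, mul_assoc, inv_mul_cancel₀ (hf.immersion z), mul_one]

theorem contDiff_quaternion_inv {g : ℂ → ℍ} (hg : ContDiff ℝ ∞ g) (h0 : ∀ z, g z ≠ 0) :
    ContDiff ℝ ∞ (fun z => (g z)⁻¹) := by
  have h1 : (fun z => (g z)⁻¹) = fun z => (‖g z‖ ^ 2)⁻¹ • star (g z) := funext fun z => by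
    rw [Quaternion.inv_def, Quaternion.normSq_eq_norm_mul_self, sq]
  have : StarModule ℝ ℍ := ⟨fun r q => by ext <;> simp⟩
  rw [h1]
  refine (ContDiff.inv (hg.norm_sq ℝ) fun z => ?_).smul ((starL' ℝ).contDiff.comp hg)
  have := norm_pos_iff.2 (h0 z); positivity

/-- The complex number `e` with `N = normalOf e`. -/
def normalPhase (f : ℂ → ℍ) (z : ℂ) : ℂ := -2 * Complex.I * coordA (leftNormal f z)

/-- Orthogonality of the two derivatives removes the real part of the left normal, and the
Lagrangian condition removes its j-part. -/
theorem IsHamiltonianStationaryTorus.leftNormal_eq (hf : IsHamiltonianStationaryTorus Γ f)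
    (z : ℂ) : leftNormal f z = normalOf (normalPhase f z) := by
  have hX := hf.immersion z
  have hX2 : ‖fderiv ℝ f z 1‖ ^ 2 ≠ 0 := by
    have := norm_pos_iff.2 hX; positivity
  have h1 : (leftNormal f z).re = 0 := by
    have h3 : inner ℝ (fderiv ℝ f z 1) (leftNormal f z * fderiv ℝ f z 1) =
        (leftNormal f z).re * ‖fderiv ℝ f z 1‖ ^ 2 := by
      rw [inner_eq, norm_sq_eq]; simp; ring
    rw [hf.leftNormal_mul, hf.conformal_inner] at h3
    exact (mul_eq_zero.1 h3.symm).resolve_right hX2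
  have h2 : (leftNormal f z).imJ = 0 := by
    have h3 : omega (fderiv ℝ f z 1) (leftNormal f z * fderiv ℝ f z 1) =
        (leftNormal f z).imJ * ‖fderiv ℝ f z 1‖ ^ 2 := by
      rw [omega, inner_eq, norm_sq_eq]; simp; ring
    rw [hf.leftNormal_mul, hf.lagrangian] at h3
    exact (mul_eq_zero.1 h3.symm).resolve_right hX2
  rw [normalOf_eq_leftMul]
  ext <;> simp [normalPhase, coordA_apply, h1, h2] <;> ring

theorem IsHamiltonianStationaryTorus.norm_normalPhase (hf : IsHamiltonianStationaryTorus Γ f)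
    (z : ℂ) : ‖normalPhase f z‖ = 1 := by
  have h1 : ‖leftNormal f z‖ = 1 := by
    rw [leftNormal, norm_mul, norm_inv, hf.conformal_norm,
      mul_inv_cancel₀ (norm_ne_zero_iff.2 (hf.immersion z))]
  have h2 : ‖normalPhase f z‖ ^ 2 = ‖leftNormal f z‖ ^ 2 := by
    rw [hf.leftNormal_eq, norm_sq_eq, ← Complex.normSq_eq_norm_sq, Complex.normSq_apply,
      normalOf_eq_leftMul]
    simp; ring
  rw [h1, one_pow] at h2
  exact (pow_eq_one_iff_of_nonneg (norm_nonneg _) two_ne_zero).1 h2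

theorem IsHamiltonianStationaryTorus.fderiv_I_mul (hf : IsHamiltonianStationaryTorus Γ f)
    (z v : ℂ) :
    fderiv ℝ f z (Complex.I * v) = normalOf (normalPhase f z) * fderiv ℝ f z v := by
  have h1 : normalOf (normalPhase f z) * fderiv ℝ f z 1 = fderiv ℝ f z Complex.I := by
    rw [← hf.leftNormal_eq, hf.leftNormal_mul]
  rw [fderiv_apply_eq, fderiv_apply_eq _ v, mul_add, mul_smul_comm, mul_smul_comm, h1, ← h1,
    ← mul_assoc, normalOf_mul_self (hf.norm_normalPhase z)]
  simp [add_comm]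

theorem IsHamiltonianStationaryTorus.contDiff_normalPhase
    (hf : IsHamiltonianStationaryTorus Γ f) : ContDiff ℝ ∞ (normalPhase f) := by
  have h1 : ContDiff ℝ ∞ (leftNormal f) :=
    (hf.smooth.fderiv_apply_const _).mul (contDiff_quaternion_inv
        (hf.smooth.fderiv_apply_const 1) hf.immersion)
  exact contDiff_const.mul (coordA.contDiff.comp h1)

theorem IsHamiltonianStationaryTorus.isPeriodic_normalPhase
    (hf : IsHamiltonianStationaryTorus Γ f) : IsPeriodic Γ (normalPhase f) := fun γ hγ z => by
  simp only [normalPhase, leftNormal, hf.periodic.fderiv γ hγ z]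

/-- A Hamiltonian vector field for a given Hamiltonian. -/
def hamiltonianField (f : ℂ → ℍ) (φ : ℂ → ℝ) (z : ℂ) : ℍ :=
  -(‖fderiv ℝ f z 1‖ ^ 2)⁻¹ • (fderiv ℝ φ z 1 • (qj * fderiv ℝ f z 1) +
    fderiv ℝ φ z Complex.I • (qj * fderiv ℝ f z Complex.I))

theorem IsHamiltonianStationaryTorus.omega_hamiltonianField
    (hf : IsHamiltonianStationaryTorus Γ f) (φ : ℂ → ℝ) (z v : ℂ) :
    omega (hamiltonianField f φ z) (fderiv ℝ f z v) = fderiv ℝ φ z v := by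
  have key : ∀ (a c d : ℝ) (X Y W : ℍ), omega (a • (c • (qj * X) + d • (qj * Y))) W =
      -a * (c * inner ℝ X W + d * inner ℝ Y W) := fun a c d X Y W => by
    simp only [omega, inner_eq]; simp; ring
  have hX2 : ‖fderiv ℝ f z 1‖ ^ 2 ≠ 0 := by
    have := norm_pos_iff.2 (hf.immersion z); positivity
  rw [hamiltonianField, key, fderiv_apply_eq (fderiv ℝ f z) v, fderiv_apply_eq (fderiv ℝ φ z) v,
    inner_add_right, inner_add_right, inner_smul_right, inner_smul_right, inner_smul_right,
    inner_smul_right, hf.conformal_inner, real_inner_comm (fderiv ℝ f z 1) (fderiv ℝ f z Complex.I),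
    hf.conformal_inner,
    real_inner_self_eq_norm_sq, real_inner_self_eq_norm_sq, hf.conformal_norm]
  generalize ‖fderiv ℝ f z 1‖ ^ 2 = n at hX2 ⊢
  simp only [smul_eq_mul]
  field_simp
  ring

theorem IsHamiltonianStationaryTorus.contDiff_hamiltonianField
    (hf : IsHamiltonianStationaryTorus Γ f) {φ : ℂ → ℝ} (hφ : ContDiff ℝ ∞ φ) :
    ContDiff ℝ ∞ (hamiltonianField f φ) := by
  have h := hf.smooth.fderiv_apply_const
  have h1 : ContDiff ℝ ∞ (fun z => -(‖fderiv ℝ f z 1‖ ^ 2)⁻¹) := by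
    refine (ContDiff.inv ((h 1).norm_sq ℝ) fun z => ?_).neg
    have := norm_pos_iff.2 (hf.immersion z); positivity
  exact h1.smul (((hφ.fderiv_apply_const 1).smul (contDiff_const.mul (h 1))).add
    ((hφ.fderiv_apply_const _).smul (contDiff_const.mul (h _))))

variable [DiscreteTopology Γ] [IsZLattice ℝ Γ]

/-- Use the divergence d itself as the Hamiltonian. Then 0 = ∫ b · ∇d = -∫ d². -/
theorem IsHamiltonianStationaryTorus.divergence_angleForm
    (hf : IsHamiltonianStationaryTorus Γ f) (z : ℂ) :
    fderiv ℝ (angleForm (normalPhase f) 1) z 1 +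
      fderiv ℝ (angleForm (normalPhase f) Complex.I) z Complex.I = 0 := by
  obtain ⟨D, hD⟩ := exists_fundamentalDomain Γ
  have he := hf.contDiff_normalPhase
  have hn := hf.norm_normalPhase
  have hep := hf.isPeriodic_normalPhase
  have hb : ∀ v, ContDiff ℝ ∞ (angleForm (normalPhase f) v) := contDiff_angleForm he
  have hbp : ∀ v, IsPeriodic Γ (angleForm (normalPhase f) v) := fun v γ hγ z => by
    simp only [angleForm, hep.fderiv γ hγ z, hep γ hγ z]
  set b₁ := angleForm (normalPhase f) 1
  set b₂ := angleForm (normalPhase f) Complex.I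
  set d : ℂ → ℝ := fun z => fderiv ℝ b₁ z 1 + fderiv ℝ b₂ z Complex.I with hd_def
  have hd : ContDiff ℝ ∞ d :=
    ((hb 1).fderiv_apply_const 1).add ((hb _).fderiv_apply_const _)
  have hdp : IsPeriodic Γ d := fun γ hγ z => by
    simp only [hd_def, (hbp _).fderiv γ hγ z, b₁, b₂]
  have hZp : IsPeriodic Γ (hamiltonianField f d) := fun γ hγ z => by
    simp only [hamiltonianField, hf.periodic.fderiv γ hγ z, hdp.fderiv γ hγ z]
  have h1 := hf.critical _ ⟨hf.contDiff_hamiltonianField hd, hZp, d, hd, hdp,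
    hf.omega_hamiltonianField d⟩ D hD
  have h2 := hasDerivAt_area_hamiltonian hD hf.smooth hf.periodic he hn hf.fderiv_I_mul
    (fun z => fderiv_eq_angleForm he hn z 1) (fun z => fderiv_eq_angleForm he hn z Complex.I)
    (ae_of_all _ hf.immersion) (hf.contDiff_hamiltonianField hd) hZp (hf.omega_hamiltonianField d)
  have h3 : ∫ z in D, (b₁ z * fderiv ℝ d z 1 + b₂ z * fderiv ℝ d z Complex.I) = 0 := h2.unique h1
  have h4 : ∀ v, ∫ z in D, (angleForm (normalPhase f) v z * fderiv ℝ d z v +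
      fderiv ℝ (angleForm (normalPhase f) v) z v * d z) = 0 := fun v => by
    rw [← setIntegral_fderiv_eq_zero (f := fun z => angleForm (normalPhase f) v z * d z) hD
      (((hb v).mul hd).of_le (by simp)) (fun γ hγ z => congrArg₂ _ (hbp v γ hγ z) (hdp γ hγ z)) v]
    congr 1
    ext z
    rw [fderiv_fun_mul ((hb v).differentiable (by simp) z) (hd.differentiable (by simp) z)]
    simp [mul_comm]
  have hi : ∀ v, IntegrableOn (fun z => angleForm (normalPhase f) v z * fderiv ℝ d z v) D :=
    fun v => integrableOn_of_periodic hD ((hb v).mul (hd.fderiv_apply_const v)).continuous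
      fun γ hγ z => congrArg₂ _ (hbp v γ hγ z) (hdp.fderiv_apply v γ hγ z)
  have hi2 : ∀ v, IntegrableOn (fun z => fderiv ℝ (angleForm (normalPhase f) v) z v * d z) D :=
    fun v => integrableOn_of_periodic hD (((hb v).fderiv_apply_const v).mul hd).continuous
      fun γ hγ z => congrArg₂ _ ((hbp v).fderiv_apply v γ hγ z) (hdp γ hγ z)
  have h5 : ∫ z in D, d z * d z = 0 := by
    have h6 := h4 1
    have h7 := h4 Complex.I
    rw [integral_add (hi _) (hi2 _)] at h6 h7
    rw [integral_add (hi 1) (hi Complex.I)] at h3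
    have h8 : ∫ z in D, d z * d z = (∫ z in D, fderiv ℝ b₁ z 1 * d z) +
        ∫ z in D, fderiv ℝ b₂ z Complex.I * d z := by
      rw [← integral_add (hi2 1) (hi2 Complex.I)]
      congr 1
      ext z
      rw [← add_mul]
    rw [h8]
    linarith
  have h6 := eq_zero_of_setIntegral_eq_zero hD (hd.mul hd).continuous
    (fun γ hγ z => congrArg₂ _ (hdp γ hγ z) (hdp γ hγ z)) (fun z => mul_self_nonneg _) h5
  exact mul_self_eq_zero.1 (congrFun h6 z)

/-- For a constant normal, A + e₀ B and the conjugate of A - e₀ B are holomorphic, where A and B are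
the coordinates of f. Both are bounded by periodicity, so f would be constant. -/
theorem IsHamiltonianStationaryTorus.not_constant_phase
    (hf : IsHamiltonianStationaryTorus Γ f) {e₀ : ℂ} (h : ∀ z, normalPhase f z = e₀) : False := by
  have he : ‖e₀‖ = 1 := h 0 ▸ hf.norm_normalPhase 0
  have he0 : e₀ ≠ 0 := by rw [← norm_ne_zero_iff, he]; exact one_ne_zero
  have hd := hf.smooth.differentiable (by simp)
  have hI : ∀ z, fderiv ℝ f z Complex.I = normalOf e₀ * fderiv ℝ f z 1 := fun z => by
    have := hf.fderiv_I_mul z 1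
    rwa [mul_one, h] at this
  have hA : Differentiable ℝ (fun z => coordA (f z)) := coordA.differentiable.comp hd
  have hB : Differentiable ℝ (fun z => coordB (f z)) := coordB.differentiable.comp hd
  have hAp : IsPeriodic Γ (fun z => coordA (f z)) := hf.periodic.comp _
  have hBp : IsPeriodic Γ (fun z => coordB (f z)) := hf.periodic.comp _
  obtain ⟨C₁, hC₁⟩ := exists_bound_of_periodic hA.continuous hAp
  obtain ⟨C₂, hC₂⟩ := exists_bound_of_periodic hB.continuous hBp
  have hAI : ∀ z, fderiv ℝ (fun z => coordA (f z)) z Complex.I =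
      Complex.I * e₀ * fderiv ℝ (fun z => coordB (f z)) z 1 := fun z => by
    rw [fderiv_coordA (hd z), fderiv_coordB (hd z), hI, coordA_normalOf_mul]
  have hBI : ∀ z, fderiv ℝ (fun z => coordB (f z)) z Complex.I =
      Complex.I * e₀⁻¹ * fderiv ℝ (fun z => coordA (f z)) z 1 := fun z => by
    rw [fderiv_coordA (hd z), fderiv_coordB (hd z), hI, coordB_normalOf_mul,
      conj_eq_inv_of_norm he]
  have h1 : ∀ z w, coordA (f z) + e₀ * coordB (f z) = coordA (f w) + e₀ * coordB (f w) := by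
    refine apply_eq_apply_of_cauchyRiemann (hA.add (hB.const_mul e₀)) (fun z => ?_) (C := C₁ + C₂)
      fun z => ?_
    · have h2 := ((hA z).hasFDerivAt.add ((hB z).hasFDerivAt.const_mul e₀)).fderiv
      erw [h2]
      simp only [_root_.add_apply, _root_.smul_apply, smul_eq_mul, hAI, hBI]
      field_simp
      ring
    · refine (norm_add_le _ _).trans ?_
      rw [norm_mul, he, one_mul]
      exact add_le_add (hC₁ z) (hC₂ z)
  have h2 : ∀ z w, conj (coordA (f z) - e₀ * coordB (f z)) =
      conj (coordA (f w) - e₀ * coordB (f w)) := by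
    have h3 : ∀ z, HasFDerivAt (fun z => conj (coordA (f z) - e₀ * coordB (f z)))
        ((Complex.conjCLE : ℂ →L[ℝ] ℂ) ∘L (fderiv ℝ (fun z => coordA (f z)) z -
          e₀ • fderiv ℝ (fun z => coordB (f z)) z)) z := fun z =>
      (Complex.conjCLE : ℂ →L[ℝ] ℂ).hasFDerivAt.comp z
        ((hA z).hasFDerivAt.sub ((hB z).hasFDerivAt.const_mul e₀))
    refine apply_eq_apply_of_cauchyRiemann (fun z => (h3 z).differentiableAt) (fun z => ?_)
      (C := C₁ + C₂) fun z => ?_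
    · rw [(h3 z).fderiv]
      have h4 : fderiv ℝ (fun z => coordA (f z)) z Complex.I -
          e₀ * fderiv ℝ (fun z => coordB (f z)) z Complex.I =
          -Complex.I * (fderiv ℝ (fun z => coordA (f z)) z 1 -
            e₀ * fderiv ℝ (fun z => coordB (f z)) z 1) := by
        rw [hAI, hBI]; field_simp; ring
      have h5 := congrArg conj h4
      rw [map_mul, map_neg, Complex.conj_I, neg_neg] at h5
      exact h5
    · rw [RCLike.norm_conj]
      refine (norm_sub_le _ _).trans ?_
      rw [norm_mul, he, one_mul]
      exact add_le_add (hC₁ z) (hC₂ z)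
  have h3 : f = fun _ => f 0 := funext fun z => by
    have h4 := h1 z 0
    have h5 := star_injective (h2 z 0)
    have hA : coordA (f z) = coordA (f 0) := by linear_combination (h4 + h5) / 2
    have hB : coordB (f z) = coordB (f 0) :=
      mul_left_cancel₀ he0 (by linear_combination (h4 - h5) / 2)
    exact ext_coord hA hB
  apply hf.immersion 0
  rw [h3, fderiv_fun_const]; rfl

/-- The left normal of a Hamiltonian stationary torus has affine phase. -/
theorem IsHamiltonianStationaryTorus.exists_isPhase (hf : IsHamiltonianStationaryTorus Γ f) :
    ∃ κ e₀, IsPhase Γ κ e₀ ∧ leftNormal f = phaseNormal κ e₀ := by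
  have he := hf.contDiff_normalPhase
  have hep := hf.isPeriodic_normalPhase
  have hbp : ∀ v, IsPeriodic Γ (angleForm (normalPhase f) v) := fun v γ hγ z => by
    simp only [angleForm, hep.fderiv γ hγ z, hep γ hγ z]
  obtain ⟨C₁, h1⟩ := exists_bound_of_periodic (contDiff_angleForm he 1).continuous (hbp 1)
  obtain ⟨C₂, h2⟩ := exists_bound_of_periodic (contDiff_angleForm he Complex.I).continuous (hbp _)
  obtain ⟨κ, hκ⟩ := exists_eq_phase he hf.norm_normalPhase hf.divergence_angleForm
    (C := max C₁ C₂) (fun z => (h1 z).trans (le_max_left _ _))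
    (fun z => (h2 z).trans (le_max_right _ _))
  have hn0 := hf.norm_normalPhase 0
  refine ⟨κ, normalPhase f 0, ⟨?_, hn0, fun γ hγ => ?_⟩, ?_⟩
  · rintro rfl
    refine hf.not_constant_phase (e₀ := normalPhase f 0) fun z => ?_
    conv_lhs => rw [hκ]
    simp [phase, planeWave_zero_zero]
  · have h3 := hep γ hγ 0
    rw [zero_add, hκ] at h3
    have h0 : normalPhase f 0 ≠ 0 := by rw [← norm_ne_zero_iff, hn0]; exact one_ne_zero
    simp only [phase, planeWave_zero, mul_one] at h3
    exact mul_left_cancel₀ h0 (h3.trans (mul_one _).symm)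
  · funext z
    rw [hf.leftNormal_eq, phaseNormal, ← hκ]

end Torus

/-! ### Branch points -/

/-- The moments of the coefficients `d`. -/
def moment (T : Finset ℂ) (d : ℂ → ℂ) (i : ℤ) : ℂ := ∑ l ∈ T, d l * l ^ i

theorem moment_mul_inv {T : Finset ℂ} (hT : ∀ l ∈ T, l ≠ 0) (d : ℂ → ℂ) (i : ℤ) :
    moment T (fun l => d l * l⁻¹) i = moment T d (i - 1) := by
  refine Finset.sum_congr rfl fun l hl => ?_
  rw [zpow_sub_one₀ (hT l hl)]; ring

/-- The binomial expansion shows which moments enter the Taylor term of degree j: those of index -j,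
-j + 2, …, j. -/
theorem sum_mul_pow_eq {T : Finset ℂ} (hT : ∀ l ∈ T, l ≠ 0) (d : ℂ → ℂ) (j : ℕ) (w : ℂ) :
    ∑ l ∈ T, d l * (l * w + l⁻¹ * conj w) ^ j =
      ∑ a ∈ Finset.range (j + 1), w ^ a * conj w ^ (j - a) * (j.choose a) *
        moment T d (2 * a - j) := by
  simp only [add_pow, moment, Finset.mul_sum]
  rw [Finset.sum_comm]
  refine Finset.sum_congr rfl fun a ha => Finset.sum_congr rfl fun l hl => ?_
  have h1 : l ^ (2 * a - j : ℤ) = l ^ a * l⁻¹ ^ (j - a) := by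
    have ha' : a ≤ j := Nat.lt_succ_iff.1 (Finset.mem_range.1 ha)
    rw [inv_pow, ← zpow_natCast, ← zpow_natCast, ← zpow_neg, ← zpow_add₀ (hT l hl)]
    push_cast [ha']
    ring_nf
  rw [h1, mul_pow, mul_pow]; ring

/-- Vanishing moments annihilate all polynomials; test with one that vanishes at all nodes except l.
-/
theorem eq_zero_of_moment_eq_zero {T : Finset ℂ} {d : ℂ → ℂ} (h : ∀ n : ℕ, moment T d n = 0) :
    ∀ l ∈ T, d l = 0 := by
  intro l hl
  have h1 : ∀ p : Polynomial ℂ, ∑ l ∈ T, d l * p.eval l = 0 := fun p => by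
    simp only [Polynomial.eval_eq_sum_range, Finset.mul_sum]
    rw [Finset.sum_comm]
    refine Finset.sum_eq_zero fun n _ => ?_
    have h2 := h n
    simp only [moment, zpow_natCast] at h2
    rw [← mul_zero (p.coeff n), ← h2, Finset.mul_sum]
    exact Finset.sum_congr rfl fun l _ => by ring
  have h2 := h1 (∏ l' ∈ T.erase l, (Polynomial.X - Polynomial.C l'))
  rw [Finset.sum_eq_single l, mul_eq_zero] at h2
  · refine h2.resolve_right ?_
    rw [Polynomial.eval_prod]
    refine Finset.prod_ne_zero_iff.2 fun l' hl' => ?_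
    simpa [sub_eq_zero] using (Finset.ne_of_mem_erase hl').symm
  · intro l' hl' hne
    rw [Polynomial.eval_prod, Finset.prod_eq_zero (Finset.mem_erase.2 ⟨hne, hl'⟩) (by simp),
        mul_zero]
  · exact fun h => absurd hl h

/-- All Taylor terms of degree below k vanish, and the one of degree k dominates the remainder,
which is O(|w|^{k+1}). -/
theorem eventually_expSum_ne_zero_of_leading {T : Finset ℂ} {d : ℂ → ℂ} {k : ℕ} {q : ℂ → ℂ} {c : ℝ}
    (hc : 0 < c) (hq : ∀ w, c * ‖w‖ ^ k ≤ ‖q w‖)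
    (hlt : ∀ j < k, ∀ w, ∑ l ∈ T, d l * (l * w + l⁻¹ * conj w) ^ j = 0)
    (hk : ∀ w, ∑ l ∈ T, d l * (l * w + l⁻¹ * conj w) ^ k = q w) :
    ∀ᶠ w in 𝓝[≠] 0, ∑ l ∈ T, d l * Complex.exp (Complex.I * (l * w + l⁻¹ * conj w)) ≠ 0 := by
  have hexp : (fun u : ℂ => Complex.exp u - ∑ j ∈ Finset.range (k + 1), u ^ j / j.factorial)
      =O[𝓝 0] fun u => u ^ (k + 1) := by
    refine Asymptotics.IsBigO.of_bound ((k + 1).succ * ((k + 1).factorial * (k + 1 : ℕ) : ℝ)⁻¹) ?_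
    filter_upwards [Metric.closedBall_mem_nhds (0 : ℂ) one_pos] with u hu
    rw [mul_comm, norm_pow]
    exact Complex.exp_bound (by simpa using hu) (Nat.succ_pos k)
  have hlin : ∀ l : ℂ, (fun w : ℂ => Complex.I * (l * w + l⁻¹ * conj w)) =O[𝓝 0] fun w => w := by
    intro l
    refine Asymptotics.IsBigO.of_bound (‖l‖ + ‖l⁻¹‖) (.of_forall fun w => ?_)
    rw [norm_mul, Complex.norm_I, one_mul, add_mul]
    refine (norm_add_le _ _).trans ?_
    rw [norm_mul, norm_mul, RCLike.norm_conj]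
  have hterm : ∀ l : ℂ, (fun w : ℂ => Complex.exp (Complex.I * (l * w + l⁻¹ * conj w)) -
      ∑ j ∈ Finset.range (k + 1), (Complex.I * (l * w + l⁻¹ * conj w)) ^ j / j.factorial)
      =O[𝓝 0] fun w => w ^ (k + 1) := by
    intro l
    have ht : Tendsto (fun w : ℂ => Complex.I * (l * w + l⁻¹ * conj w)) (𝓝 0) (𝓝 0) := by
      have : Continuous (fun w : ℂ => Complex.I * (l * w + l⁻¹ * conj w)) := by fun_prop
      simpa using this.tendsto 0
    exact (hexp.comp_tendsto ht).trans ((hlin l).pow (k + 1))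
  have hsum := Asymptotics.IsBigO.fun_sum (s := T) fun l _ => (hterm l).const_mul_left (d l)
  have heq : ∀ w : ℂ, ∑ l ∈ T, d l * (Complex.exp (Complex.I * (l * w + l⁻¹ * conj w)) -
      ∑ j ∈ Finset.range (k + 1), (Complex.I * (l * w + l⁻¹ * conj w)) ^ j / j.factorial) =
      ∑ l ∈ T, d l * Complex.exp (Complex.I * (l * w + l⁻¹ * conj w)) -
        Complex.I ^ k * q w / k.factorial := by
    intro w
    simp only [mul_sub, Finset.sum_sub_distrib]
    congr 1
    simp only [Finset.mul_sum]
    rw [Finset.sum_comm, Finset.sum_range_succ, Finset.sum_eq_zero, zero_add, ← hk, Finset.mul_sum,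
      Finset.sum_div]
    · exact Finset.sum_congr rfl fun l _ => by rw [mul_pow]; ring
    · intro j hj
      have h1 := hlt j (Finset.mem_range.1 hj) w
      rw [← mul_zero (Complex.I ^ j / j.factorial), ← h1, Finset.mul_sum]
      exact Finset.sum_congr rfl fun l _ => by rw [mul_pow]; ring
  simp only [heq] at hsum
  have hlo := hsum.trans_isLittleO (Asymptotics.isLittleO_pow_pow (𝕜 := ℂ) (Nat.lt_succ_self k))
  have hkf : (0 : ℝ) < k.factorial := by positivity
  filter_upwards [mem_nhdsWithin_of_mem_nhds (hlo.def (half_pos (div_pos hc hkf))),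
    self_mem_nhdsWithin] with w hw hne h0
  have hw : ‖∑ l ∈ T, d l * Complex.exp (Complex.I * (l * w + l⁻¹ * conj w)) -
        Complex.I ^ k * q w / k.factorial‖ ≤ c / k.factorial / 2 * ‖w ^ k‖ := hw
  rw [h0, zero_sub, norm_neg, norm_div, norm_mul, norm_pow, Complex.norm_I, one_pow, one_mul,
    Complex.norm_natCast, norm_pow] at hw
  have h1 : 0 < ‖w‖ ^ k := pow_pos (norm_pos_iff.2 hne) k
  have h2 : c * ‖w‖ ^ k / k.factorial ≤ ‖q w‖ / k.factorial := by gcongr; exact hq w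
  have h3 : 0 < c * ‖w‖ ^ k / k.factorial := by positivity
  have h4 : c / k.factorial / 2 * ‖w‖ ^ k = c * ‖w‖ ^ k / k.factorial / 2 := by ring
  linarith

/-- Take the least k for which the moment of index k or -k - 1 is nonzero. In degree k the first sum
involves the indices from -k to k, the second those from -k - 1 to k - 1. So one of the sums has a
leading term that is a multiple of w^k or of conj w^k alone, which vanishes only at 0. -/
theorem eventually_expSum_ne_zero {T : Finset ℂ} (hT : ∀ l ∈ T, l ≠ 0) {d : ℂ → ℂ}
    (hd : ∃ l ∈ T, d l ≠ 0) : ∀ᶠ w in 𝓝[≠] 0,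
      ∑ l ∈ T, d l * Complex.exp (Complex.I * (l * w + l⁻¹ * conj w)) ≠ 0 ∨
      ∑ l ∈ T, d l * l⁻¹ * Complex.exp (Complex.I * (l * w + l⁻¹ * conj w)) ≠ 0 := by
  have hex : ∃ k : ℕ, moment T d k ≠ 0 ∨ moment T d (-k - 1) ≠ 0 := by
    by_contra! h
    obtain ⟨l, hl, hne⟩ := hd
    exact hne (eq_zero_of_moment_eq_zero (fun n => (h n).1) l hl)
  classical
  obtain ⟨k, hk, hmin⟩ : ∃ k : ℕ, (moment T d k ≠ 0 ∨ moment T d (-k - 1) ≠ 0) ∧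
      ∀ i : ℤ, -k ≤ i → i < k → moment T d i = 0 := by
    refine ⟨Nat.find hex, Nat.find_spec hex, fun i h1 h2 => ?_⟩
    by_cases hi : 0 ≤ i
    · have h3 := Nat.find_min hex (m := i.toNat) (by omega)
      push Not at h3
      rw [← h3.1, Int.toNat_of_nonneg hi]
    · have h3 := Nat.find_min hex (m := (-i - 1).toNat) (by omega)
      push Not at h3
      rw [← h3.2]
      congr 1
      omega
  rcases hk with hk | hk
  · refine (eventually_expSum_ne_zero_of_leading (k := k) (q := fun w => moment T d k * w ^ k)
      (norm_pos_iff.2 hk) (fun w => by rw [norm_mul, norm_pow]) (fun j hj w => ?_)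
      fun w => ?_).mono fun w hw => Or.inl hw
    · rw [sum_mul_pow_eq hT]
      refine Finset.sum_eq_zero fun a ha => ?_
      have := Finset.mem_range.1 ha
      rw [hmin _ (by omega) (by omega), mul_zero]
    · rw [sum_mul_pow_eq hT, Finset.sum_range_succ, Finset.sum_eq_zero]
      · rw [show (2 * k - k : ℤ) = k by ring]; simp; ring
      · intro a ha
        have := Finset.mem_range.1 ha
        rw [hmin _ (by omega) (by omega), mul_zero]
  · refine (eventually_expSum_ne_zero_of_leading (k := k) (d := fun l => d l * l⁻¹)
      (q := fun w => moment T d (-k - 1) * conj w ^ k)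
      (norm_pos_iff.2 hk) (fun w => by rw [norm_mul, norm_pow, RCLike.norm_conj])
      (fun j hj w => ?_) fun w => ?_).mono fun w hw => Or.inr hw
    · rw [sum_mul_pow_eq hT]
      refine Finset.sum_eq_zero fun a ha => ?_
      have := Finset.mem_range.1 ha
      rw [moment_mul_inv hT, hmin _ (by omega) (by omega), mul_zero]
    · rw [sum_mul_pow_eq hT, Finset.sum_range_succ', Finset.sum_eq_zero]
      · rw [moment_mul_inv hT]; simp; ring
      · intro a ha
        have := Finset.mem_range.1 ha
        rw [moment_mul_inv hT, hmin _ (by push_cast; omega) (by push_cast; omega), mul_zero]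

section HolSections

variable {Γ : Submodule ℤ ℂ} [DiscreteTopology Γ] [IsZLattice ℝ Γ] {h : AddChar Γ ℂ} {κ e₀ : ℂ}
  {α : ℂ → ℍ}

/-- The zeros of the derivative of a nonconstant holomorphic section are isolated. -/
theorem eventually_fderiv_ne_zero (hp : IsPhase Γ κ e₀)
    (hα : α ∈ holSections Γ (phaseNormal κ e₀) h) (hne : ∃ z, fderiv ℝ α z ≠ 0) (z₀ : ℂ) :
    ∀ᶠ z in 𝓝[≠] z₀, fderiv ℝ α z ≠ 0 := by
  obtain ⟨D, hD⟩ := exists_fundamentalDomain Γ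
  obtain ⟨c, hc, -⟩ := exists_sum_of_holSections hp hD hα
  set T := parameters hp h
  have hT : ∀ l ∈ T, l ≠ 0 := fun l hl => (mem_parameters.1 hl).1
  have hfd : ∀ z v, fderiv ℝ α z v = ∑ l ∈ T, fderiv ℝ (mode κ e₀ l) z v * (c l : ℍ) := by
    intro z v
    have h1 : α = fun z => ∑ l ∈ T, mode κ e₀ l z * (c l : ℍ) := funext hc
    rw [h1, fderiv_fun_sum fun l _ => (differentiable_mode l z).mul_const _,
      _root_.sum_apply]
    refine Finset.sum_congr rfl fun l _ => ?_
    rw [fderiv_mul_const' (differentiable_mode l z)]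
    rfl
  have hA : ∀ z v, coordA (fderiv ℝ α z v) = Complex.I * e₀ * planeWave κ (conj κ) z *
      (κ * v * ∑ l ∈ T, c l * (l ^ 2 - 1) * planeWave (κ * l) (conj κ * l⁻¹) z +
        conj κ * conj v *
          ∑ l ∈ T, c l * (l ^ 2 - 1) * l⁻¹ * planeWave (κ * l) (conj κ * l⁻¹) z) := by
    intro z v
    rw [hfd, map_sum, Finset.mul_sum, Finset.mul_sum, ← Finset.sum_add_distrib, Finset.mul_sum]
    refine Finset.sum_congr rfl fun l hl => ?_
    have hl0 := hT l hl
    have h2 : planeWave (κ * (l + 1)) (conj κ * (l⁻¹ + 1)) z =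
        planeWave κ (conj κ) z * planeWave (κ * l) (conj κ * l⁻¹) z := by
      rw [planeWave_mul]; ring_nf
    rw [coordA_mul_coe, coordA_fderiv_mode, coordA_mode, h2]
    field_simp
    ring
  -- The modes with l² = 1 are constant. If only these occurred, the derivative would vanish
  -- identically.
  have hd : ∃ l ∈ T, c l * (l ^ 2 - 1) * planeWave (κ * l) (conj κ * l⁻¹) z₀ ≠ 0 := by
    by_contra! h0
    obtain ⟨z, hz⟩ := hne
    apply hz
    ext1 v
    rw [hfd]
    refine Finset.sum_eq_zero fun l hl => ?_
    have h1 := (mul_eq_zero.1 (h0 l hl)).resolve_right (planeWave_ne_zero _ _ _)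
    rcases mul_eq_zero.1 h1 with h2 | h2
    · rw [h2, Quaternion.coeComplex_zero, mul_zero]
    · have h3 : fderiv ℝ (mode κ e₀ l) z v = 0 := by
        have hl0 := hT l hl
        have h4 : (l⁻¹ + 1) * (l - 1) = 0 := by
          field_simp; linear_combination h2
        have h5 : (l⁻¹ - 1) * (l + 1) = 0 := by
          field_simp; linear_combination -h2
        apply ext_coord
        · rw [coordA_fderiv_mode, coordA_mode, map_zero]
          linear_combination (Complex.I * e₀ * planeWave (κ * (l + 1)) (conj κ * (l⁻¹ + 1)) z) *
            (κ * v * h2 + conj κ * conj v * h4)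
        · rw [coordB_fderiv_mode, coordB_mode, map_zero]
          linear_combination (Complex.I * planeWave (κ * (l - 1)) (conj κ * (l⁻¹ - 1)) z) *
            (κ * v * h2 + conj κ * conj v * h5)
      rw [h3, zero_mul]
  have hev := eventually_expSum_ne_zero hT hd
  -- In the variable w = κ(z - z₀) the two coefficients of the derivative become exponential sums
  -- centred at 0.
  have ht : Tendsto (fun z => κ * (z - z₀)) (𝓝[≠] z₀) (𝓝[≠] 0) := by
    refine tendsto_nhdsWithin_iff.2 ⟨?_, ?_⟩
    · have : Continuous (fun z => κ * (z - z₀)) := by fun_prop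
      simpa using (this.tendsto z₀).mono_left nhdsWithin_le_nhds
    · filter_upwards [self_mem_nhdsWithin] with z hz h0
      rcases mul_eq_zero.1 h0 with h1 | h1
      · exact hp.ne_zero h1
      · exact hz (sub_eq_zero.1 h1)
  filter_upwards [ht.eventually hev] with z hz h0
  have hwave : ∀ l, planeWave (κ * l) (conj κ * l⁻¹) z₀ *
      Complex.exp (Complex.I * (l * (κ * (z - z₀)) + l⁻¹ * conj (κ * (z - z₀)))) =
        planeWave (κ * l) (conj κ * l⁻¹) z := fun l => by
    rw [planeWave, planeWave, ← Complex.exp_add, map_mul, map_sub]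
    ring_nf
  have he0 : Complex.I * e₀ * planeWave κ (conj κ) z ≠ 0 :=
    mul_ne_zero (mul_ne_zero Complex.I_ne_zero
      (by rw [← norm_ne_zero_iff, hp.norm_eq_one]; exact one_ne_zero)) (planeWave_ne_zero _ _ _)
  have h1 := linear_form_eq
    (p := κ * ∑ l ∈ T, c l * (l ^ 2 - 1) * planeWave (κ * l) (conj κ * l⁻¹) z)
    (q := conj κ * ∑ l ∈ T, c l * (l ^ 2 - 1) * l⁻¹ * planeWave (κ * l) (conj κ * l⁻¹) z)
    (p' := 0) (q' := 0) fun v => by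
    have h2 := hA z v
    rw [h0, _root_.zero_apply, map_zero] at h2
    have h3 := (mul_eq_zero.1 h2.symm).resolve_left he0
    rw [zero_mul, zero_mul, add_zero, ← h3]
    ring
  have hκ' : conj κ ≠ 0 := by simpa using hp.ne_zero
  have hD := (mul_eq_zero.1 h1.1).resolve_left hp.ne_zero
  have hE := (mul_eq_zero.1 h1.2).resolve_left hκ'
  rcases hz with hz | hz
  · refine hz (Eq.trans (Finset.sum_congr rfl fun l _ => ?_) hD)
    rw [mul_assoc, hwave]
  · refine hz (Eq.trans (Finset.sum_congr rfl fun l _ => ?_) hE)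
    rw [← hwave]; ring

end HolSections

/-! ### Darboux transforms given by eigenfunctions of a derivative -/

theorem map_mul_eq {E : Type*} [NormedAddCommGroup E] [NormedSpace ℝ E] (L : ℂ →L[ℝ] E)
    (c v : ℂ) : L (c * v) = c.re • L v + c.im • L (Complex.I * v) := by
  have h : c * v = c.re • v + c.im • (Complex.I * v) := by
    rw [Complex.real_smul, Complex.real_smul]
    conv_lhs => rw [← Complex.re_add_im c]
    ring
  rw [h, map_add, map_smul, map_smul]

/-- The second component of the prolongation of `α`. -/
def darbouxNu (f α : ℂ → ℍ) (τ k : ℂ) (z : ℂ) : ℍ := -((fderiv ℝ f z τ)⁻¹ * α z * (k : ℍ))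

/-- The Darboux transform of `f` given by `α`, as a map into `ℍ`. -/
def darbouxTransform (f α : ℂ → ℍ) (τ k : ℂ) (z : ℂ) : ℍ :=
  f z - α z * ((k⁻¹ : ℂ) : ℍ) * (α z)⁻¹ * fderiv ℝ f z τ

section Darboux

variable {f α N : ℂ → ℍ} {τ k : ℂ} (hτ : τ ≠ 0)
  (hf : ContDiff ℝ ∞ f) (hfτ : ∀ z, fderiv ℝ f z τ ≠ 0)
  (hfN : ∀ z v, fderiv ℝ f z (Complex.I * v) = N z * fderiv ℝ f z v)
  (hα : ContDiff ℝ ∞ α) (hα0 : ∀ z, α z ≠ 0)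
  (hαN : ∀ z v, fderiv ℝ α z (Complex.I * v) = N z * fderiv ℝ α z v)
  (hατ : ∀ z, fderiv ℝ α z τ = α z * (k : ℍ))

theorem coe_ne_zero {k : ℂ} (hk : k ≠ 0) : (k : ℍ) ≠ 0 := fun h => hk (by
  have h1 := congrArg coordA (h.trans (mul_zero (1 : ℍ)).symm)
  have h2 : coordA (1 * (k : ℍ)) = coordA 1 * k := coordA_mul_coe 1 k
  rw [one_mul] at h2
  rw [h2, mul_zero, map_zero] at h1
  refine (mul_eq_zero.1 h1).resolve_left ?_
  simp [coordA_apply, Complex.ext_iff])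

theorem coe_inv_mul_coe {k : ℂ} (hk : k ≠ 0) : ((k⁻¹ : ℂ) : ℍ) * (k : ℍ) = 1 := by
  rw [← Quaternion.coeComplex_mul, inv_mul_cancel₀ hk, Quaternion.coeComplex_one]

theorem coe_inv {k : ℂ} (hk : k ≠ 0) : ((k⁻¹ : ℂ) : ℍ) = (k : ℍ)⁻¹ :=
  eq_inv_of_mul_eq_one_left (coe_inv_mul_coe hk)

include hα0 hfτ in
theorem darbouxNu_ne_zero (hk : k ≠ 0) (z : ℂ) : darbouxNu f α τ k z ≠ 0 :=
  neg_ne_zero.2 (mul_ne_zero (mul_ne_zero (inv_ne_zero (hfτ z)) (hα0 z)) (coe_ne_zero hk))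

include hf hfτ hα in
theorem contDiff_darbouxNu : ContDiff ℝ ∞ (darbouxNu f α τ k) :=
  (((contDiff_quaternion_inv (hf.fderiv_apply_const τ) hfτ).mul hα).mul contDiff_const).neg

include hτ hfτ hfN hαN hατ in
-- Both df and dα are of type *η = N η, so agreement in the single direction τ suffices; ν is
-- defined so that it holds there.
theorem fderiv_mul_darbouxNu (z v : ℂ) :
    fderiv ℝ f z v * darbouxNu f α τ k z = -fderiv ℝ α z v := by
  have h1 : fderiv ℝ f z τ * darbouxNu f α τ k z = -fderiv ℝ α z τ := by
    rw [darbouxNu, mul_neg, ← mul_assoc, ← mul_assoc, mul_inv_cancel₀ (hfτ z), one_mul, hατ]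
  rw [← div_mul_cancel₀ v hτ, map_mul_eq (fderiv ℝ f z), map_mul_eq (fderiv ℝ α z), hfN, hαN,
      add_mul, smul_mul_assoc,
    smul_mul_assoc, mul_assoc, h1]
  simp only [mul_neg, smul_neg, neg_add]

include hτ hf hfτ hfN hα hαN hατ in
theorem isProlongation_darbouxNu :
    IsProlongation f α (fun z => (f z * darbouxNu f α τ k z + α z, darbouxNu f α τ k z)) := by
  have hν := contDiff_darbouxNu (k := k) hf hfτ hα
  have hfd := hf.differentiable (by simp)
  have hαd := hα.differentiable (by simp)
  have hνd := hν.differentiable (by simp)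
  refine ⟨((hf.mul hν).add hα).prodMk hν, fun z => by simp, fun z v => ?_⟩
  have h1 := (((hfd z).hasFDerivAt.mul' (hνd z).hasFDerivAt).add (hαd z).hasFDerivAt).prodMk
    (hνd z).hasFDerivAt
  have h2 := congrArg (fun L : ℂ →L[ℝ] ℍ × ℍ => L v) h1.fderiv
  have h3 := congrArg Prod.fst h2
  have h4 := congrArg Prod.snd h2
  refine (h3.trans ?_).trans (congrArg _ h4.symm)
  have h5 := fderiv_mul_darbouxNu hτ hfτ hfN hαN hατ z v
  simp [h5]

theorem toS4_of_ne_zero {p : ℍ × ℍ} (h : p.2 ≠ 0) :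
    toS4 p = ((p.1 * p.2⁻¹ : ℍ) : OnePoint ℍ) := by
  rw [toS4, if_neg h]

include hα0 hfτ in
theorem darbouxTransform_eq (hk : k ≠ 0) (z : ℂ) : darbouxTransform f α τ k z =
    (f z * darbouxNu f α τ k z + α z) * (darbouxNu f α τ k z)⁻¹ := by
  have hν := darbouxNu_ne_zero hfτ hα0 hk z
  rw [eq_mul_inv_iff_mul_eq₀ hν, darbouxTransform, sub_mul, sub_eq_add_neg, ← mul_neg]
  congr 1
  rw [darbouxNu, neg_neg, mul_assoc, mul_assoc, mul_assoc, ← mul_assoc (fderiv ℝ f z τ),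
    ← mul_assoc (fderiv ℝ f z τ), mul_inv_cancel₀ (hfτ z), one_mul, ← mul_assoc (α z)⁻¹,
    inv_mul_cancel₀ (hα0 z), one_mul, coe_inv_mul_coe hk, mul_one]

include hα0 hf hα in
theorem contDiff_darbouxTransform : ContDiff ℝ ∞ (darbouxTransform f α τ k) :=
  hf.sub (((hα.mul contDiff_const).mul (contDiff_quaternion_inv hα hα0)).mul
    (hf.fderiv_apply_const τ))

include hα0 hfτ in
theorem sub_darbouxTransform_mul (hk : k ≠ 0) (z : ℂ) :
    (darbouxTransform f α τ k z - f z) * darbouxNu f α τ k z = α z := by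
  rw [darbouxTransform_eq hfτ hα0 hk, sub_mul, inv_mul_cancel_right₀
    (darbouxNu_ne_zero hfτ hα0 hk z), add_sub_cancel_left]

include hτ hf hfτ hfN hα hαN hατ in
-- The identity df ∧ dν = 0, obtained by differentiating df ν = -dα.
theorem fderiv_darbouxNu_comm (z v w : ℂ) :
    fderiv ℝ f z v * fderiv ℝ (darbouxNu f α τ k) z w =
      fderiv ℝ f z w * fderiv ℝ (darbouxNu f α τ k) z v := by
  have hνd := (contDiff_darbouxNu (k := k) hf hfτ hα).differentiable (by simp) z
  have key : ∀ v w, fderiv ℝ f z v * fderiv ℝ (darbouxNu f α τ k) z w =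
      -(fderiv ℝ (fun x => fderiv ℝ α x v) z w) -
        fderiv ℝ (fun x => fderiv ℝ f x v) z w * darbouxNu f α τ k z := fun v w => by
    have hfd := (hf.fderiv_apply_const v).differentiable (by simp) z
    have h1 : (fun x => fderiv ℝ f x v * darbouxNu f α τ k x) = fun x => -fderiv ℝ α x v :=
      funext fun x => fderiv_mul_darbouxNu hτ hfτ hfN hαN hατ x v
    have h2 := congrArg (fun g => fderiv ℝ g z w) h1
    rw [fderiv_fun_mul' hfd hνd, fderiv_fun_neg] at h2
    rw [eq_sub_iff_add_eq]
    exact h2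
  rw [key v w, key w v, fderiv_fderiv_comm hf, fderiv_fderiv_comm hα]

include hτ hf hfτ hfN hα hα0 hαN hατ in
-- Differentiate (g - f) ν = α for the transform g, and insert df ν = -dα.
theorem fderiv_darbouxTransform_mul (hk : k ≠ 0) (z v : ℂ) :
    fderiv ℝ (darbouxTransform f α τ k) z v * darbouxNu f α τ k z =
      (f z - darbouxTransform f α τ k z) * fderiv ℝ (darbouxNu f α τ k) z v := by
  have hνd := (contDiff_darbouxNu (k := k) hf hfτ hα).differentiable (by simp) z
  have hfd := hf.differentiable (by simp) z
  have hgd := (contDiff_darbouxTransform (τ := τ) (k := k) hf hα hα0).differentiable (by simp) z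
  have h1 : (fun x => (darbouxTransform f α τ k x - f x) * darbouxNu f α τ k x) = α :=
    funext (sub_darbouxTransform_mul hfτ hα0 hk)
  have h2 := congrArg (fun g => fderiv ℝ g z v) h1
  rw [fderiv_fun_mul' (hgd.fun_sub hfd) hνd, fderiv_fun_sub hgd hfd] at h2
  have h3 : (darbouxTransform f α τ k z - f z) * fderiv ℝ (darbouxNu f α τ k) z v +
      (fderiv ℝ (darbouxTransform f α τ k) z v - fderiv ℝ f z v) * darbouxNu f α τ k z =
        fderiv ℝ α z v := h2
  have h4 := fderiv_mul_darbouxNu hτ hfτ hfN hαN hατ z v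
  rw [sub_mul (fderiv ℝ (darbouxTransform f α τ k) z v), h4] at h3
  have h5 : fderiv ℝ (darbouxTransform f α τ k) z v * darbouxNu f α τ k z =
      -((darbouxTransform f α τ k z - f z) * fderiv ℝ (darbouxNu f α τ k) z v) := by
    rw [eq_neg_iff_add_eq_zero, add_comm]
    have := sub_eq_zero.2 h3
    rw [← this]; abel
  rw [h5, ← neg_mul, neg_sub]

include hτ hf hfτ hfN hα hα0 hαN hατ in
/-- The left normal of the Darboux transform. -/
theorem fderiv_darbouxTransform_I_mul (hk : k ≠ 0) {M : ℍ} {z : ℂ} (hM : M * M = -1)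
    (hSM : α z * (k : ℍ) * (α z)⁻¹ * M = N z * (α z * (k : ℍ) * (α z)⁻¹)) (v : ℂ) :
    fderiv ℝ (darbouxTransform f α τ k) z (Complex.I * v) =
      M * fderiv ℝ (darbouxTransform f α τ k) z v := by
  have hν := darbouxNu_ne_zero hfτ hα0 hk z
  set g := darbouxTransform f α τ k
  set S := α z * (k : ℍ) * (α z)⁻¹ with hS
  have hk' := coe_ne_zero hk
  have hS0 : S ≠ 0 := mul_ne_zero (mul_ne_zero (hα0 z) hk') (inv_ne_zero (hα0 z))
  -- This relation trades f - g for df(τ), so that df ∧ dν = 0 moves the rotation by i from ν to f,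
  -- where it is multiplication by N.
  have hfg : S * (f z - g z) = fderiv ℝ f z τ := by
    have h1 : f z - g z = α z * ((k⁻¹ : ℂ) : ℍ) * (α z)⁻¹ * fderiv ℝ f z τ := by
      simp only [g, darbouxTransform, sub_sub_cancel]
    rw [h1, coe_inv hk, hS]
    have h2 := hα0 z
    simp only [mul_assoc, inv_mul_cancel_left₀ h2, mul_inv_cancel_left₀ h2,
        mul_inv_cancel_left₀ hk']
  have h1 : fderiv ℝ g z (Complex.I * τ) = M * fderiv ℝ g z τ := by
    apply mul_right_cancel₀ hν
    apply mul_left_cancel₀ hS0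
    rw [mul_assoc M, fderiv_darbouxTransform_mul hτ hf hfτ hfN hα hα0 hαN hατ hk,
      fderiv_darbouxTransform_mul hτ hf hfτ hfN hα hα0 hαN hατ hk, ← mul_assoc, hfg,
      fderiv_darbouxNu_comm hτ hf hfτ hfN hα hαN hατ, hfN, ← mul_assoc S, hSM, ← hfg]
    simp only [mul_assoc]
    rfl
  have h2 : fderiv ℝ g z (Complex.I * (Complex.I * τ)) = M * fderiv ℝ g z (Complex.I * τ) := by
    rw [h1, ← mul_assoc, ← mul_assoc, hM, Complex.I_mul_I]
    simp
  rw [← div_mul_cancel₀ v hτ, ← mul_assoc, mul_comm Complex.I, mul_assoc,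
    map_mul_eq (fderiv ℝ g z) _ (Complex.I * τ), h2, h1, map_mul_eq (fderiv ℝ g z) _ τ, h1,
        mul_add, mul_smul_comm, mul_smul_comm]

include hτ hf hfτ hfN hα hα0 hαN hατ in
/-- If the Darboux transform is constant, then `α` is a multiple of `f` up to a constant. -/
theorem eq_of_darbouxTransform_eq_const (hk : k ≠ 0) {q : ℍ}
    (h : ∀ z, darbouxTransform f α τ k z = q) : ∃ n : ℍ, ∀ z, α z = (q - f z) * n := by
  have h1 : darbouxTransform f α τ k = fun _ => q := funext h
  have hd := (contDiff_darbouxNu (k := k) hf hfτ hα).differentiable (by simp)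
  -- For a constant transform q, (f - q) dν = 0, and f never meets q because α has no zeros.
  have h2 : ∀ z, fderiv ℝ (darbouxNu f α τ k) z = 0 := fun z => by
    ext1 v
    have h3 := fderiv_darbouxTransform_mul hτ hf hfτ hfN hα hα0 hαN hατ hk z v
    have h4 := sub_darbouxTransform_mul hfτ hα0 hk z
    rw [h1, fderiv_fun_const] at h3
    rw [h1] at h4
    have h5 : f z - q ≠ 0 := fun h0 => hα0 z (by rw [← h4, ← neg_sub, h0, neg_zero, zero_mul])
    have h6 : (0 : ℍ) * darbouxNu f α τ k z = (f z - q) * fderiv ℝ (darbouxNu f α τ k) z v := h3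
    rw [zero_mul] at h6
    exact (mul_eq_zero.1 h6.symm).resolve_left h5
  refine ⟨darbouxNu f α τ k 0, fun z => ?_⟩
  rw [is_const_of_fderiv_eq_zero hd h2 0 z, ← h z, sub_darbouxTransform_mul hfτ hα0 hk]

end Darboux

/-! ### The family of Darboux transforms -/

section ModeAlgebra

variable {κ e₀ l : ℂ}

/-- In the direction iκ⁻¹ the shifts ±1 in the two frequencies cancel, so both coordinates are
eigenfunctions for the same number l⁻¹ - l. -/
theorem fderiv_mode_direction (hκ : κ ≠ 0) (z : ℂ) :
    fderiv ℝ (mode κ e₀ l) z (Complex.I * κ⁻¹) = mode κ e₀ l z * ((l⁻¹ - l : ℂ) : ℍ) := by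
  have hκ' : conj κ ≠ 0 := by simpa using hκ
  apply ext_coord
  · rw [coordA_fderiv_mode, coordA_mul_coe, map_mul, map_inv₀, Complex.conj_I]
    generalize coordA (mode κ e₀ l z) = a
    generalize l⁻¹ = r
    field_simp
    linear_combination (l - r) * a * Complex.I_sq
  · rw [coordB_fderiv_mode, coordB_mul_coe, map_mul, map_inv₀, Complex.conj_I]
    generalize coordB (mode κ e₀ l z) = a
    generalize l⁻¹ = r
    field_simp
    linear_combination (l - r) * a * Complex.I_sq

/-- The factor by which the phase of the left normal changes. -/
def phaseFactor (l : ℂ) : ℂ := (l - 1) * (conj l + 1) / ((l + 1) * (conj l - 1))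

theorem norm_phaseFactor (h : l ^ 2 ≠ 1) : ‖phaseFactor l‖ = 1 := by
  have h1 : ‖l - 1‖ ≠ 0 := by
    rw [norm_ne_zero_iff]; intro h0; apply h; linear_combination (l + 1) * h0
  have h2 : ‖l + 1‖ ≠ 0 := by
    rw [norm_ne_zero_iff]; intro h0; apply h; linear_combination (l - 1) * h0
  have h3 : ‖conj l + 1‖ = ‖l + 1‖ := by rw [← RCLike.norm_conj (l + 1), map_add, map_one]
  have h4 : ‖conj l - 1‖ = ‖l - 1‖ := by rw [← RCLike.norm_conj (l - 1), map_sub, map_one]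
  rw [phaseFactor, norm_div, norm_mul, norm_mul, h3, h4]
  field_simp

/-- Writing the conjugate of k by the mode as `leftMul m n`, the claim splits into m ζ = conj m and
n conj(e ζ) = -e conj n for the phase factor ζ. -/
theorem mode_conjugation (he : ‖e₀‖ = 1) (hl : l ≠ 0) (h : l ^ 2 ≠ 1) (z : ℂ) :
    mode κ e₀ l z * ((l⁻¹ - l : ℂ) : ℍ) * (mode κ e₀ l z)⁻¹ *
        phaseNormal κ (e₀ * phaseFactor l) z =
      phaseNormal κ e₀ z * (mode κ e₀ l z * ((l⁻¹ - l : ℂ) : ℍ) * (mode κ e₀ l z)⁻¹) := by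
  have hne : l - 1 ≠ 0 := fun h0 => h (by linear_combination (l + 1) * h0)
  have hne' : l + 1 ≠ 0 := fun h0 => h (by linear_combination (l - 1) * h0)
  have hL1 : conj l - 1 ≠ 0 := fun h0 => hne (by
    have := congrArg conj h0; simpa using this)
  have hL : conj l ≠ 0 := by simpa using hl
  have hD : l * conj l + 1 ≠ 0 := by
    rw [Complex.mul_conj]
    exact_mod_cast (by have := Complex.normSq_nonneg l; linarith : Complex.normSq l + 1 ≠ 0)
  set e := phase κ e₀ z with he_def
  have hE : e ≠ 0 := phase_ne_zero he z
  have hEc : conj e = e⁻¹ := conj_phase he z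
  -- The solution of the linear equations saying that `leftMul m n` sends the mode to its multiple
  -- by k; their determinant is |l - 1|² + |l + 1|² = 2(|l|² + 1).
  set m : ℂ := ((l⁻¹ - l) * (l - 1) * (conj l - 1) +
    ((conj l)⁻¹ - conj l) * (l + 1) * (conj l + 1)) / (2 * (l * conj l + 1)) with hm
  set n : ℂ := e * ((l⁻¹ - l) - ((conj l)⁻¹ - conj l)) * (l - 1) * (conj l + 1) /
    (2 * (l * conj l + 1)) with hn
  have hmc : conj m = (((conj l)⁻¹ - conj l) * (l - 1) * (conj l - 1) +
      (l⁻¹ - l) * (l + 1) * (conj l + 1)) / (2 * (l * conj l + 1)) := by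
    simp only [hm, map_div₀, map_add, map_sub, map_mul, map_one, map_inv₀, Complex.conj_conj,
      Complex.conj_ofNat]
    ring_nf
  have hnc : conj n = e⁻¹ * (((conj l)⁻¹ - conj l) - (l⁻¹ - l)) * (conj l - 1) * (l + 1) /
      (2 * (l * conj l + 1)) := by
    simp only [hn, map_div₀, map_add, map_sub, map_mul, map_one, map_inv₀, Complex.conj_conj,
      Complex.conj_ofNat, hEc]
    ring_nf
  have hS : mode κ e₀ l z * ((l⁻¹ - l : ℂ) : ℍ) * (mode κ e₀ l z)⁻¹ = leftMul m n := by
    rw [mul_inv_eq_iff_eq_mul₀ (mode_ne_zero he l z)]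
    apply ext_coord
    · rw [coordA_mul_coe, coordA_leftMul, coordA_mode_eq, coordB_mode, ← he_def, hm, hn]
      field_simp
      ring
    · rw [coordB_mul_coe, coordB_leftMul, coordA_mode_eq, coordB_mode, ← he_def, hmc, hnc]
      field_simp
      ring
  have hphase : phase κ (e₀ * phaseFactor l) z = e * phaseFactor l := by
    rw [he_def, phase, phase]; ring
  have h1 : m * phaseFactor l = conj m := by
    rw [hm, hmc, phaseFactor]
    field_simp
    ring
  have hζ : conj (phaseFactor l) = (conj l - 1) * (l + 1) / ((conj l + 1) * (l - 1)) := by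
    simp only [phaseFactor, map_div₀, map_add, map_sub, map_mul, map_one, Complex.conj_conj]
  have hL2 : conj l + 1 ≠ 0 := fun h0 => hne' (by
    have := congrArg conj h0; simpa using this)
  have h2 : n * conj (e * phaseFactor l) = -(e * conj n) := by
    rw [map_mul, hEc, hζ, hn, hnc]
    field_simp
    ring
  rw [hS, phaseNormal, phaseNormal, hphase, ← he_def]
  have hA1 : coordA (1 : ℍ) = 1 / 2 := by apply Complex.ext <;> simp [coordA_apply]
  have hB1 : coordB (1 : ℍ) = 1 / 2 := by apply Complex.ext <;> simp [coordB_apply]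
  have hA2 : coordA (normalOf (e * phaseFactor l)) = Complex.I * (e * phaseFactor l) * (1 / 2) := by
    rw [← hB1, ← coordA_normalOf_mul, mul_one]
  have hB2 : coordB (normalOf (e * phaseFactor l)) =
      Complex.I * conj (e * phaseFactor l) * (1 / 2) := by
    rw [← hA1, ← coordB_normalOf_mul, mul_one]
  have hA3 : coordA (leftMul m n) = m * (1 / 2) + n * (1 / 2) := by
    conv_lhs => rw [← mul_one (leftMul m n), coordA_leftMul, hA1, hB1]
  have hB3 : coordB (leftMul m n) = conj m * (1 / 2) - conj n * (1 / 2) := by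
    conv_lhs => rw [← mul_one (leftMul m n), coordB_leftMul, hA1, hB1]
  have h3 := congrArg conj h1
  have h4 := congrArg conj h2
  simp only [map_mul, map_neg, Complex.conj_conj] at h3 h4
  apply ext_coord
  · rw [coordA_leftMul, coordA_normalOf_mul, hA2, hB2, hB3]
    linear_combination Complex.I / 2 * (e * h1 + h2)
  · rw [coordB_leftMul, coordB_normalOf_mul, hA2, hB2, hA3, map_mul]
    linear_combination Complex.I / 2 * (conj e * h3 - h4)

end ModeAlgebra

/-- The Darboux transform of `f` for a point of `ℂP¹ ∖ {1, -1}`, with values in `ℍ`. -/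
def affineFamily (f : ℂ → ℍ) (κ e₀ : ℂ) : OnePoint ℂ → ℂ → ℍ
  | none => f
  | some l => darbouxTransform f (mode κ e₀ l) (Complex.I * κ⁻¹) (l⁻¹ - l)

/-- The Darboux transforms of `f`. -/
def darbouxFamily (f : ℂ → ℍ) (κ e₀ : ℂ) (p : OnePoint ℂ) (z : ℂ) : OnePoint ℍ :=
  open Classical in
  -- For l = ±1 one has k = 0, and the convention 0⁻¹ = 0 would give f. The prolongation, however,
  -- has second component 0 and represents the point ∞.
  if p = ((1 : ℂ) : OnePoint ℂ) ∨ p = ((-1 : ℂ) : OnePoint ℂ) then OnePoint.infty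
  else (affineFamily f κ e₀ p z : OnePoint ℍ)

section Family

variable {f : ℂ → ℍ} {κ e₀ : ℂ}

theorem affineFamily_coe (l z : ℂ) : affineFamily f κ e₀ (l : OnePoint ℂ) z =
    darbouxTransform f (mode κ e₀ l) (Complex.I * κ⁻¹) (l⁻¹ - l) z := rfl

theorem coe_eq_or_iff (l : ℂ) : ((l : OnePoint ℂ) = ((1 : ℂ) : OnePoint ℂ) ∨
    (l : OnePoint ℂ) = ((-1 : ℂ) : OnePoint ℂ)) ↔ l ^ 2 = 1 := by
  rw [OnePoint.coe_eq_coe, OnePoint.coe_eq_coe]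
  rw [← sub_eq_zero (a := l ^ 2), show l ^ 2 - 1 = (l - 1) * (l + 1) by ring, mul_eq_zero,
    sub_eq_zero, add_eq_zero_iff_eq_neg]

theorem darbouxFamily_of_sq_eq {l : ℂ} (h : l ^ 2 = 1) (z : ℂ) :
    darbouxFamily f κ e₀ (l : OnePoint ℂ) z = OnePoint.infty := by
  rw [darbouxFamily, if_pos ((coe_eq_or_iff l).2 h)]

theorem darbouxFamily_of_sq_ne {l : ℂ} (h : l ^ 2 ≠ 1) (z : ℂ) :
    darbouxFamily f κ e₀ (l : OnePoint ℂ) z =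
      (darbouxTransform f (mode κ e₀ l) (Complex.I * κ⁻¹) (l⁻¹ - l) z : OnePoint ℍ) := by
  rw [darbouxFamily, if_neg (mt (coe_eq_or_iff l).1 h), affineFamily_coe]

theorem darbouxFamily_infty (z : ℂ) :
    darbouxFamily f κ e₀ OnePoint.infty z = (f z : OnePoint ℍ) := by
  rw [darbouxFamily, if_neg (by simp)]; rfl

theorem darbouxFamily_zero (z : ℂ) :
    darbouxFamily f κ e₀ ((0 : ℂ) : OnePoint ℂ) z = (f z : OnePoint ℍ) := by
  -- At l = 0 the conventions 0⁻¹ = 0 give k⁻¹ = 0, so the correction term vanishes as it should in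
  -- the limit.
  rw [darbouxFamily_of_sq_ne (by simp), darbouxTransform]
  simp

theorem norm_coe_complex (c : ℂ) : ‖(c : ℍ)‖ = ‖c‖ := by
  rw [← sq_eq_sq₀ (norm_nonneg _) (norm_nonneg _), norm_sq_eq, ← Complex.normSq_eq_norm_sq,
    Complex.normSq_apply]
  simp; ring

theorem continuous_coe_complex : Continuous (fun c : ℂ => (c : ℍ)) :=
  Quaternion.ofComplex.toLinearMap.continuous_of_finiteDimensional

/-- Conjugation by α preserves norms. So the distance to f is controlled by k alone, which settles
the behaviour at l = 0, ∞ and ±1. -/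
theorem norm_darbouxTransform_sub {α : ℂ → ℍ} {τ k z : ℂ} (h : α z ≠ 0) :
    ‖darbouxTransform f α τ k z - f z‖ = ‖k⁻¹‖ * ‖fderiv ℝ f z τ‖ := by
  have h1 : ‖α z‖ ≠ 0 := norm_ne_zero_iff.2 h
  rw [darbouxTransform, sub_sub_cancel_left, norm_neg, norm_mul, norm_mul, norm_mul, norm_inv,
    norm_coe_complex]
  field_simp

/-- The right side extends continuously across l = 0, and with 0⁻¹ = 0 the equality holds there too.
-/
theorem inv_inv_sub (l : ℂ) : (l⁻¹ - l)⁻¹ = l / (1 - l ^ 2) := by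
  by_cases hl : l = 0
  · simp [hl]
  · rw [show l⁻¹ - l = (1 - l ^ 2) / l by field_simp, inv_div]

/-- The norm of the difference of the two complex structures. -/
def familyBound : OnePoint ℂ → ℝ
  | none => 0
  | some l => ‖(l⁻¹ - l)⁻¹‖

theorem norm_affineFamily_sub (he : ‖e₀‖ = 1) (p : OnePoint ℂ) (z : ℂ) :
    ‖affineFamily f κ e₀ p z - f z‖ = familyBound p * ‖fderiv ℝ f z (Complex.I * κ⁻¹)‖ := by
  induction p using OnePoint.rec with
  | infty => exact (norm_eq_zero.2 (sub_self (f z))).trans (zero_mul _).symm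
  | coe l => exact norm_darbouxTransform_sub (mode_ne_zero he l z)

theorem continuousAt_familyBound_zero : ContinuousAt familyBound ((0 : ℂ) : OnePoint ℂ) := by
  rw [OnePoint.continuousAt_coe]
  have h1 : familyBound ∘ (fun l : ℂ => (l : OnePoint ℂ)) = fun l => ‖l / (1 - l ^ 2)‖ :=
    funext fun l => by rw [← inv_inv_sub]; rfl
  have h2 : ContinuousAt (fun l : ℂ => ‖l / (1 - l ^ 2)‖) 0 := by
    refine (ContinuousAt.div continuousAt_id (by fun_prop) (by simp)).norm
  rw [← h1] at h2
  exact h2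

theorem continuousAt_familyBound_infty : ContinuousAt familyBound OnePoint.infty := by
  rw [OnePoint.continuousAt_infty', coclosedCompact_eq_cocompact, ← Metric.cobounded_eq_cocompact]
  change Tendsto (fun l : ℂ => ‖(l⁻¹ - l)⁻¹‖) (Bornology.cobounded ℂ) (𝓝 0)
  refine squeeze_zero' (.of_forall fun l => norm_nonneg _) ?_
    ((tendsto_norm_cobounded_atTop (E := ℂ)).const_div_atTop 2)
  filter_upwards [tendsto_norm_cobounded_atTop.eventually_ge_atTop 2] with l hl
  have h1 : ‖l‖ ^ 2 - 1 ≤ ‖1 - l ^ 2‖ := by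
    have := norm_sub_norm_le (l ^ 2) 1
    rw [norm_pow, norm_one] at this
    rwa [norm_sub_rev]
  rw [inv_inv_sub, norm_div, div_le_div_iff₀ (by nlinarith) (by linarith)]
  nlinarith

theorem continuous_darbouxFamily (he : ‖e₀‖ = 1) (hf : ContDiff ℝ ∞ f)
    (hfτ : ∀ z, fderiv ℝ f z (Complex.I * κ⁻¹) ≠ 0) :
    Continuous (fun p : OnePoint ℂ × ℂ => darbouxFamily f κ e₀ p.1 p.2) := by
  have hc := (hf.fderiv_apply_const (Complex.I * κ⁻¹)).continuous
  have hfix : ∀ p : OnePoint ℂ, familyBound p = 0 → ContinuousAt familyBound p →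
      p ≠ ((1 : ℂ) : OnePoint ℂ) → p ≠ ((-1 : ℂ) : OnePoint ℂ) → ∀ z,
      ContinuousAt (fun p : OnePoint ℂ × ℂ => darbouxFamily f κ e₀ p.1 p.2) (p, z) := by
    intro p hp0 hpc h1 h2 z
    have h3 : ContinuousAt (fun p : OnePoint ℂ × ℂ => affineFamily f κ e₀ p.1 p.2) (p, z) := by
      have h4 : affineFamily f κ e₀ p z = f z := by
        have := norm_affineFamily_sub (f := f) (κ := κ) he p z
        rw [hp0, zero_mul, norm_eq_zero, sub_eq_zero] at this
        exact this
      have h5 : Tendsto (fun p : OnePoint ℂ × ℂ => affineFamily f κ e₀ p.1 p.2 - f p.2)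
          (𝓝 (p, z)) (𝓝 0) := by
        rw [tendsto_zero_iff_norm_tendsto_zero]
        simp only [norm_affineFamily_sub he]
        have h6 : ContinuousAt (fun q : OnePoint ℂ × ℂ => familyBound q.1 *
            ‖fderiv ℝ f q.2 (Complex.I * κ⁻¹)‖) (p, z) :=
          (ContinuousAt.comp (f := Prod.fst) (x := (p, z)) hpc continuousAt_fst).mul
            (hc.norm.comp continuous_snd).continuousAt
        have h7 := h6.tendsto
        simp only [hp0, zero_mul] at h7
        exact h7
      have h8 := h5.add (hf.continuous.comp continuous_snd).continuousAt.tendsto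
      simp only [sub_add_cancel, Function.comp_apply, zero_add] at h8
      rw [ContinuousAt, h4]
      exact h8
    refine (OnePoint.continuous_coe.continuousAt.comp h3).congr ?_
    filter_upwards [continuousAt_fst.eventually (isOpen_ne.mem_nhds h1),
      continuousAt_fst.eventually (isOpen_ne.mem_nhds h2)] with q hq1 hq2
    rw [darbouxFamily, if_neg (by rintro (h | h); exacts [hq1 h, hq2 h])]
    rfl
  rw [continuous_iff_continuousAt]
  rintro ⟨p, z⟩
  induction p using OnePoint.rec with
  | infty => exact hfix _ rfl continuousAt_familyBound_infty (by simp) (by simp) z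
  | coe l =>
    by_cases hl : l = 0
    · subst hl
      refine hfix _ ?_ continuousAt_familyBound_zero (by simp) (by simp) z
      change ‖((0 : ℂ)⁻¹ - 0)⁻¹‖ = 0
      simp
    have hemb : IsOpenEmbedding (Prod.map (fun l : ℂ => (l : OnePoint ℂ)) (id : ℂ → ℂ)) :=
      OnePoint.isOpenEmbedding_coe.prodMap IsOpenEmbedding.id
    rw [show ((l : OnePoint ℂ), z) = Prod.map (fun l : ℂ => (l : OnePoint ℂ)) id (l, z) from rfl,
      ← hemb.continuousAt_iff]
    by_cases hl1 : l ^ 2 = 1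
    · -- the transforms escape to infinity
      have hval : ((fun p : OnePoint ℂ × ℂ => darbouxFamily f κ e₀ p.1 p.2) ∘
          Prod.map (fun l : ℂ => (l : OnePoint ℂ)) id) (l, z) = OnePoint.infty :=
        darbouxFamily_of_sq_eq hl1 z
      rw [ContinuousAt, hval]
      refine OnePoint.hasBasis_nhds_infty.tendsto_right_iff.2 fun K hK => ?_
      obtain ⟨R, hR⟩ := hK.2.isBounded.exists_norm_le
      have h1 : ContinuousAt (fun p : ℂ × ℂ => ‖1 - p.1 ^ 2‖ * (R + ‖f p.2‖)) (l, z) := by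
        have := hf.continuous
        fun_prop
      have h2 : ContinuousAt (fun p : ℂ × ℂ => ‖p.1‖ * ‖fderiv ℝ f p.2 (Complex.I * κ⁻¹)‖)
          (l, z) := ((continuous_norm.comp continuous_fst).mul
            (hc.norm.comp continuous_snd)).continuousAt
      -- At l² = 1 the left side is 0 and the right side positive. Nearby, this inequality says that
      -- the distance of the transform to f exceeds R + |f|, which puts it outside K.
      have h3 := h1.tendsto.eventually_lt h2.tendsto (by
        rw [hl1, sub_self, norm_zero, zero_mul]
        exact mul_pos (norm_pos_iff.2 hl) (norm_pos_iff.2 (hfτ z)))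
      filter_upwards [h3] with ⟨l', z'⟩ h4
      by_cases hl' : l' ^ 2 = 1
      · exact Or.inr (darbouxFamily_of_sq_eq hl' z')
      · refine Or.inl ⟨_, ?_, (darbouxFamily_of_sq_ne hl' z').symm⟩
        intro hKm
        have h5 := hR _ hKm
        have h6 := norm_darbouxTransform_sub (f := f) (τ := Complex.I * κ⁻¹) (k := l'⁻¹ - l')
          (mode_ne_zero (κ := κ) he l' z')
        have h7 := norm_sub_le (darbouxTransform f (mode κ e₀ l') (Complex.I * κ⁻¹)
          (l'⁻¹ - l') z') (f z')
        have h8 : 0 < ‖1 - l' ^ 2‖ := norm_pos_iff.2 (sub_ne_zero.2 (Ne.symm hl'))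
        rw [h6, inv_inv_sub, norm_div, div_mul_eq_mul_div, div_le_iff₀ h8] at h7
        simp only at h4
        nlinarith
    · have hk : l⁻¹ - l ≠ 0 := fun h0 => hl1 (by
        field_simp at h0; linear_combination -h0)
      have h1 : ContinuousAt (fun p : ℂ × ℂ => mode κ e₀ p.1 p.2) (l, z) :=
        (contDiffAt_mode (p := (l, z)) hl).continuousAt
      have h2 : ContinuousAt (fun p : ℂ × ℂ => (p.1⁻¹ - p.1)⁻¹) (l, z) :=
        ((continuousAt_fst.inv₀ hl).sub continuousAt_fst).inv₀ hk
      have h3 : ContinuousAt (fun p : ℂ × ℂ => (((p.1⁻¹ - p.1)⁻¹ : ℂ) : ℍ)) (l, z) :=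
        ContinuousAt.comp (g := fun c : ℂ => (c : ℍ)) continuous_coe_complex.continuousAt h2
      have h4 : ContinuousAt (fun p : ℂ × ℂ => darbouxTransform f (mode κ e₀ p.1)
          (Complex.I * κ⁻¹) (p.1⁻¹ - p.1) p.2) (l, z) :=
        (hf.continuous.comp continuous_snd).continuousAt.sub
          (((h1.mul h3).mul (h1.inv₀ (mode_ne_zero he l z))).mul
            (hc.comp continuous_snd).continuousAt)
      refine (OnePoint.continuous_coe.continuousAt.comp h4).congr ?_
      have h5 : ∀ᶠ p : ℂ × ℂ in 𝓝 (l, z), p.1 ^ 2 ≠ 1 :=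
        ((continuous_fst.pow 2).continuousAt (x := ((l, z) : ℂ × ℂ))).eventually_ne hl1
      filter_upwards [h5] with p hp
      exact (darbouxFamily_of_sq_ne hp p.2).symm

end Family

/-! ### Darboux transforms of Hamiltonian stationary tori -/

theorem omega_eq_zero_of_normalOf {L : ℂ →L[ℝ] ℍ} {e : ℂ}
    (h : ∀ v, L (Complex.I * v) = normalOf e * L v) (v w : ℂ) : omega (L v) (L w) = 0 := by
  have hI : L Complex.I = normalOf e * L 1 := by rw [← h, mul_one]
  rw [fderiv_apply_eq L v, fderiv_apply_eq L w, hI]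
  simp only [omega, inner_eq]
  simp
  ring

/-- The factor c commutes with k⁻¹ and cancels. This gives independence of the chosen section in the
line and, with c the multiplier, periodicity. -/
theorem darbouxTransform_mul_coe (f α : ℂ → ℍ) (τ k : ℂ) {c : ℂ} (hc : c ≠ 0) :
    darbouxTransform f (fun z => α z * (c : ℍ)) τ k = darbouxTransform f α τ k := by
  have hc' := coe_ne_zero hc
  ext1 z
  have h1 : (c : ℍ) * ((k⁻¹ : ℂ) : ℍ) = ((k⁻¹ : ℂ) : ℍ) * (c : ℍ) := by
    rw [← Quaternion.coeComplex_mul, ← Quaternion.coeComplex_mul, mul_comm]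
  simp only [darbouxTransform]
  rw [mul_inv_rev, mul_assoc (α z) (c : ℍ), h1, ← mul_assoc (α z), ← mul_assoc,
    mul_inv_cancel_right₀ hc']

theorem mul_coe_eq_self_iff {q : ℍ} (hq : q ≠ 0) {c : ℂ} : q * (c : ℍ) = q ↔ c = 1 := by
  constructor
  · intro h
    by_contra hc
    have h1 : ((c - 1 : ℂ) : ℍ) = (c : ℍ) - 1 := map_sub Quaternion.ofComplex c 1
    refine mul_ne_zero hq (coe_ne_zero (sub_ne_zero.2 hc)) ?_
    rw [h1, mul_sub, h, mul_one, sub_self]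
  · rintro rfl
    rw [Quaternion.coeComplex_one, mul_one]

theorem IsHamiltonianStationaryTorus.fderiv_ne_zero {Γ : Submodule ℤ ℂ} {f : ℂ → ℍ}
    (hf : IsHamiltonianStationaryTorus Γ f) {τ : ℂ} (hτ : τ ≠ 0) (z : ℂ) :
    fderiv ℝ f z τ ≠ 0 := fun h => hf.immersion z (by
  rw [← inv_mul_cancel₀ hτ, map_mul_eq, hf.fderiv_I_mul, h, mul_zero, smul_zero, smul_zero,
    add_zero])

section TorusFamily

variable {Γ : Submodule ℤ ℂ} {f : ℂ → ℍ} {κ e₀ l : ℂ}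

theorem IsHamiltonianStationaryTorus.fderiv_I_mul_phaseNormal
    (hf : IsHamiltonianStationaryTorus Γ f) (hN : leftNormal f = phaseNormal κ e₀) (z v : ℂ) :
    fderiv ℝ f z (Complex.I * v) = phaseNormal κ e₀ z * fderiv ℝ f z v := by
  rw [hf.fderiv_I_mul, ← hf.leftNormal_eq, hN]

theorem inv_sub_ne_zero (hl : l ≠ 0) (h : l ^ 2 ≠ 1) : l⁻¹ - l ≠ 0 := fun h0 => h (by
  field_simp at h0; linear_combination -h0)

theorem isDarbouxTransform_darbouxFamily (hf : IsHamiltonianStationaryTorus Γ f)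
    (hp : IsPhase Γ κ e₀) (hN : leftNormal f = phaseNormal κ e₀) (hl : l ≠ 0) {α : ℂ → ℍ}
    (hα : α ∈ complexSpan (mode κ e₀ l)) (hα0 : α ≠ 0) :
    IsDarbouxTransform f α (darbouxFamily f κ e₀ (l : OnePoint ℂ)) := by
  obtain ⟨c, rfl⟩ := hα
  have hc : c ≠ 0 := by
    rintro rfl
    exact hα0 (by ext1 z; simp)
  have hτ : Complex.I * κ⁻¹ ≠ 0 := mul_ne_zero Complex.I_ne_zero (inv_ne_zero hp.ne_zero)
  obtain ⟨h1, h2, -⟩ := mul_coe_mem_holSections (hp.mode_mem_holSections hl) c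
  have hne : ∀ z, mode κ e₀ l z * (c : ℍ) ≠ 0 := fun z =>
    mul_ne_zero (mode_ne_zero hp.norm_eq_one l z) (coe_ne_zero hc)
  have hfτ := hf.fderiv_ne_zero hτ
  refine ⟨_, isProlongation_darbouxNu (k := l⁻¹ - l) hτ hf.smooth hfτ
    (hf.fderiv_I_mul_phaseNormal hN) h1 h2 fun z => ?_, fun z => ?_⟩
  · rw [fderiv_mul_const' (differentiable_mode l z)]
    simp only [_root_.smul_apply, MulOpposite.smul_eq_mul_unop, MulOpposite.unop_op]
    rw [fderiv_mode_direction hp.ne_zero, mul_assoc, mul_assoc, ← Quaternion.coeComplex_mul,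
      ← Quaternion.coeComplex_mul, mul_comm (c : ℂ)]
  · by_cases h : l ^ 2 = 1
    · have hk : l⁻¹ - l = 0 := by field_simp; linear_combination -h
      have hν : darbouxNu f (fun z => mode κ e₀ l z * (c : ℍ)) (Complex.I * κ⁻¹)
          (l⁻¹ - l) z = 0 := by
        rw [darbouxNu, hk, Quaternion.coeComplex_zero, mul_zero, neg_zero]
      rw [hν, darbouxFamily_of_sq_eq h, mul_zero, zero_add]
      exact ⟨fun h0 => hne z (congrArg Prod.fst h0), (if_pos rfl).symm⟩
    · have hk := inv_sub_ne_zero hl h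
      have hν := darbouxNu_ne_zero (k := l⁻¹ - l) hfτ hne hk z
      refine ⟨fun h0 => hν (congrArg Prod.snd h0), ?_⟩
      rw [toS4_of_ne_zero hν, darbouxFamily_of_sq_ne h, ← darbouxTransform_mul_coe _ _ _ _ hc,
        darbouxTransform_eq hfτ hne hk]

/-- A constant transform makes the mode equal to (q - f) n with a constant n, which is periodic. -/
theorem modeMultiplier_eq_one_of_constant (hf : IsHamiltonianStationaryTorus Γ f)
    (hp : IsPhase Γ κ e₀) (hN : leftNormal f = phaseNormal κ e₀) (hl : l ≠ 0) (h : l ^ 2 ≠ 1)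
    {q : ℍ} (hq : ∀ z, darbouxTransform f (mode κ e₀ l) (Complex.I * κ⁻¹) (l⁻¹ - l) z = q) :
    modeMultiplier Γ κ l = 1 := by
  have hτ : Complex.I * κ⁻¹ ≠ 0 := mul_ne_zero Complex.I_ne_zero (inv_ne_zero hp.ne_zero)
  obtain ⟨h1, h2, h3⟩ := hp.mode_mem_holSections hl
  obtain ⟨n, hn⟩ := eq_of_darbouxTransform_eq_const hτ hf.smooth (hf.fderiv_ne_zero hτ)
    (hf.fderiv_I_mul_phaseNormal hN) h1 (mode_ne_zero hp.norm_eq_one l) h2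
    (fderiv_mode_direction hp.ne_zero) (inv_sub_ne_zero hl h) hq
  ext γ
  have h4 := h3 γ 0
  rw [hn (0 + γ), hf.periodic γ γ.2, ← hn] at h4
  exact (mul_coe_eq_self_iff (mode_ne_zero hp.norm_eq_one l 0)).1 h4.symm

theorem IsPhase.mul_phaseFactor (hp : IsPhase Γ κ e₀) (h : l ^ 2 ≠ 1) :
    IsPhase Γ κ (e₀ * phaseFactor l) :=
  ⟨hp.ne_zero, by rw [norm_mul, hp.norm_eq_one, norm_phaseFactor h, mul_one], hp.wave_eq_one⟩

variable [DiscreteTopology Γ] [IsZLattice ℝ Γ]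

theorem finite_constant_darbouxFamily (hf : IsHamiltonianStationaryTorus Γ f)
    (hp : IsPhase Γ κ e₀) (hN : leftNormal f = phaseNormal κ e₀) :
    {l : ℂ | l ≠ 0 ∧ ∃ q, ∀ z, darbouxFamily f κ e₀ (l : OnePoint ℂ) z = q}.Finite := by
  refine ((finite_fiber hp 1).union (Set.toFinite {1, -1})).subset ?_
  rintro l ⟨hl, q, hq⟩
  by_cases h : l ^ 2 = 1
  · exact Or.inr (by simpa using h)
  · refine Or.inl ⟨hl, ?_⟩
    simp only [darbouxFamily_of_sq_ne h] at hq
    refine modeMultiplier_eq_one_of_constant hf hp hN hl h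
      (q := darbouxTransform f (mode κ e₀ l) (Complex.I * κ⁻¹) (l⁻¹ - l) 0) fun z => ?_
    exact OnePoint.coe_injective ((hq z).trans (hq 0).symm)

/-- The map g is itself a holomorphic section with trivial multiplier. Its branch points are
therefore isolated, hence countable and of measure zero, and the first variation formula applies. -/
theorem isBranchedHamiltonianStationaryTorus_of_star {g : ℂ → ℍ} (hp : IsPhase Γ κ e₀)
    (hg : ContDiff ℝ ∞ g) (hgp : IsPeriodic Γ g)
    (hstar : ∀ z v, fderiv ℝ g z (Complex.I * v) = phaseNormal κ e₀ z * fderiv ℝ g z v)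
    (hne : ∃ z, fderiv ℝ g z ≠ 0) :
    IsBranchedHamiltonianStationaryTorus Γ g (phaseNormal κ e₀) := by
  have hmem : g ∈ holSections Γ (phaseNormal κ e₀) 1 := ⟨hg, hstar, fun γ z => by
    rw [hgp γ γ.2, AddChar.one_apply, Quaternion.coeComplex_one, mul_one]⟩
  have hcd : IsClosed {z | fderiv ℝ g z = 0} ∧ IsDiscrete {z | fderiv ℝ g z = 0} := by
    rw [isClosed_and_discrete_iff]
    intro z
    rw [disjoint_principal_right]
    filter_upwards [eventually_fderiv_ne_zero hp hmem hne z] with w hw using hw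
  have hcount : {z | fderiv ℝ g z = 0}.Countable := by
    have := hcd.2.to_subtype
    exact countable_of_Lindelof_of_discrete
  refine ⟨hg, hgp, contDiff_phaseNormal κ e₀, phaseNormal_sq hp.norm_eq_one, hstar, hcd.1, hcd.2,
    fun z v w => omega_eq_zero_of_normalOf (hstar z) v w,
    isHamiltonianCritical_of_phaseNormal hp.norm_eq_one hg hgp hstar ?_⟩
  have h1 : ∀ᵐ z, z ∉ {z | fderiv ℝ g z = 0} :=
    measure_eq_zero_iff_ae_notMem.1 (hcount.measure_zero volume)
  filter_upwards [h1] with z hz h0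
  refine hz ?_
  ext1 v
  have h2 : fderiv ℝ g z Complex.I = 0 := by
    rw [← mul_one Complex.I, hstar, h0, mul_zero]
  rw [fderiv_apply_eq, h0, h2, smul_zero, smul_zero, add_zero]
  rfl

/-- Only e₀ changes under the transform, while the explicit descriptions of both spectra involve κ
alone. -/
theorem exists_isBranchedHamiltonianStationaryTorus (hf : IsHamiltonianStationaryTorus Γ f)
    (hp : IsPhase Γ κ e₀) (hN : leftNormal f = phaseNormal κ e₀) (hl : l ≠ 0)
    (hc : ¬ ∃ q, ∀ z, darbouxFamily f κ e₀ (l : OnePoint ℂ) z = q) :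
    ∃ g M : ℂ → ℍ, (∀ z, darbouxFamily f κ e₀ (l : OnePoint ℂ) z = (g z : OnePoint ℍ)) ∧
      IsBranchedHamiltonianStationaryTorus Γ g M ∧
      Spec Γ M = Spec Γ (phaseNormal κ e₀) ∧ Eig Γ M = Eig Γ (phaseNormal κ e₀) := by
  have h : l ^ 2 ≠ 1 := fun h => hc ⟨_, darbouxFamily_of_sq_eq h⟩
  have hp' := hp.mul_phaseFactor h
  have he := hp.norm_eq_one
  have hτ : Complex.I * κ⁻¹ ≠ 0 := mul_ne_zero Complex.I_ne_zero (inv_ne_zero hp.ne_zero)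
  have hk := inv_sub_ne_zero hl h
  obtain ⟨h1, h2, h3⟩ := hp.mode_mem_holSections hl
  have hg := contDiff_darbouxTransform (τ := Complex.I * κ⁻¹) (k := l⁻¹ - l) hf.smooth h1
    (mode_ne_zero he l)
  refine ⟨darbouxTransform f (mode κ e₀ l) (Complex.I * κ⁻¹) (l⁻¹ - l),
    phaseNormal κ (e₀ * phaseFactor l), darbouxFamily_of_sq_ne h,
    isBranchedHamiltonianStationaryTorus_of_star hp' hg (fun γ hγ z => ?_) (fun z v => ?_) ?_,
    by rw [Spec_phaseNormal hp, Spec_phaseNormal hp'], by rw [Eig_phaseNormal hp,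
        Eig_phaseNormal hp']⟩
  · have h4 : modeMultiplier Γ κ l ⟨γ, hγ⟩ ≠ 0 := planeWave_ne_zero _ _ _
    have h5 := congrFun (darbouxTransform_mul_coe f (mode κ e₀ l) (Complex.I * κ⁻¹) (l⁻¹ - l) h4) z
    rw [← h5]
    simp only [darbouxTransform]
    rw [h3 ⟨γ, hγ⟩ z, hf.periodic γ hγ, hf.periodic.fderiv γ hγ]
  · exact fderiv_darbouxTransform_I_mul hτ hf.smooth (hf.fderiv_ne_zero hτ)
      (hf.fderiv_I_mul_phaseNormal hN) h1 (mode_ne_zero he l) h2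
      (fderiv_mode_direction hp.ne_zero) hk (phaseNormal_sq hp'.norm_eq_one z)
      (mode_conjugation he hl h z) v
  · by_contra! h0
    refine hc ⟨(darbouxTransform f (mode κ e₀ l) (Complex.I * κ⁻¹) (l⁻¹ - l) 0 : ℍ), fun z => ?_⟩
    rw [darbouxFamily_of_sq_ne h, is_const_of_fderiv_eq_zero (hg.differentiable (by simp)) h0 z 0]

end TorusFamily

end HSTorus

end

/-! ### The theorem on the spectral curves -/

theorem mainTheorem1 (Γ : Submodule ℤ ℂ) [DiscreteTopology Γ] [IsZLattice ℝ Γ]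
    (f : ℂ → ℍ[ℝ]) (hf : IsHamiltonianStationaryTorus Γ f) :
    -- the multiplier spectral curve `S` and the eigenline spectral curve `Sₑ` exist
    (∃ (S : Type) (_ : TopologicalSpace S) (_ : ChartedSpace ℂ S) (ν : S → AddChar Γ ℂ),
      T2Space S ∧ IsManifold 𝓘(ℂ) ω S ∧
      IsNormalization (multiplierCoord Γ) (Spec Γ (leftNormal f)) ν) ∧
    (∃ (Sₑ : Type) (_ : TopologicalSpace Sₑ) (_ : ChartedSpace ℂ Sₑ)
      (νₑ : Sₑ → ℂ × AddChar Γ ℂ),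
      T2Space Sₑ ∧ IsManifold 𝓘(ℂ) ω Sₑ ∧
      IsNormalization (eigCoord Γ) (Eig Γ (leftNormal f)) νₑ) ∧
    -- and whatever normalizations represent them, the following holds
    ∀ (S : Type*) [TopologicalSpace S] [ChartedSpace ℂ S] [T2Space S] [IsManifold 𝓘(ℂ) ω S]
      (ν : S → AddChar Γ ℂ)
      (_ : IsNormalization (multiplierCoord Γ) (Spec Γ (leftNormal f)) ν)
      (Sₑ : Type*) [TopologicalSpace Sₑ] [ChartedSpace ℂ Sₑ] [T2Space Sₑ]
      [IsManifold 𝓘(ℂ) ω Sₑ] (νₑ : Sₑ → ℂ × AddChar Γ ℂ)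
      (_ : IsNormalization (eigCoord Γ) (Eig Γ (leftNormal f)) νₑ),
      -- the kernel bundle and the eigenline bundle are well defined
      (∃! L : S → Set (ℂ → ℍ[ℝ]), IsKernelBundle Γ (leftNormal f) ν L) ∧
      (∃! E : Sₑ → Set (ℂ → ℍ[ℝ]), IsEigenlineBundle Γ (leftNormal f) νₑ E) ∧
      -- `(μ, h) ↦ h` induces a unique map `Φ` of the curves, and `Φ` is biholomorphic
      ∃ Φ : Sₑ ≃ S,
        (∀ x, ν (Φ x) = (νₑ x).2) ∧
        (∀ Ψ : Sₑ → S, Continuous Ψ → (∀ x, ν (Ψ x) = (νₑ x).2) → Ψ = Φ) ∧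
        MDifferentiable 𝓘(ℂ) 𝓘(ℂ) Φ ∧ MDifferentiable 𝓘(ℂ) 𝓘(ℂ) Φ.symm ∧
        -- the two line bundles coincide
        (∀ L E, IsKernelBundle Γ (leftNormal f) ν L →
          IsEigenlineBundle Γ (leftNormal f) νₑ E → ∀ x, E x = L (Φ x)) ∧
        -- `S` compactifies to `ℂP¹` by two points, which lie over `μ = 0` and `μ = ∞`
        ∃ i : S → OnePoint ℂ, IsHolomorphicOpenEmbedding i ∧
          Set.range i = {((0 : ℂ) : OnePoint ℂ), OnePoint.infty}ᶜ ∧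
          (∀ x, ∃ w : ℂ, i (Φ x) = (w : OnePoint ℂ) ∧ (νₑ x).1 = w ^ 2) ∧
          -- the `ℂP¹`-family of Darboux transforms of `f`
          ∃ F : OnePoint ℂ → ℂ → OnePoint ℍ[ℝ],
            Continuous (fun p : OnePoint ℂ × ℂ => F p.1 p.2) ∧
            (∀ L, IsKernelBundle Γ (leftNormal f) ν L → ∀ x, ∀ α ∈ L x, α ≠ 0 →
              IsDarbouxTransform f α (F (i x))) ∧
            (∀ z, F ((0 : ℂ) : OnePoint ℂ) z = (f z : OnePoint ℍ[ℝ])) ∧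
            (∀ z, F OnePoint.infty z = (f z : OnePoint ℍ[ℝ])) ∧
            {x : S | ∃ q, ∀ z, F (i x) z = q}.Finite ∧
            ∀ x : S, (¬ ∃ q, ∀ z, F (i x) z = q) →
              ∃ g M : ℂ → ℍ[ℝ], (∀ z, F (i x) z = (g z : OnePoint ℍ[ℝ])) ∧
                IsBranchedHamiltonianStationaryTorus Γ g M ∧
                Spec Γ M = Spec Γ (leftNormal f) ∧ Eig Γ M = Eig Γ (leftNormal f) := by
  obtain ⟨κ, e₀, hp, hN⟩ := hf.exists_isPhase
  have hn := isNormalizingMap_modeMultiplier hp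
  have hnₑ := isNormalizingMap_eig hp
  rw [hN, Spec_phaseNormal hp, Eig_phaseNormal hp]
  refine ⟨⟨puncturedPlane, inferInstance, inferInstance, _, inferInstance, inferInstance,
    hn.isNormalization⟩, ⟨puncturedPlane, inferInstance, inferInstance, _, inferInstance,
    inferInstance, hnₑ.isNormalization⟩, ?_⟩
  intro S _ _ _ _ ν hν Sₑ _ _ _ _ νₑ hνₑ
  obtain ⟨ψ, hψ, hψo, hψr, hψν⟩ := IsNormalization.exists_coordinate hn hν
  obtain ⟨ψₑ, hψₑ, hψₑo, hψₑr, hψₑν⟩ := IsNormalization.exists_coordinate hnₑ hνₑ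
  have h0 : ∀ x, ψ x ≠ 0 := fun x => by
    have : ψ x ∈ Set.range ψ := ⟨x, rfl⟩
    rwa [hψr] at this
  have h0ₑ : ∀ x, ψₑ x ≠ 0 := fun x => by
    have : ψₑ x ∈ Set.range ψₑ := ⟨x, rfl⟩
    rwa [hψₑr] at this
  have hL := isKernelBundle_iff hp hψ hψo.injective h0 hψν
  have hE := isEigenlineBundle_iff hp hψₑ hψₑo.injective h0ₑ hψₑν
  refine ⟨⟨_, (hL _).2 rfl, fun L h => (hL L).1 h⟩, ⟨_, (hE _).2 rfl, fun E h => (hE E).1 h⟩, ?_⟩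
  -- Both curves have the global coordinate l, with the same range; Φ is the identity in this
  -- coordinate.
  set Φ : Sₑ ≃ S := ((Equiv.ofInjective ψₑ hψₑo.injective).trans
    (Equiv.setCongr (hψₑr.trans hψr.symm))).trans (Equiv.ofInjective ψ hψo.injective).symm
  have hΦ : ∀ x, ψ (Φ x) = ψₑ x := fun x => Equiv.apply_ofInjective_symm hψo.injective _
  have hΦ' : ∀ x, ψₑ (Φ.symm x) = ψ x := fun x => by rw [← hΦ, Φ.apply_symm_apply]
  have hΦν : ∀ x, ν (Φ x) = (νₑ x).2 := fun x => by rw [← hψν, hΦ, ← hψₑν]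
  refine ⟨Φ, hΦν, fun Ψ hΨ hΨν => ?_,
    mdifferentiable_of_comp_isOpenEmbedding hψ hψo
      (by rw [show ψ ∘ Φ = ψₑ from funext hΦ]; exact hψₑ),
    mdifferentiable_of_comp_isOpenEmbedding hψₑ hψₑo
      (by rw [show ψₑ ∘ Φ.symm = ψ from funext hΦ']; exact hψ), fun L E h1 h2 x => ?_, ?_⟩
  · ext1 x
    apply hψo.injective
    rw [hΦ]
    have := nhdsNE_neBot_surface x
    have h1 : Tendsto (fun y => ψ (Ψ y)) (𝓝[≠] x) (𝓝 (ψ (Ψ x))) :=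
      (hψo.continuous.comp hΨ).continuousAt.tendsto.mono_left nhdsWithin_le_nhds
    have h2 : Tendsto ψₑ (𝓝[≠] x) (𝓝 (ψₑ x)) :=
      hψₑo.continuous.continuousAt.tendsto.mono_left nhdsWithin_le_nhds
    refine tendsto_nhds_unique (h1.congr' ?_) h2
    -- Near every point the multiplier determines the parameter, so any lift agrees with Φ off
    -- isolated points, and continuity does the rest.
    filter_upwards [(tendsto_nhdsNE_of_injective hψₑo.continuous hψₑo.injective x).eventually
      (eventually_modeMultiplier_injective hp (h0ₑ x))] with y hy
    exact hy _ (h0 _) (by rw [hψν, hΨν, ← hψₑν])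
  · rw [(hL L).1 h1, (hE E).1 h2]
    simp only [hΦ]
  · refine ⟨fun x => (ψ x : OnePoint ℂ), isHolomorphicOpenEmbedding_coe_comp hψ hψo, ?_,
      fun x => ⟨ψₑ x, congrArg _ (hΦ x), by rw [← hψₑν]⟩, darbouxFamily f κ e₀,
      continuous_darbouxFamily hp.norm_eq_one hf.smooth (hf.fderiv_ne_zero
        (mul_ne_zero Complex.I_ne_zero (inv_ne_zero hp.ne_zero))), fun L h x α hα hα0 => ?_,
      darbouxFamily_zero, darbouxFamily_infty, ?_, fun x hx => ?_⟩
    · ext p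
      induction p using OnePoint.rec with
      | infty => simp
      | coe w =>
        have : w ∈ Set.range ψ ↔ w ≠ 0 := by rw [hψr]; rfl
        simpa using this
    · rw [(hL L).1 h] at hα
      exact isDarbouxTransform_darbouxFamily hf hp hN (h0 x) hα hα0
    · refine ((finite_constant_darbouxFamily hf hp hN).preimage
        (hψo.injective.injOn (s := Set.univ)|>.mono (Set.subset_univ _))).subset fun x hx => ?_
      exact ⟨h0 x, hx⟩
    · rw [← Spec_phaseNormal hp, ← Eig_phaseNormal hp]
      exact exists_isBranchedHamiltonianStationaryTorus hf hp hN (h0 x) hx
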